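/- **Setting.** Let $\mathbb N=\{1,2,\dots\}$, $\mathbb N_0=\mathbb N\cup\{0\}$, $U=\mathbb R^{\mathbb N}$ with the product $\gamma$ of standard Gaussian measures $\gamma_1=N(0,1)$, $\gamma_N$ the standard Gaussian measure on $\mathbb R^N$, and $X$ a complex separable Hilbert space. Let $\mathcal F$ be the set of finitely supported $\nu\in\mathbb N_0^{\mathbb N}$, with the componentwise order, and $p_\nu(1)=\prod_j(1+\nu_j)$. *Holomorphy.* Let $b\in(0,\infty)^{\mathbb N}$, $\xi,\delta>0$. Call $\varrho\in(0,\infty)^N$ admissible if $\sum_{j\le N}b_j\varrho_j\le\xi$. A function $u\in L^2(U,X;\gamma)$ is $(b,\xi,\delta,X)$-holomorphic if there are $u_N:\mathbb R^N\to X$ ($N\in\mathbb N$) with $u_N(y)=u_M(y,0,\dots,0)$ for $N<M$ such that (i) for each admissible $\varrho$, $u_N$ extends holomorphically to $\{z\in\mathbb C^N:|\operatorname{Im}z_j|<\varrho_j\ \forall j\}$; (ii) there is $\varphi_N:\mathbb R^N\to[0,\infty)$ with $\|\varphi_N\|_{L^2(\gamma_N)}\le\delta$ and $\|u_N(y+z)\|_X\le\varphi_N(y)$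 for all $y\in\mathbb R^N$, all admissible $\varrho$ and all $z\in\mathbb C^N$ with $|z_j|<\varrho_j$; (iii) $u_N(y_1,\dots,y_N)\to u(y)$ in $L^2(U,X;\gamma)$ as $N\to\infty$. Point values at finitely supported points are understood as $u(y_1,\dots,y_N,0,0,\dots):=u_N(y_1,\dots,y_N)$. *Work sequence.* Let $(\mathfrak w_l)_{l\in\mathbb N_0}\subseteq\mathbb N_0$ be strictly increasing with $\mathfrak w_0=0$, and suppose there is $K_{\mathfrak W}\ge1$ such that for all $l\in\mathbb N$: $\sum_{j=0}^l\mathfrak w_j\le K_{\mathfrak W}\mathfrak w_l$, $\ l\le K_{\mathfrak W}(1+\log\mathfrak w_l)$, $\ \mathfrak w_l\le K_{\mathfrak W}(1+\mathfrak w_{l-1})$; and for every $s>0$ there is $C_s>0$ with $\sum_{j\ge l}\mathfrak w_j^{-s}\le C_s(1+\mathfrak w_l)^{-s}$ for all $l\in\mathbb N$. *Approximations.* Let $\alpha>0$, $0<p_1<4/5$, $p_1\le p_2<1$, $\xi,\delta>0$, and let $b_1\in\ell^{p_1}(\mathbb N)$, $b_2\in\ell^{p_2}(\mathbb N)$ be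 positive sequences. Let $u,u^l\in L^2(U,X;\gamma)$ ($l\in\mathbb N$) be such that $u$ is $(b_1,\xi,\delta,X)$-holomorphic and $(b_2,\xi,\delta,X)$-holomorphic (the latter follows from the former if $b_{1,j}\le b_{2,j}$ for all $j$), and for every $l\in\mathbb N$ the difference $u-u^l$ is $(b_1,\xi,\delta,X)$-holomorphic and $(b_2,\xi,\delta\,\mathfrak w_l^{-\alpha},X)$-holomorphic, with the same point values at finitely supported points, namely those of $u$ minus those of $u^l$. *Quadrature.* Let $\chi_{n,0}<\dots<\chi_{n,n}$ be the zeros of the Hermite polynomial of degree $n+1$ (orthogonal with respect to $\gamma_1$), $\omega_{n,j}=\int_{\mathbb R}\prod_{i\ne j}\frac{y-\chi_{n,i}}{\chi_{n,j}-\chi_{n,i}}\,d\gamma_1(y)$ and, for $\nu\in\mathcal F$, $\mathbf Q_\nu f=\sum_{\mu\le\nu}\bigl(\prod_j\omega_{\nu_j,\mu_j}\bigr)f\bigl((\chi_{\nu_j,\mu_j})_j\bigr)$. For finite $\Lambda\subseteq\mathcal F$ let $\mathbf Q_\Lambda=\sum_{\nu\in\Lambda}\sigma_{\Lambda;\nu}\mathbf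 Q_\nu$ with $\sigma_{\Lambda;\nu}=\sum_{e\in\{0,1\}^{\mathbb N},\ \nu+e\in\Lambda}(-1)^{|e|}$. For levels $\mathbf l=(l_\nu)_{\nu\in\mathcal F}\subseteq\mathbb N_0$, finitely many of them nonzero, let $\Gamma_j=\{\nu:l_\nu\ge j\}$, $$\mathbf Q^{\rm ML}_{\mathbf l}u=\sum_{j\in\mathbb N}(\mathbf Q_{\Gamma_j}-\mathbf Q_{\Gamma_{j+1}})u^j,\qquad \mathrm{work}(\mathbf l)=\sum_{\nu\in\mathcal F}p_\nu(1)\sum_{j=1}^{l_\nu}\mathfrak w_j .$$ *Levels.* Let $q_1=p_1/(1-p_1)$ and let $r$ be a real number with $r>\frac{4(1+(\alpha+1)q_1/2)}{q_1}+3$. For $K>0$ put $\varrho_{i,j}=b_{i,j}^{p_i-1}\frac{\xi}{4\|b_i\|_{\ell^{p_i}}}$ ($i=1,2$) and $$c_\nu=\prod_{j\in\operatorname{supp}\nu}\max\{1,K\varrho_{1,j}\}^4\nu_j^{r-3},\qquad d_\nu=\prod_{j\in\operatorname{supp}\nu}\max\{1,K\varrho_{2,j}\}^4\nu_j^{r-3}.$$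 For $\varepsilon>0$ let $\Lambda_\varepsilon=\{\nu\in\mathcal F:c_\nu^{-1}\ge\varepsilon\}$ and define $\mathbf l_\varepsilon=(l_{\varepsilon,\nu})_\nu$ by $l_{\varepsilon,\nu}=0$ for $\nu\notin\Lambda_\varepsilon$ and, with $\tilde q_1=q_1/2$, $$l_{\varepsilon,\nu}=\max\Bigl\{j\in\mathbb N_0:\ \mathfrak w_j\le\varepsilon^{-\frac{1/2-\tilde q_1/4}{\alpha}}\,d_\nu^{-\frac1{1+2\alpha}}\Bigl(\sum_{\mu\in\Lambda_\varepsilon}d_\mu^{-\frac1{1+2\alpha}}\Bigr)^{\frac1{2\alpha}}\Bigr\},\qquad \nu\in\Lambda_\varepsilon .$$ **Theorem.** There exist constants $K>0$, $C>0$ and $n_0\in\mathbb N$ such that for every $n\in\mathbb N$ there is $\varepsilon_n>0$, with $\varepsilon_n\le1$ whenever $n\ge n_0$, such that $\mathrm{work}(\mathbf l_{\varepsilon_n})\le n$ and $$\Bigl\|\int_Uu\,d\gamma-\mathbf Q^{\rm ML}_{\mathbf l_{\varepsilon_n}}u\Bigr\|_X\le C(1+\log n)\,n^{-R},\qquad R=\min\Bigl\{\alpha,\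 \frac{\alpha(2p_1^{-1}-5/2)}{\alpha+2p_1^{-1}-2p_2^{-1}}\Bigr\}.$$ -/

import Mathlib

open MeasureTheory ProbabilityTheory Filter Topology Set

noncomputable section

namespace MLQuad

/-! ### Gaussian measures, parameter space -/

/-- The standard product Gaussian measure on `U = ℝ^∞`; coordinates are indexed by `0, 1, 2, …`. -/
def gaussU : Measure (ℕ → ℝ) := Measure.infinitePi (fun _ : ℕ => gaussianReal 0 1)

/-- The standard Gaussian measure on `ℝ^N`. -/
def gaussN (N : ℕ) : Measure (Fin N → ℝ) := Measure.pi (fun _ : Fin N => gaussianReal 0 1)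

/-- `(y_1, …, y_N) ↦ (y_1, …, y_N, 0, 0, …)`. -/
def extendZero {N : ℕ} (y : Fin N → ℝ) : ℕ → ℝ := fun j => if h : j < N then y ⟨j, h⟩ else 0

/-- `(y_1, y_2, …) ↦ (y_1, …, y_N)`. -/
def restrict (N : ℕ) (y : ℕ → ℝ) : Fin N → ℝ := fun j => y j

/-- The quasi-norm of `ℓ^p(ℕ)`, `0 < p < ∞`, for a nonnegative sequence
(used for sequences with summable `p`-th powers). -/
def lpNorm (p : ℝ) (b : ℕ → ℝ) : ℝ := (∑' j, b j ^ p) ^ (1 / p)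

/-! ### Holomorphy -/

/-- `ρ ∈ (0,∞)^N` is `(b, ξ)`-admissible. -/
def Admissible (b : ℕ → ℝ) (ξ : ℝ) {N : ℕ} (ρ : Fin N → ℝ) : Prop :=
  (∀ j, 0 < ρ j) ∧ ∑ j : Fin N, b j * ρ j ≤ ξ

/-- The strip `{z ∈ ℂ^N : |Im z_j| < ρ_j for all j}`. -/
def strip {N : ℕ} (ρ : Fin N → ℝ) : Set (Fin N → ℂ) := {z | ∀ j, |(z j).im| < ρ j}

/-- The polydisc `{z ∈ ℂ^N : |z_j| < ρ_j for all j}`. -/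
def polydisc {N : ℕ} (ρ : Fin N → ℝ) : Set (Fin N → ℂ) := {z | ∀ j, ‖z j‖ < ρ j}

/-- `(b, ξ, δ, X)`-holomorphy of `u ∈ L²(U, X; γ)`. The functions `u_N : ℝ^N → X` of the definition
are consistent, `u_N(y_1, …, y_N) = u_M(y_1, …, y_N, 0, …, 0)` for `N < M`, so that they are
encoded by the values `u(y_1, …, y_N, 0, 0, …) := u_N(y_1, …, y_N)`. The set of these points is
`γ`-null: every class in `L²(U, X; γ)` has a representative with these values, and `u` below is
such a representative. The extension to a strip is unique, since a strip is connected. -/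
structure IsHolo {X : Type*} [NormedAddCommGroup X] [InnerProductSpace ℂ X]
    (b : ℕ → ℝ) (ξ δ : ℝ) (u : (ℕ → ℝ) → X) : Prop where
  memLp : MemLp u 2 gaussU
  holo : ∀ N : ℕ, 1 ≤ N → ∃ φ : (Fin N → ℝ) → ℝ,
    (∀ y, 0 ≤ φ y) ∧ MemLp φ 2 (gaussN N) ∧ eLpNorm φ 2 (gaussN N) ≤ ENNReal.ofReal δ ∧
    ∀ ρ : Fin N → ℝ, Admissible b ξ ρ → ∃ F : (Fin N → ℂ) → X,
      DifferentiableOn ℂ F (strip ρ) ∧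
      (∀ y : Fin N → ℝ, F (fun j => (y j : ℂ)) = u (extendZero y)) ∧
      ∀ y : Fin N → ℝ, ∀ z ∈ polydisc ρ, ‖F ((fun j => (y j : ℂ)) + z)‖ ≤ φ y
  tendsto : Tendsto (fun N => eLpNorm (fun y => u y - u (extendZero (restrict N y))) 2 gaussU)
    atTop (𝓝 0)

/-! ### Work measure and discretization -/

/-- The assumptions on the work sequence `(w_l)_{l ≥ 0} ⊆ ℕ₀`. -/
structure WorkSequence (w : ℕ → ℕ) : Prop where
  strictMono : StrictMono w
  zero : w 0 = 0
  growth : ∃ K : ℝ, 1 ≤ K ∧ ∀ l : ℕ, 1 ≤ l →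
    (∑ j ∈ Finset.range (l + 1), (w j : ℝ)) ≤ K * w l ∧
    (l : ℝ) ≤ K * (1 + Real.log (w l)) ∧
    (w l : ℝ) ≤ K * (1 + w (l - 1))
  tail : ∀ r : ℝ, 0 < r → ∃ C : ℝ, 0 < C ∧ ∀ l : ℕ, 1 ≤ l →
    Summable (fun j : ℕ => (w (l + j) : ℝ) ^ (-r)) ∧
    ∑' j : ℕ, (w (l + j) : ℝ) ^ (-r) ≤ C * (1 + (w l : ℝ)) ^ (-r)

/-- The assumptions on `u` and its approximations `u^l`, `l ≥ 1` (the value `v 0` is never used). -/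
structure MLAssumption {X : Type*} [NormedAddCommGroup X] [InnerProductSpace ℂ X]
    (w : ℕ → ℕ) (α p₁ p₂ ξ δ : ℝ) (b₁ b₂ : ℕ → ℝ)
    (u : (ℕ → ℝ) → X) (v : ℕ → (ℕ → ℝ) → X) : Prop where
  work : WorkSequence w
  p₁_pos : 0 < p₁
  p₁_le_p₂ : p₁ ≤ p₂
  b₁_pos : ∀ j, 0 < b₁ j
  b₂_pos : ∀ j, 0 < b₂ j
  b₁_summable : Summable (fun j => b₁ j ^ p₁)
  b₂_summable : Summable (fun j => b₂ j ^ p₂)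
  ξ_pos : 0 < ξ
  δ_pos : 0 < δ
  memLp : ∀ l, 1 ≤ l → MemLp (v l) 2 gaussU
  u_holo₁ : IsHolo b₁ ξ δ u
  u_holo₂ : IsHolo b₂ ξ δ u
  diff_holo₁ : ∀ l, 1 ≤ l → IsHolo b₁ ξ δ (fun y => u y - v l y)
  diff_holo₂ : ∀ l, 1 ≤ l → IsHolo b₂ ξ (δ * (w l : ℝ) ^ (-α)) (fun y => u y - v l y)

/-! ### Smolyak–Gauss–Hermite quadrature. Multi-indices are elements of `ℕ →₀ ℕ`. -/

/-- The Gauss–Hermite nodes `χ_{n,0} < … < χ_{n,n}`: the roots of the `(n+1)`-st probabilists'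
Hermite polynomial in increasing order (the normalization of the polynomial is irrelevant). -/
def node (n j : ℕ) : ℝ :=
  (((Polynomial.hermite (n + 1)).map (Int.castRingHom ℝ)).roots.toFinset.sort (· ≤ ·)).getD j 0

/-- The weight `ω_{n,j}`: the Gaussian integral of the `j`-th Lagrange basis polynomial
`∏_{i ≠ j} (y - χ_{n,i}) / (χ_{n,j} - χ_{n,i})`. -/
def weight (n j : ℕ) : ℝ :=
  ∫ y, (Lagrange.basis (Finset.range (n + 1)) (node n) j).eval y ∂(gaussianReal 0 1)

/-- The tensor product quadrature `Q_ν`. Since `ω_{0,0} = 1`, the product of the weights is taken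
over the support of `ν`; all nodes have finitely many nonzero coordinates, as `χ_{0,0} = 0`. -/
def tensorQuad {X : Type*} [NormedAddCommGroup X] [NormedSpace ℝ X]
    (ν : ℕ →₀ ℕ) (f : (ℕ → ℝ) → X) : X :=
  ∑ μ ∈ Finset.Icc 0 ν, (∏ j ∈ ν.support, weight (ν j) (μ j)) • f (fun j => node (ν j) (μ j))

/-- The coefficient `σ_{Λ;ν} = ∑_{e ∈ {0,1}^∞, ν + e ∈ Λ} (-1)^{|e|}`, for finite `Λ`. -/
def smolyakCoeff (Λ : Set (ℕ →₀ ℕ)) (ν : ℕ →₀ ℕ) : ℝ :=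
  ∑ᶠ e ∈ {e : ℕ →₀ ℕ | (∀ j, e j ≤ 1) ∧ ν + e ∈ Λ}, (-1 : ℝ) ^ (∑ j ∈ e.support, e j)

/-- The Smolyak quadrature `Q_Λ` for finite `Λ`; `Q_∅ = 0`. -/
def smolyakQuad {X : Type*} [NormedAddCommGroup X] [NormedSpace ℝ X]
    (Λ : Set (ℕ →₀ ℕ)) (f : (ℕ → ℝ) → X) : X :=
  ∑ᶠ ν ∈ Λ, smolyakCoeff Λ ν • tensorQuad ν f

/-- `Γ_j = {ν : l_ν ≥ j}`. -/
def levelSet (l : (ℕ →₀ ℕ) → ℕ) (j : ℕ) : Set (ℕ →₀ ℕ) := {ν | j ≤ l ν}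

/-- The multilevel quadrature `∑_{j ≥ 1} (Q_{Γ_j} - Q_{Γ_{j+1}}) u^j`; only finitely many summands
are nonzero if finitely many `l_ν` are nonzero. -/
def multilevelQuad {X : Type*} [NormedAddCommGroup X] [NormedSpace ℝ X]
    (l : (ℕ →₀ ℕ) → ℕ) (v : ℕ → (ℕ → ℝ) → X) : X :=
  ∑ᶠ j ∈ Set.Ici (1 : ℕ),
    (smolyakQuad (levelSet l j) (v j) - smolyakQuad (levelSet l (j + 1)) (v j))

/-- `work(l) = ∑_ν p_ν(1) ∑_{j=1}^{l_ν} w_j` with `p_ν(1) = ∏_j (1 + ν_j)`; the value is finite only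
if finitely many `l_ν` with positive work are nonzero. -/
def work (w : ℕ → ℕ) (l : (ℕ →₀ ℕ) → ℕ) : ENNReal :=
  ∑' ν : ℕ →₀ ℕ, (((∏ j ∈ ν.support, (1 + ν j)) * ∑ j ∈ Finset.Icc 1 (l ν), w j : ℕ) : ENNReal)

/-! ### Construction of the levels -/

/-- `ϱ_j = b_j^{p-1} ξ / (4 ‖b‖_{ℓ^p})`. -/
def rhoSeq (b : ℕ → ℝ) (p ξ : ℝ) (j : ℕ) : ℝ := b j ^ (p - 1) * (ξ / (4 * lpNorm p b))

/-- `∏_{j ∈ supp ν} max{1, K ϱ_j}^4 ν_j^{r-3}`. -/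
def indexWeight (K r : ℝ) (ρ : ℕ → ℝ) (ν : ℕ →₀ ℕ) : ℝ :=
  ∏ j ∈ ν.support, max 1 (K * ρ j) ^ 4 * (ν j : ℝ) ^ (r - 3)

/-- `Λ_ε = {ν : c_ν⁻¹ ≥ ε}`. -/
def threshold (c : (ℕ →₀ ℕ) → ℝ) (ε : ℝ) : Set (ℕ →₀ ℕ) := {ν | ε ≤ (c ν)⁻¹}

/-- `ε^{-(1/2 - q/4)/α} d_ν^{-1/(1+2α)} (∑_{μ ∈ Λ_ε} d_μ^{-1/(1+2α)})^{1/(2α)}`. -/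
def targetWork (c d : (ℕ →₀ ℕ) → ℝ) (q α ε : ℝ) (ν : ℕ →₀ ℕ) : ℝ :=
  ε ^ (-((1 / 2 - q / 4) / α)) * d ν ^ (-1 / (1 + 2 * α)) *
    (∑ᶠ μ ∈ threshold c ε, d μ ^ (-1 / (1 + 2 * α))) ^ (1 / (2 * α))

open Classical in
/-- The discretization level `l_{ε,ν}`: the largest `j` with `w_j` at most the target work
if `ν ∈ Λ_ε`, and `0` otherwise. -/
def level (w : ℕ → ℕ) (c d : (ℕ →₀ ℕ) → ℝ) (q α ε : ℝ) (ν : ℕ →₀ ℕ) : ℕ :=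
  if ν ∈ threshold c ε then sSup {j : ℕ | (w j : ℝ) ≤ targetWork c d q α ε ν} else 0

end MLQuad

end

/-! Everything rests on the tensorized differences Δ_ν = ⊗_j (Q_{ν_j} - Q_{ν_j - 1}), written
`diffQuad`. For downward closed Λ the combination formula reads Q_Λ = ∑_{ν ∈ Λ} Δ_ν, so the
multilevel formula collapses to the sum of Δ_ν u^{l_ν} over l_ν ≥ 1, while ∫ u = ∑_ν Δ_ν u. With u^0
= 0, the error is at most the sum of ‖Δ_ν u‖ over ν ∉ Λ_ε plus the sum of ‖Δ_ν (u - u^{l_ν})‖ over ν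
∈ Λ_ε.

The core is `exists_diffQuad_bound`: ‖Δ_ν f‖ ≤ δ A_ν for all holomorphic f, where ∑ c_ν A_ν² < ∞
already with K = 1 (and likewise with d_ν for b₂). No Hermite expansion in infinitely many variables
is used. In one variable, Cauchy estimates and the decay of Hermite coefficients show that Q_n -
Q_{n-1} has norm O(κ⁻² n^{-t}) relative to the L² norm of the function that dominates the integrand
on discs of radius κ. Evaluation at zero, which is Q_0, has norm exp(O(κ^{-2k})). These bounds
multiply under tensor products (`enorm_tens_le`).

The radii are chosen anew for each ν. Half of the budget ξ is spread over all coordinates in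
proportion to max{1, ϱ_j}; the other half is shared, with equal contributions b_j κ_j, by the
coordinates of supp ν beyond a fixed index. The resulting κ⁻⁴ in A_ν² cancels max{1, ϱ_j}^4 in c_ν.
There remain products with a factor n^n, n being the number of large coordinates, and they are
summable because n! ∑_{|S| = n} ∏_{j ∈ S} z_j ≤ (∑ z_j)^n.

Two applications of Cauchy-Schwarz bound both parts of the error by a multiple of ε^{1/2 - q₁/8}
(`exists_error_bound`). Interpolation between the two weights bounds the work by W ε^{-ω} with ω =
`workExponent` (`exists_work_bound`). Taking W ε^{-ω} = n gives a rate at least R, and the logarithm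
in the claim is slack. -/

noncomputable section

namespace MLQuad

/-! ### Hermite polynomials and Gaussian integration by parts. -/

open Polynomial in
/-- The probabilists' Hermite polynomial with real coefficients. -/
def he (n : ℕ) : ℝ[X] := (hermite n).map (Int.castRingHom ℝ)

/-- The standard Gaussian measure on the line. -/
abbrev γ₁ : Measure ℝ := gaussianReal 0 1

open Polynomial in
lemma he_zero : he 0 = 1 := by simp [he]

open Polynomial in
lemma he_one : he 1 = X := by simp [he]

open Polynomial in
lemma he_succ (n : ℕ) : he (n + 1) = X * he n - derivative (he n) := by
  simp [he, hermite_succ, derivative_map]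

lemma he_monic (n : ℕ) : (he n).Monic := (Polynomial.hermite_monic n).map _

lemma natDegree_he (n : ℕ) : (he n).natDegree = n := by
  rw [he, (Polynomial.hermite_monic n).natDegree_map, Polynomial.natDegree_hermite]

lemma degree_he (n : ℕ) : (he n).degree = n := by
  rw [Polynomial.degree_eq_natDegree (he_monic n).ne_zero, natDegree_he]

open Polynomial in
lemma derivative_he_succ (n : ℕ) : derivative (he (n + 1)) = C ((n : ℝ) + 1) * he n := by
  induction n with
  | zero => simp [he_one, he_zero]
  | succ n ih =>
    rw [he_succ (n + 1), derivative_sub, derivative_mul, ih, derivative_mul, derivative_C,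
      derivative_X, he_succ n]
    push_cast
    simp only [map_add, map_one]
    ring

open Polynomial in
lemma iterate_derivative_he_self (n : ℕ) : derivative^[n] (he n) = C (n.factorial : ℝ) := by
  induction n with
  | zero => simp [he_zero]
  | succ n ih =>
    rw [Function.iterate_succ_apply, derivative_he_succ, Polynomial.iterate_derivative_C_mul, ih,
      ← C_mul]
    congr 1
    push_cast [Nat.factorial_succ]; ring

lemma memLp_polynomial (p : Polynomial ℝ) : MemLp (fun y => p.eval y) 2 γ₁ := by
  induction p using Polynomial.induction_on' with
  | add p q hp hq =>
    simp only [Polynomial.eval_add]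
    exact hp.add hq
  | monomial n a =>
    simp only [Polynomial.eval_monomial]
    apply MemLp.const_mul
    rw [memLp_two_iff_integrable_sq (by fun_prop)]
    have := integrable_pow_of_mem_interior_integrableExpSet (X := id) (μ := γ₁) (by simp) (2 * n)
    refine this.congr (ae_of_all _ fun y => ?_)
    simp [← pow_mul, mul_comm]

lemma integrable_polynomial (p : Polynomial ℝ) : Integrable (fun y => p.eval y) γ₁ :=
  (memLp_polynomial p).integrable one_le_two

section IBP
variable {E : Type*} [NormedAddCommGroup E] [NormedSpace ℝ E]

lemma integrable_polynomial_smul (p : Polynomial ℝ) {f : ℝ → E} (hf : MemLp f 2 γ₁) :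
    Integrable (fun y => p.eval y • f y) γ₁ := by
  rw [← memLp_one_iff_integrable]
  exact hf.smul (memLp_polynomial p)

lemma gaussianPDFReal_std (y : ℝ) :
    gaussianPDFReal 0 1 y = (Real.sqrt (2 * Real.pi))⁻¹ * Real.exp (-(y ^ 2 / 2)) := by
  simp [gaussianPDFReal, neg_div]

lemma hasDerivAt_gaussianPDFReal (y : ℝ) :
    HasDerivAt (gaussianPDFReal 0 1) (-y * gaussianPDFReal 0 1 y) y := by
  have h1 : HasDerivAt (fun y : ℝ => -(y ^ 2 / 2)) (-y) y := by
    refine (((hasDerivAt_pow 2 y).div_const 2).neg).congr_deriv ?_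
    norm_num
  rw [funext gaussianPDFReal_std]
  refine ((h1.exp).const_mul (Real.sqrt (2 * Real.pi))⁻¹).congr_deriv ?_
  ring

lemma integrable_gaussian_iff {f : ℝ → E} :
    Integrable f γ₁ ↔ Integrable (fun y => gaussianPDFReal 0 1 y • f y) volume := by
  rw [γ₁, gaussianReal_of_var_ne_zero 0 one_ne_zero, gaussianPDF_def]
  rw [integrable_withDensity_iff_integrable_smul₀' (by fun_prop) (by simp)]
  simp [ENNReal.toReal_ofReal, gaussianPDFReal_nonneg]

/-- Gaussian integration by parts. -/
lemma integral_gaussian_by_parts [CompleteSpace E] (p : Polynomial ℝ) {f f' : ℝ → E}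
    (hd : ∀ y, HasDerivAt f (f' y) y) (hf : MemLp f 2 γ₁) (hf' : MemLp f' 2 γ₁) :
    ∫ y, (Polynomial.X * p - Polynomial.derivative p).eval y • f y ∂γ₁
      = ∫ y, p.eval y • f' y ∂γ₁ := by
  have i1 := integrable_polynomial_smul (Polynomial.X * p - Polynomial.derivative p) hf
  have i2 := integrable_polynomial_smul p hf'
  have i0 := integrable_polynomial_smul p hf
  have hD : ∀ y, HasDerivAt (fun y => gaussianPDFReal 0 1 y • (p.eval y • f y))
      (gaussianPDFReal 0 1 y • (p.eval y • f' y) - gaussianPDFReal 0 1 y •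
        ((Polynomial.X * p - Polynomial.derivative p).eval y • f y)) y := by
    intro y
    refine ((hasDerivAt_gaussianPDFReal y).smul ((p.hasDerivAt y).smul (hd y))).congr_deriv ?_
    simp only [Polynomial.eval_sub, Polynomial.eval_mul, Polynomial.eval_X, Pi.smul_apply']
    module
  have := integral_eq_zero_of_hasDerivAt_of_integrable hD
    ((integrable_gaussian_iff.1 i2).sub (integrable_gaussian_iff.1 i1))
    (integrable_gaussian_iff.1 i0)
  rw [integral_sub (integrable_gaussian_iff.1 i2) (integrable_gaussian_iff.1 i1)] at this
  rw [integral_gaussianReal_eq_integral_smul one_ne_zero,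
    integral_gaussianReal_eq_integral_smul one_ne_zero]
  exact (sub_eq_zero.1 this).symm

/-- Hermite coefficients in terms of derivatives. -/
lemma integral_he_smul [CompleteSpace E] (k s : ℕ) {D : ℕ → ℝ → E}
    (hd : ∀ i y, HasDerivAt (D i) (D (i + 1) y) y) (hf : ∀ i, MemLp (D i) 2 γ₁) (i : ℕ) :
    ∫ y, (he (k + s)).eval y • D i y ∂γ₁ = ∫ y, (he k).eval y • D (i + s) y ∂γ₁ := by
  induction s generalizing i with
  | zero => rfl
  | succ s ih =>
    rw [← add_assoc, he_succ, integral_gaussian_by_parts _ (hd i) (hf i) (hf _), ih]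
    rw [show i + 1 + s = i + (s + 1) by ring]

end IBP

open Polynomial in
lemma integral_he_mul (k : ℕ) (p : ℝ[X]) :
    ∫ y, (he k).eval y * p.eval y ∂γ₁ = ∫ y, (derivative^[k] p).eval y ∂γ₁ := by
  have := integral_he_smul (E := ℝ) 0 k (D := fun i y => (derivative^[i] p).eval y)
    (fun i y => by
      simp only [Function.iterate_succ_apply']
      exact Polynomial.hasDerivAt _ y) (fun i => memLp_polynomial _) 0
  simpa [he_zero] using this

lemma integral_he_mul_of_degree_lt {k : ℕ} {p : Polynomial ℝ} (h : p.degree < k) :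
    ∫ y, (he k).eval y * p.eval y ∂γ₁ = 0 := by
  rw [integral_he_mul, Polynomial.iterate_derivative_eq_zero_of_degree_lt h]
  simp

lemma integral_he_sq (k : ℕ) : ∫ y, (he k).eval y ^ 2 ∂γ₁ = k.factorial := by
  simp_rw [sq]
  rw [integral_he_mul, iterate_derivative_he_self]
  simp

lemma integral_he_mul_he_of_ne {k m : ℕ} (h : k ≠ m) :
    ∫ y, (he k).eval y * (he m).eval y ∂γ₁ = 0 := by
  rcases h.lt_or_gt with h | h
  · rw [integral_congr_ae (ae_of_all _ fun y => mul_comm _ _)]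
    exact integral_he_mul_of_degree_lt (by rw [degree_he]; exact_mod_cast h)
  · exact integral_he_mul_of_degree_lt (by rw [degree_he]; exact_mod_cast h)

/-- Cauchy-Schwarz for square integrable functions. -/
lemma integral_norm_smul_le {α E : Type*} [MeasurableSpace α] {μ : Measure α}
    [NormedAddCommGroup E] {f : α → ℝ} {g : α → E}
    (hf : MemLp f 2 μ) (hg : MemLp g 2 μ) :
    ∫ y, ‖f y‖ * ‖g y‖ ∂μ ≤ Real.sqrt (∫ y, ‖f y‖ ^ 2 ∂μ) * Real.sqrt (∫ y, ‖g y‖ ^ 2 ∂μ) := by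
  have := integral_mul_norm_le_Lp_mul_Lq (p := 2) (q := 2) (f := f) (g := fun y => ‖g y‖) (μ := μ)
    Real.HolderConjugate.two_two (by simpa using hf) (by simpa using hg.norm)
  simpa [Real.sqrt_eq_rpow] using this

lemma sqrt_integral_he_sq (k : ℕ) :
    Real.sqrt (∫ y, ‖(he k).eval y‖ ^ 2 ∂γ₁) = Real.sqrt k.factorial := by
  simp_rw [Real.norm_eq_abs, sq_abs, integral_he_sq]

lemma norm_integral_he_smul_le {E : Type*} [NormedAddCommGroup E] [NormedSpace ℝ E] (k : ℕ)
    {f : ℝ → E} (hf : MemLp f 2 γ₁) :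
    ‖∫ y, (he k).eval y • f y ∂γ₁‖ ≤
      Real.sqrt k.factorial * Real.sqrt (∫ y, ‖f y‖ ^ 2 ∂γ₁) := by
  refine (norm_integral_le_integral_norm _).trans ?_
  simp_rw [norm_smul]
  refine (integral_norm_smul_le (memLp_polynomial (he k)) hf).trans ?_
  rw [sqrt_integral_he_sq]

/-! ### Pointwise growth of Hermite polynomials. -/

lemma norm_le_integral_norm_deriv {f f' : ℝ → ℝ} (hd : ∀ y, HasDerivAt f (f' y) y)
    (hf : Integrable f) (hf' : Integrable f') (y : ℝ) : ‖f y‖ ≤ ∫ x, ‖f' x‖ := by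
  have h0 := tendsto_zero_of_hasDerivAt_of_integrableOn_Iic (a := y) (fun x _ => hd x)
    hf'.integrableOn hf.integrableOn
  have := integral_Iic_of_hasDerivAt_of_tendsto' (a := y) (fun x _ => hd x)
    hf'.integrableOn h0
  rw [sub_zero] at this
  rw [← this]
  exact (norm_integral_le_integral_norm _).trans
    (setIntegral_le_integral hf'.norm (ae_of_all _ fun _ => norm_nonneg _))

lemma sqrt_factorial_succ_le (k : ℕ) :
    Real.sqrt (k + 1).factorial = Real.sqrt (k + 1) * Real.sqrt k.factorial := by
  rw [Nat.factorial_succ]; push_cast; rw [Real.sqrt_mul (by positivity)]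

/-- Norm of the derivative of a Hermite polynomial. -/
lemma sqrt_integral_derivative_he_sq_le (k : ℕ) :
    Real.sqrt (∫ y, ‖(Polynomial.derivative (he k)).eval y‖ ^ 2 ∂γ₁) ≤
      Real.sqrt (k + 1) * Real.sqrt k.factorial := by
  cases k with
  | zero => simp [he_zero]
  | succ k =>
    simp_rw [derivative_he_succ, Polynomial.eval_mul, norm_mul, mul_pow, Polynomial.eval_C]
    rw [integral_const_mul, Real.sqrt_mul (by positivity), sqrt_integral_he_sq,
      Real.sqrt_sq (norm_nonneg _), sqrt_factorial_succ_le, ← mul_assoc]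
    gcongr
    rw [Real.norm_eq_abs, abs_of_nonneg (by positivity)]
    have h1 : (k : ℝ) + 1 = Real.sqrt (k + 1) * Real.sqrt (k + 1) :=
      (Real.mul_self_sqrt (by positivity)).symm
    push_cast
    calc (k : ℝ) + 1 = Real.sqrt (k + 1) * Real.sqrt (k + 1) := h1
      _ ≤ _ := by gcongr; linarith

/-- The derivative of He_k² times the Gaussian density is the density times He_k (He_k' - He_{k+1}),
up to the factor that the proof tracks; its L¹ norm bounds the function and is at most 2 k! √(k+1)
by Cauchy-Schwarz. The constant 36 is not sharp; it is a square, so that its root 6 appears in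
`abs_he_le`. -/
lemma he_sq_mul_exp_le (k : ℕ) (y : ℝ) :
    (he k).eval y ^ 2 * Real.exp (-(y ^ 2 / 2)) ≤ 36 * (k.factorial * (k + 1)) := by
  have hd : ∀ y, HasDerivAt (fun y => gaussianPDFReal 0 1 y • (he k).eval y ^ 2)
      (gaussianPDFReal 0 1 y • ((he k).eval y *
        ((Polynomial.derivative (he k)).eval y - (he (k + 1)).eval y))) y := by
    intro y
    refine ((hasDerivAt_gaussianPDFReal y).smul (((he k).hasDerivAt y).pow 2)).congr_deriv ?_
    simp only [Pi.pow_apply, he_succ, Polynomial.eval_sub, Polynomial.eval_mul, Polynomial.eval_X, smul_eq_mul]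
    push_cast
    ring
  have i0 : Integrable (fun y => (he k).eval y ^ 2) γ₁ := by
    have := integrable_polynomial (he k ^ 2)
    simpa using this
  have i1 : Integrable (fun y => (he k).eval y *
        ((Polynomial.derivative (he k)).eval y - (he (k + 1)).eval y)) γ₁ := by
    simpa using integrable_polynomial (he k * (Polynomial.derivative (he k) - he (k + 1)))
  have h1 := norm_le_integral_norm_deriv hd (integrable_gaussian_iff.1 i0)
    (integrable_gaussian_iff.1 i1) y
  have h2 : ∫ x, ‖gaussianPDFReal 0 1 x • ((he k).eval x *
        ((Polynomial.derivative (he k)).eval x - (he (k + 1)).eval x))‖ =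
      ∫ x, ‖(he k).eval x *
        ((Polynomial.derivative (he k)).eval x - (he (k + 1)).eval x)‖ ∂γ₁ := by
    rw [integral_gaussianReal_eq_integral_smul one_ne_zero]
    simp_rw [norm_smul, Real.norm_eq_abs, abs_of_nonneg (gaussianPDFReal_nonneg 0 1 _), smul_eq_mul]
  rw [h2] at h1
  have h3 : ∫ x, ‖(he k).eval x *
        ((Polynomial.derivative (he k)).eval x - (he (k + 1)).eval x)‖ ∂γ₁ ≤
      Real.sqrt k.factorial * (Real.sqrt (k + 1) * Real.sqrt k.factorial) +
      Real.sqrt k.factorial * (Real.sqrt (k + 1) * Real.sqrt k.factorial) := by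
    have e1 := integral_norm_smul_le (memLp_polynomial (he k))
      (memLp_polynomial (Polynomial.derivative (he k)))
    have e2 := integral_norm_smul_le (memLp_polynomial (he k)) (memLp_polynomial (he (k + 1)))
    have j1 : Integrable (fun x => ‖(he k).eval x‖ *
        ‖(Polynomial.derivative (he k)).eval x‖) γ₁ := by
      simpa using (integrable_polynomial (he k * Polynomial.derivative (he k))).norm
    have j2 : Integrable (fun x => ‖(he k).eval x‖ * ‖(he (k + 1)).eval x‖) γ₁ := by
      simpa using (integrable_polynomial (he k * he (k + 1))).norm
    calc _ ≤ ∫ x, (‖(he k).eval x‖ * ‖(Polynomial.derivative (he k)).eval x‖ +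
          ‖(he k).eval x‖ * ‖(he (k + 1)).eval x‖) ∂γ₁ := by
            apply integral_mono i1.norm (j1.add j2)
            intro x
            simp only [norm_mul, Pi.add_apply]
            rw [← mul_add]
            exact mul_le_mul_of_nonneg_left (norm_sub_le (E := ℝ) _ _) (norm_nonneg _)
      _ ≤ _ := by
        rw [integral_add j1 j2]
        rw [sqrt_integral_he_sq] at e1 e2
        rw [sqrt_integral_he_sq, sqrt_factorial_succ_le] at e2
        have := sqrt_integral_derivative_he_sq_le k
        gcongr
        exact e1.trans (by gcongr)
  have h4 := h1.trans h3
  rw [norm_smul, Real.norm_eq_abs, Real.norm_eq_abs, abs_of_nonneg (gaussianPDFReal_nonneg 0 1 _),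
    abs_of_nonneg (sq_nonneg _), gaussianPDFReal_std] at h4
  have hpi : Real.sqrt (2 * Real.pi) ≤ 3 := by
    rw [Real.sqrt_le_iff]; constructor <;> nlinarith [Real.pi_le_four, Real.pi_lt_d2]
  have hpos : 0 < Real.sqrt (2 * Real.pi) := by positivity
  have hk : Real.sqrt (k + 1) ≤ k + 1 := by
    rw [Real.sqrt_le_iff]; constructor
    · positivity
    · nlinarith [(Nat.cast_nonneg k : (0 : ℝ) ≤ k)]
  have hf : Real.sqrt k.factorial * Real.sqrt k.factorial = k.factorial :=
    Real.mul_self_sqrt (by positivity)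
  have h5 : (he k).eval y ^ 2 * Real.exp (-(y ^ 2 / 2)) ≤ Real.sqrt (2 * Real.pi) *
      (2 * (k.factorial * Real.sqrt (k + 1))) := by
    have : (he k).eval y ^ 2 * Real.exp (-(y ^ 2 / 2)) = Real.sqrt (2 * Real.pi) *
        ((Real.sqrt (2 * Real.pi))⁻¹ * Real.exp (-(y ^ 2 / 2)) * (he k).eval y ^ 2) := by
      field_simp
    rw [this]
    refine mul_le_mul_of_nonneg_left (h4.trans (le_of_eq ?_)) hpos.le
    linear_combination 2 * Real.sqrt (k + 1) * hf
  refine h5.trans ?_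
  calc _ ≤ 3 * (2 * (k.factorial * ((k : ℝ) + 1))) := by gcongr
    _ ≤ _ := by
      have : (0 : ℝ) ≤ k.factorial * ((k : ℝ) + 1) := by positivity
      linarith

lemma abs_he_le (k : ℕ) (y : ℝ) :
    |(he k).eval y| ≤ 6 * (Real.sqrt k.factorial * Real.sqrt (k + 1)) * Real.exp (y ^ 2 / 4) := by
  apply abs_le_of_sq_le_sq _ (by positivity)
  have h := he_sq_mul_exp_le k y
  have e : Real.exp (y ^ 2 / 4) ^ 2 = Real.exp (y ^ 2 / 2) := by
    rw [← Real.exp_nat_mul]; congr 1; push_cast; ring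
  rw [mul_pow, mul_pow, mul_pow, Real.sq_sqrt (by positivity), Real.sq_sqrt (by positivity), e]
  rw [Real.exp_neg, ← div_eq_mul_inv, div_le_iff₀ (Real.exp_pos _)] at h
  linarith

lemma hasSum_of_forall_eq {ι E : Type*} [AddCommMonoid E] [TopologicalSpace E] {f g : ι → E} {a : E}
    (h : HasSum f a) (e : ∀ i, g i = f i) : HasSum g a := funext e ▸ h

/-! ### Completeness of the polynomials for the Gaussian measure. -/

lemma integrable_exp_mul_abs (t : ℝ) : Integrable (fun y : ℝ => Real.exp (t * |y|)) γ₁ := by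
  have h1 := integrable_exp_mul_gaussianReal (μ := 0) (v := 1) t
  have h2 := integrable_exp_mul_gaussianReal (μ := 0) (v := 1) (-t)
  refine (h1.add h2).mono (by fun_prop) (ae_of_all _ fun y => ?_)
  simp only [Pi.add_apply, Real.norm_eq_abs, Real.abs_exp]
  have h3 := Real.exp_pos (t * y)
  have h4 := Real.exp_pos (-t * y)
  rw [abs_of_pos (add_pos h3 h4)]
  rcases abs_cases y with ⟨h, _⟩ | ⟨h, _⟩ <;> rw [h]
  · linarith
  · rw [mul_neg, ← neg_mul]; linarith

/-- A function with Gaussian exponential moments that is orthogonal to all monomials has vanishing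
Fourier transform. -/
lemma integral_exp_mul_I_eq_zero {f : ℝ → ℝ}
    (hf : ∀ t : ℝ, Integrable (fun y => Real.exp (t * |y|) * f y) γ₁)
    (hm : ∀ k : ℕ, ∫ y, y ^ k * f y ∂γ₁ = 0) (t : ℝ) :
    ∫ y, Complex.exp (t * y * Complex.I) * (f y : ℂ) ∂γ₁ = 0 := by
  have hfm : AEStronglyMeasurable f γ₁ := by
    have := (hf 0).1
    simpa using this
  -- The exponential series is integrated term by term. The norms of its terms add up to
  -- exp(|t||y|)|f y|, which is integrable, and every term is a multiple of a moment.
  have key := hasSum_integral_of_dominated_convergence (μ := γ₁)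
    (F := fun (k : ℕ) (y : ℝ) => ((t * y * Complex.I) ^ k / (k.factorial : ℂ)) * (f y : ℂ))
    (f := fun y : ℝ => Complex.exp (t * y * Complex.I) * (f y : ℂ))
    (fun k y => (|t| * |y|) ^ k / k.factorial * |f y|)
    (fun k => by
      have : AEStronglyMeasurable (fun y : ℝ => (f y : ℂ)) γ₁ :=
        Complex.continuous_ofReal.comp_aestronglyMeasurable hfm
      refine AEStronglyMeasurable.mul ?_ this
      exact Continuous.aestronglyMeasurable (by fun_prop))
    (fun k => ae_of_all _ fun y => by simp)
    (ae_of_all _ fun y => (Real.summable_pow_div_factorial _).mul_right _)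
    (by
      refine ((hf |t|).norm).congr (ae_of_all _ fun y => ?_)
      simp only
      rw [tsum_mul_right, norm_mul, Real.norm_eq_abs, Real.abs_exp, Real.exp_eq_exp_ℝ,
        NormedSpace.exp_eq_tsum_div, Real.norm_eq_abs])
    (ae_of_all _ fun y => by
      refine HasSum.mul_right _ ?_
      rw [Complex.exp_eq_exp_ℂ]
      exact NormedSpace.expSeries_div_hasSum_exp _)
  have h0 : ∀ k : ℕ, ∫ y, ((t * y * Complex.I) ^ k / (k.factorial : ℂ)) * (f y : ℂ) ∂γ₁ = 0 := by
    intro k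
    have : ∀ y : ℝ, ((t * y * Complex.I) ^ k / (k.factorial : ℂ)) * (f y : ℂ) =
        ((t * Complex.I) ^ k / (k.factorial : ℂ)) * ((y ^ k * f y : ℝ) : ℂ) := by
      intro y; push_cast; ring
    simp_rw [this]
    rw [integral_const_mul, integral_complex_ofReal, hm]
    simp
  simp_rw [h0] at key
  exact key.unique hasSum_zero |>.symm ▸ rfl

/-- Completeness of the polynomials with respect to the Gaussian measure. -/
lemma ae_eq_zero_of_moments {f : ℝ → ℝ}
    (hf : ∀ t : ℝ, Integrable (fun y => Real.exp (t * |y|) * f y) γ₁)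
    (hm : ∀ k : ℕ, ∫ y, y ^ k * f y ∂γ₁ = 0) : f =ᵐ[γ₁] 0 := by
  have hfi : Integrable f γ₁ := by have := hf 0; simpa using this
  have hp : Integrable (fun y => max (f y) 0) γ₁ := hfi.pos_part
  have hn : Integrable (fun y => max (-f y) 0) γ₁ := hfi.neg_part
  have fin : ∀ g : ℝ → ℝ, Integrable g γ₁ → ∫⁻ y, ENNReal.ofReal (g y) ∂γ₁ ≠ ⊤ := fun g hg =>
    (lt_of_le_of_lt (lintegral_mono fun y => by
      rw [← ofReal_norm]
      exact ENNReal.ofReal_le_ofReal (le_abs_self _)) hg.2).ne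
  have := isFiniteMeasure_withDensity (fin _ hp)
  have := isFiniteMeasure_withDensity (fin _ hn)
  have hchar : ∀ g : ℝ → ℝ, Integrable g γ₁ → (∀ y, 0 ≤ g y) → ∀ t,
      charFun (γ₁.withDensity fun y => ENNReal.ofReal (g y)) t =
        ∫ y, Complex.exp (t * y * Complex.I) * (g y : ℂ) ∂γ₁ := by
    intro g hg h0 t
    rw [charFun_apply_real,
      integral_withDensity_eq_integral_toReal_smul₀ hg.1.aemeasurable.ennreal_ofReal
        (ae_of_all _ fun _ => ENNReal.ofReal_lt_top)]
    congr 1 with y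
    rw [ENNReal.toReal_ofReal (h0 y), Complex.real_smul, mul_comm]
  have hint : ∀ g : ℝ → ℝ, Integrable g γ₁ → ∀ t : ℝ,
      Integrable (fun y : ℝ => Complex.exp (t * y * Complex.I) * (g y : ℂ)) γ₁ := by
    intro g hg t
    refine (hg.ofReal (𝕜 := ℂ)).bdd_mul (c := 1)
      (Continuous.aestronglyMeasurable (by fun_prop)) (ae_of_all _ fun y => ?_)
    rw [← Complex.ofReal_mul, Complex.norm_exp_ofReal_mul_I]
  -- As densities, the positive and negative parts of `f` define finite measures. Their
  -- characteristic functions agree because the Fourier transform of `f` vanishes.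
  have heq : (γ₁.withDensity fun y => ENNReal.ofReal (max (f y) 0)) =
      γ₁.withDensity fun y => ENNReal.ofReal (max (-f y) 0) := by
    apply Measure.ext_of_charFun
    funext t
    rw [hchar _ hp (fun _ => le_max_right _ _), hchar _ hn (fun _ => le_max_right _ _),
      ← sub_eq_zero, ← integral_sub (hint _ hp t) (hint _ hn t),
      ← integral_exp_mul_I_eq_zero hf hm t]
    congr 1 with y
    rw [← mul_sub, ← Complex.ofReal_sub]
    congr 2
    rcases le_total 0 (f y) with h | h
    · rw [max_eq_left h, max_eq_right (by linarith), sub_zero]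
    · rw [max_eq_right h, max_eq_left (by linarith)]; ring
  rw [withDensity_eq_iff hp.1.aemeasurable.ennreal_ofReal hn.1.aemeasurable.ennreal_ofReal
    (fin _ hp)] at heq
  filter_upwards [heq] with y hy
  rw [ENNReal.ofReal_eq_ofReal_iff (le_max_right _ _) (le_max_right _ _)] at hy
  rcases le_total 0 (f y) with h | h
  · rw [max_eq_left h, max_eq_right (by linarith)] at hy; exact hy
  · rw [max_eq_right h, max_eq_left (by linarith)] at hy
    simp only [Pi.zero_apply]; linarith

/-! ### Decay of Hermite coefficients and pointwise convergence of Hermite series. -/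

lemma sqrt_factorial_sub_mul_le {q k : ℕ} (hq : 1 ≤ q) (hk : 2 * q ≤ k) :
    Real.sqrt (k - 2 * q).factorial * (k : ℝ) ^ q ≤ (2 * q : ℝ) ^ q * Real.sqrt k.factorial := by
  refine le_of_sq_le_sq ?_ (by positivity)
  rw [mul_pow, mul_pow, Real.sq_sqrt (by positivity), Real.sq_sqrt (by positivity), ← pow_mul,
    ← pow_mul, mul_comm q 2]
  have h1 : (k + 1 - 2 * q) ^ (2 * q) ≤ k.descFactorial (2 * q) := Nat.pow_sub_le_descFactorial _ _
  have h2 : (k - 2 * q).factorial * k.descFactorial (2 * q) = k.factorial :=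
    Nat.factorial_mul_descFactorial hk
  have h3 : k ≤ (2 * q) * (k + 1 - 2 * q) := by
    obtain ⟨m, rfl⟩ := Nat.exists_eq_add_of_le hk
    have : 2 * q + m + 1 - 2 * q = m + 1 := by omega
    rw [this]; nlinarith
  have h4 : (k - 2 * q).factorial * k ^ (2 * q) ≤ (2 * q) ^ (2 * q) * k.factorial := by
    calc _ ≤ (k - 2 * q).factorial * ((2 * q) * (k + 1 - 2 * q)) ^ (2 * q) := by gcongr
      _ = (2 * q) ^ (2 * q) * ((k - 2 * q).factorial * (k + 1 - 2 * q) ^ (2 * q)) := by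
        rw [mul_pow]; ring
      _ ≤ (2 * q) ^ (2 * q) * ((k - 2 * q).factorial * k.descFactorial (2 * q)) := by gcongr
      _ = _ := by rw [h2]
  exact_mod_cast h4

section HermiteSeries

variable {D : ℕ → ℝ → ℝ}

/-- Decay of the Hermite coefficients of a smooth function. -/
lemma hermite_coeff_bound (hd : ∀ i y, HasDerivAt (D i) (D (i + 1) y) y)
    (hf : ∀ i, MemLp (D i) 2 γ₁) {q : ℕ} (hq : 1 ≤ q) {M : ℝ}
    (hM : ∀ i, 2 ≤ i → i ≤ 2 * q → Real.sqrt (∫ y, ‖D i y‖ ^ 2 ∂γ₁) ≤ M) {k : ℕ} (hk : 2 ≤ k) :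
    |∫ y, (he k).eval y * D 0 y ∂γ₁| * (k : ℝ) ^ q ≤ (2 * q : ℝ) ^ q * Real.sqrt k.factorial * M := by
  have hM0 : 0 ≤ M := (Real.sqrt_nonneg _).trans (hM 2 le_rfl (by omega))
  -- Integrate by parts 2q times if k allows it, and k times otherwise. As k ≥ 2, only derivatives
  -- of order between 2 and 2q occur; the lower limit later yields the factor κ⁻².
  rcases le_total (2 * q) k with h | h
  · have h1 := integral_he_smul (k - 2 * q) (2 * q) hd hf 0
    rw [Nat.sub_add_cancel h, zero_add] at h1
    simp only [smul_eq_mul] at h1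
    rw [h1]
    have h2 := norm_integral_he_smul_le (k - 2 * q) (hf (2 * q))
    have h3 := hM (2 * q) (by omega) le_rfl
    calc _ ≤ (Real.sqrt (k - 2 * q).factorial * M) * (k : ℝ) ^ q := by
          gcongr
          exact h2.trans (by gcongr)
      _ = (Real.sqrt (k - 2 * q).factorial * (k : ℝ) ^ q) * M := by ring
      _ ≤ _ := mul_le_mul_of_nonneg_right (sqrt_factorial_sub_mul_le hq h) hM0
  · have h1 := integral_he_smul 0 k hd hf 0
    rw [zero_add] at h1
    simp only [smul_eq_mul] at h1
    rw [h1]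
    have h2 := norm_integral_he_smul_le 0 (hf k)
    have h3 := hM k hk h
    simp only [Nat.factorial_zero, Nat.cast_one, Real.sqrt_one, one_mul] at h2
    have h4 : (1 : ℝ) ≤ Real.sqrt k.factorial := by
      rw [Real.one_le_sqrt]; exact_mod_cast Nat.factorial_pos k
    calc _ ≤ M * (k : ℝ) ^ q := by
          gcongr
          exact h2.trans h3
      _ ≤ M * (2 * q : ℝ) ^ q := by gcongr; exact_mod_cast h
      _ ≤ _ := by
        have : M * (2 * q : ℝ) ^ q * 1 ≤ M * (2 * q : ℝ) ^ q * Real.sqrt k.factorial := by gcongr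
        linarith

/-- The factor √k! √(k+1) is the growth of He_k from `abs_he_le`. Of the t + 3 powers of k gained,
one pays for √(k+1) ≤ 2k, two are kept for summation over k, and t give the quadrature rate. -/
lemma hermite_coeff_bound' (hd : ∀ i y, HasDerivAt (D i) (D (i + 1) y) y)
    (hf : ∀ i, MemLp (D i) 2 γ₁) {t : ℕ} {M : ℝ}
    (hM : ∀ i, 2 ≤ i → i ≤ 2 * (t + 3) → Real.sqrt (∫ y, ‖D i y‖ ^ 2 ∂γ₁) ≤ M)
    {k : ℕ} (hk : 2 ≤ k) :
    |∫ y, (he k).eval y * D 0 y ∂γ₁| / k.factorial * (Real.sqrt k.factorial * Real.sqrt (k + 1)) ≤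
      2 * (2 * (t + 3 : ℕ) : ℝ) ^ (t + 3) * M / (k : ℝ) ^ (t + 2) := by
  have h := hermite_coeff_bound hd hf (q := t + 3) (by omega) hM hk
  have hk0 : (0 : ℝ) < k := by exact_mod_cast (by omega : 0 < k)
  have hs : 0 < Real.sqrt k.factorial := by
    apply Real.sqrt_pos.2; exact_mod_cast Nat.factorial_pos k
  have hs2 : (k.factorial : ℝ) = Real.sqrt k.factorial * Real.sqrt k.factorial :=
    (Real.mul_self_sqrt (by positivity)).symm
  have h1 : Real.sqrt (k + 1) ≤ 2 * k := by
    have hk2 : (2 : ℝ) ≤ k := by exact_mod_cast hk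
    rw [Real.sqrt_le_iff]; constructor
    · positivity
    · nlinarith
  rw [le_div_iff₀ (by positivity)]
  set a := |∫ y, (he k).eval y * D 0 y ∂γ₁| with ha
  have ha0 : 0 ≤ a := abs_nonneg _
  calc a / k.factorial * (Real.sqrt k.factorial * Real.sqrt (k + 1)) * (k : ℝ) ^ (t + 2)
      ≤ a / k.factorial * (Real.sqrt k.factorial * (2 * k)) * (k : ℝ) ^ (t + 2) := by gcongr
    _ = 2 * (a * (k : ℝ) ^ (t + 3)) / Real.sqrt k.factorial := by
      nth_rw 1 [hs2]; field_simp; ring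
    _ ≤ 2 * ((2 * (t + 3 : ℕ) : ℝ) ^ (t + 3) * Real.sqrt k.factorial * M) /
          Real.sqrt k.factorial := by gcongr
    _ = _ := by field_simp

lemma integrable_exp_sq_mul_exp_abs (t : ℝ) :
    Integrable (fun y : ℝ => Real.exp (t * |y|) * Real.exp (y ^ 2 / 4)) γ₁ := by
  rw [integrable_gaussian_iff]
  have h1 : Integrable (fun y : ℝ => Real.exp (-(1 / 8) * y ^ 2)) :=
    integrable_exp_neg_mul_sq (by norm_num)
  refine (h1.const_mul ((Real.sqrt (2 * Real.pi))⁻¹ * Real.exp (2 * t ^ 2))).mono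
    (Measurable.aestronglyMeasurable (by fun_prop)) (ae_of_all _ fun y => ?_)
  rw [gaussianPDFReal_std, smul_eq_mul, Real.norm_of_nonneg (by positivity),
    Real.norm_of_nonneg (by positivity), mul_assoc, mul_assoc, ← Real.exp_add, ← Real.exp_add,
    ← Real.exp_add]
  refine mul_le_mul_of_nonneg_left (Real.exp_le_exp.2 ?_) (by positivity)
  nlinarith [sq_nonneg (|y| - 4 * t), sq_abs y]

/-- Pointwise convergence of the Hermite series of a smooth function. -/
theorem hasSum_hermite (hd : ∀ i y, HasDerivAt (D i) (D (i + 1) y) y)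
    (hf : ∀ i, MemLp (D i) 2 γ₁) (y : ℝ) :
    HasSum (fun k : ℕ => (∫ x, (he k).eval x * D 0 x ∂γ₁) / k.factorial * (he k).eval y) (D 0 y) := by
  set a : ℕ → ℝ := fun k => ∫ x, (he k).eval x * D 0 x ∂γ₁ with ha
  obtain ⟨M, hM⟩ : ∃ M, ∀ i, 2 ≤ i → i ≤ 2 * (0 + 3) → Real.sqrt (∫ y, ‖D i y‖ ^ 2 ∂γ₁) ≤ M :=
    ⟨∑ i ∈ Finset.range 7, Real.sqrt (∫ y, ‖D i y‖ ^ 2 ∂γ₁), fun i _ hi =>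
      Finset.single_le_sum (f := fun i => Real.sqrt (∫ y, ‖D i y‖ ^ 2 ∂γ₁))
        (fun i _ => Real.sqrt_nonneg _) (Finset.mem_range.2 (by omega))⟩
  set c : ℕ → ℝ := fun k => |a k| / k.factorial * (Real.sqrt k.factorial * Real.sqrt (k + 1)) with hc
  have hcs : Summable c := by
    rw [← summable_nat_add_iff 2]
    refine Summable.of_nonneg_of_le (fun k => by positivity)
      (fun k => hermite_coeff_bound' hd hf hM (by omega : 2 ≤ k + 2)) ?_
    have : Summable fun k : ℕ => 1 / (k : ℝ) ^ 2 := Real.summable_one_div_nat_pow.2 one_lt_two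
    simp_rw [div_eq_mul_one_div (2 * (2 * ((0 + 3 : ℕ) : ℝ)) ^ (0 + 3) * M)]
    exact (((summable_nat_add_iff 2).2 this)).mul_left _
  set F : ℕ → ℝ → ℝ := fun k y => a k / k.factorial * (he k).eval y with hF
  have hFb : ∀ k y, |F k y| ≤ 6 * c k * Real.exp (y ^ 2 / 4) := by
    intro k y
    simp only [hF, hc, abs_mul, abs_div, Nat.abs_cast]
    calc _ ≤ |a k| / k.factorial *
          (6 * (Real.sqrt k.factorial * Real.sqrt (k + 1)) * Real.exp (y ^ 2 / 4)) := by
          gcongr; exact abs_he_le k y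
      _ = _ := by ring
  have hFs : ∀ y, Summable fun k => F k y := fun y =>
    Summable.of_norm_bounded ((hcs.mul_left 6).mul_right (Real.exp (y ^ 2 / 4))) (fun k => hFb k y)
  set h : ℝ → ℝ := fun y => ∑' k, F k y with hh
  -- After multiplication by exp(-y²/4) the series converges uniformly.
  have hcont : Continuous h := by
    have h1 : Continuous fun y => ∑' k, F k y * Real.exp (-(y ^ 2 / 4)) := by
      refine continuous_tsum (u := fun k => 6 * c k) (fun k => ?_) (hcs.mul_left 6) (fun k y => ?_)
      · simp only [hF]; fun_prop
      · rw [norm_mul, Real.norm_eq_abs, Real.norm_eq_abs, Real.abs_exp, Real.exp_neg,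
          ← div_eq_mul_inv, div_le_iff₀ (Real.exp_pos _)]
        exact hFb k y
    have h2 : h = fun y => (∑' k, F k y * Real.exp (-(y ^ 2 / 4))) * Real.exp (y ^ 2 / 4) := by
      funext y
      rw [tsum_mul_right, mul_assoc, ← Real.exp_add]; simp [hh]
    rw [h2]; fun_prop
  have hbound : ∀ y, |h y| ≤ 6 * (∑' k, c k) * Real.exp (y ^ 2 / 4) := by
    intro y
    have := tsum_of_norm_bounded (f := fun k => F k y) ((hcs.mul_left 6).mul_right (Real.exp (y ^ 2 / 4))).hasSum
      (fun k => hFb k y)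
    rwa [tsum_mul_right, tsum_mul_left] at this
  have hc0 : 0 ≤ ∑' k, c k := tsum_nonneg fun k => by positivity
  have hhint : ∀ t : ℝ, Integrable (fun y => Real.exp (t * |y|) * h y) γ₁ := by
    intro t
    refine ((integrable_exp_sq_mul_exp_abs t).const_mul (6 * ∑' k, c k)).mono
      (Continuous.aestronglyMeasurable (by fun_prop)) (ae_of_all _ fun y => ?_)
    rw [norm_mul, Real.norm_eq_abs, Real.norm_eq_abs, Real.abs_exp, Real.norm_of_nonneg
      (by positivity)]
    calc _ ≤ Real.exp (t * |y|) * (6 * (∑' k, c k) * Real.exp (y ^ 2 / 4)) := by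
          gcongr; exact hbound y
      _ = _ := by ring
  have hDint : ∀ t : ℝ, Integrable (fun y => Real.exp (t * |y|) * D 0 y) γ₁ := by
    intro t
    have : MemLp (fun y : ℝ => Real.exp (t * |y|)) 2 γ₁ := by
      rw [memLp_two_iff_integrable_sq (by fun_prop)]
      refine (integrable_exp_mul_abs (2 * t)).congr (ae_of_all _ fun y => ?_)
      simp only
      rw [← Real.exp_nat_mul]; congr 1; push_cast; ring
    exact this.integrable_mul (hf 0)
  have hpolyint : ∀ p : Polynomial ℝ, Integrable (fun y => p.eval y * h y) γ₁ := by
    intro p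
    have hp4 : ∃ B, ∀ y : ℝ, |p.eval y| ≤ B * Real.exp |y| := by
      induction p using Polynomial.induction_on' with
      | add p q hp hq =>
        obtain ⟨B, hB⟩ := hp
        obtain ⟨B', hB'⟩ := hq
        refine ⟨B + B', fun y => ?_⟩
        rw [Polynomial.eval_add, add_mul]
        exact (abs_add_le _ _).trans (add_le_add (hB y) (hB' y))
      | monomial n b =>
        refine ⟨|b| * n.factorial, fun y => ?_⟩
        have := Real.pow_div_factorial_le_exp |y| (abs_nonneg y) n
        rw [div_le_iff₀ (by positivity)] at this
        rw [Polynomial.eval_monomial, abs_mul, abs_pow, mul_assoc]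
        gcongr
        linarith
    obtain ⟨B, hB⟩ := hp4
    have := (hhint 1).const_mul B
    refine this.mono (Continuous.aestronglyMeasurable (by fun_prop)) (ae_of_all _ fun y => ?_)
    rw [norm_mul, norm_mul, norm_mul, ← mul_assoc, Real.norm_eq_abs, Real.norm_eq_abs B,
      Real.norm_of_nonneg (Real.exp_pos _).le, one_mul]
    gcongr
    exact (hB y).trans (by gcongr; exact le_abs_self B)
  -- The sum has the same Hermite coefficients as `D 0`: summability of `c` permits termwise
  -- integration, and orthogonality leaves one term.
  have hhe : ∀ m, ∫ y, (he m).eval y * h y ∂γ₁ = a m := by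
    intro m
    have hi : ∀ k, Integrable (fun y => (he m).eval y * F k y) γ₁ := by
      intro k
      have := (integrable_polynomial (he m * he k)).const_mul (a k / k.factorial)
      refine this.congr (ae_of_all _ fun y => ?_)
      simp only [Polynomial.eval_mul, hF]; ring
    have hs := hasSum_integral_of_summable_integral_norm (μ := γ₁)
      (F := fun k y => (he m).eval y * F k y) hi ?_
    · simp only [tsum_mul_left] at hs
      have e : ∀ k, k ≠ m → ∫ y, (he m).eval y * F k y ∂γ₁ = 0 := by
        intro k hk
        have : ∀ y, (he m).eval y * F k y =
            (a k / k.factorial) * ((he m).eval y * (he k).eval y) := fun y => by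
          simp only [hF]; ring
        simp_rw [this]
        rw [integral_const_mul, integral_he_mul_he_of_ne hk.symm, mul_zero]
      have e2 : ∫ y, (he m).eval y * F m y ∂γ₁ = a m := by
        have : ∀ y, (he m).eval y * F m y = (a m / m.factorial) * ((he m).eval y ^ 2) := fun y => by
          simp only [hF]; ring
        simp_rw [this]
        rw [integral_const_mul, integral_he_sq, div_mul_cancel₀]
        exact_mod_cast (Nat.factorial_pos m).ne'
      rw [← e2]
      exact (hs.unique (hasSum_single m e))
    · refine Summable.of_nonneg_of_le (fun k => integral_nonneg fun _ => norm_nonneg _) (fun k => ?_)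
        (hcs.mul_left (Real.sqrt m.factorial))
      have h1 : ∀ y, ‖(he m).eval y * F k y‖ =
          (|a k| / k.factorial) * (‖(he m).eval y‖ * ‖(he k).eval y‖) := fun y => by
        simp only [hF, norm_mul, norm_div, Real.norm_eq_abs, Nat.abs_cast]; ring
      simp_rw [h1]
      rw [integral_const_mul]
      have h2 := integral_norm_smul_le (memLp_polynomial (he m)) (memLp_polynomial (he k))
      rw [sqrt_integral_he_sq, sqrt_integral_he_sq] at h2
      have h3 : (1 : ℝ) ≤ Real.sqrt (k + 1) := by rw [Real.one_le_sqrt]; linarith [k.cast_nonneg (α := ℝ)]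
      calc _ ≤ |a k| / k.factorial * (Real.sqrt m.factorial * Real.sqrt k.factorial) := by gcongr
        _ ≤ |a k| / k.factorial * (Real.sqrt m.factorial * (Real.sqrt k.factorial * Real.sqrt (k + 1))) := by
          gcongr
          nlinarith [Real.sqrt_nonneg (k.factorial : ℝ)]
        _ = _ := by simp only [hc]; ring
  have hae : (fun y => h y - D 0 y) =ᵐ[γ₁] 0 := by
    apply ae_eq_zero_of_moments
    · intro t
      simp only [mul_sub]
      exact (hhint t).sub (hDint t)
    · have hall : ∀ p : Polynomial ℝ, ∫ y, p.eval y * (h y - D 0 y) ∂γ₁ = 0 := by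
        have hint : ∀ p : Polynomial ℝ, Integrable (fun y => p.eval y * (h y - D 0 y)) γ₁ := by
          intro p
          simp only [mul_sub]
          exact (hpolyint p).sub (integrable_polynomial_smul p (hf 0))
        have hbase : ∀ m, ∫ y, (he m).eval y * (h y - D 0 y) ∂γ₁ = 0 := by
          intro m
          simp_rw [mul_sub]
          have := integral_sub (hpolyint (he m)) (integrable_polynomial_smul (he m) (hf 0))
          simp only [smul_eq_mul] at this
          rw [this, hhe]
          simp [ha]
        -- Subtracting the leading coefficient times `he n` lowers the degree, so orthogonality to
        -- Hermite polynomials extends to all polynomials.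
        have hdeg : ∀ n : ℕ, ∀ p : Polynomial ℝ, p.degree < n →
            ∫ y, p.eval y * (h y - D 0 y) ∂γ₁ = 0 := by
          intro n
          induction n with
          | zero =>
            intro p hp
            have : p = 0 := by
              rw [← Polynomial.degree_eq_bot]; exact Nat.WithBot.lt_zero_iff.1 (by exact_mod_cast hp)
            simp [this]
          | succ n ih =>
            intro p hp
            have hq : (p - Polynomial.C (p.coeff n) * he n).degree < n := by
              rw [Polynomial.degree_lt_iff_coeff_zero]
              intro m hm
              rw [Polynomial.coeff_sub, Polynomial.coeff_C_mul]
              rcases hm.eq_or_lt with rfl | hm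
              · have : (he n).coeff n = 1 := by
                  have := (he_monic n).coeff_natDegree; rwa [natDegree_he] at this
                rw [this]; ring
              · rw [Polynomial.coeff_eq_zero_of_degree_lt (lt_of_lt_of_le hp (by exact_mod_cast hm)),
                  Polynomial.coeff_eq_zero_of_natDegree_lt (p := he n) (by rwa [natDegree_he])]
                ring
            have e : p = (p - Polynomial.C (p.coeff n) * he n) + Polynomial.C (p.coeff n) * he n := by
              ring
            rw [e]
            simp only [Polynomial.eval_add (p := p - Polynomial.C (p.coeff n) * he n), add_mul]
            rw [integral_add (hint _) (hint _), ih _ hq]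
            simp only [Polynomial.eval_mul, Polynomial.eval_C, mul_assoc]
            rw [integral_const_mul, hbase]
            ring
        intro p
        exact hdeg (p.natDegree + 1) p (lt_of_le_of_lt Polynomial.degree_le_natDegree
          (by exact_mod_cast Nat.lt_succ_self _))
      intro k
      simpa using hall (Polynomial.X ^ k)
  -- Lebesgue measure is absolutely continuous with respect to the Gaussian, and continuous
  -- functions that agree Lebesgue-almost everywhere are equal.
  have hvol : h =ᵐ[volume] D 0 := by
    have := gaussianReal_absolutelyContinuous' 0 (v := 1) one_ne_zero
    filter_upwards [this.ae_le hae] with y hy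
    simpa [sub_eq_zero] using hy
  have hD0 : Continuous (D 0) := continuous_iff_continuousAt.2 fun y => (hd 0 y).continuousAt
  have heq : h = D 0 := (hcont.ae_eq_iff_eq volume hD0).1 hvol
  have := (hFs y).hasSum
  rwa [show ∑' k, F k y = D 0 y from congrFun heq y] at this

/-- Error of a positive quadrature formula that is exact for polynomials of degree less than `m`. -/
theorem quadrature_error (t : ℕ) : ∃ C : ℝ, 0 < C ∧ ∀ (D : ℕ → ℝ → ℝ),
    (∀ i y, HasDerivAt (D i) (D (i + 1) y) y) → (∀ i, MemLp (D i) 2 γ₁) → ∀ M : ℝ,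
    (∀ i, 2 ≤ i → i ≤ 2 * (t + 3) → Real.sqrt (∫ y, ‖D i y‖ ^ 2 ∂γ₁) ≤ M) →
    ∀ (m : ℕ) (s : Finset ℕ) (ω x : ℕ → ℝ), 2 ≤ m → (∀ j ∈ s, 0 ≤ ω j) →
    (∀ p : Polynomial ℝ, p.degree < m → ∑ j ∈ s, ω j * p.eval (x j) = ∫ y, p.eval y ∂γ₁) →
    ∑ j ∈ s, ω j * Real.exp (x j ^ 2 / 4) ≤ 2 →
    |∫ y, D 0 y ∂γ₁ - ∑ j ∈ s, ω j * D 0 (x j)| ≤ C * M / (m : ℝ) ^ t := by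
  have hsum : Summable fun k : ℕ => 1 / (k : ℝ) ^ 2 := Real.summable_one_div_nat_pow.2 one_lt_two
  set S := ∑' k : ℕ, 1 / (k : ℝ) ^ 2 with hS
  have hS0 : 0 ≤ S := tsum_nonneg fun k => by positivity
  refine ⟨24 * (2 * (t + 3 : ℕ) : ℝ) ^ (t + 3) * (S + 1), by positivity, ?_⟩
  intro D hd hf M hM m s ω x hm hω hexact hexp
  have hM0 : 0 ≤ M := (Real.sqrt_nonneg _).trans (hM 2 le_rfl (by omega))
  set a : ℕ → ℝ := fun k => ∫ x, (he k).eval x * D 0 x ∂γ₁ with ha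
  have hQ : HasSum (fun k : ℕ => a k / k.factorial * ∑ j ∈ s, ω j * (he k).eval (x j))
      (∑ j ∈ s, ω j * D 0 (x j)) := by
    have := hasSum_sum (s := s) (fun j _ => (hasSum_hermite hd hf (x j)).mul_left (ω j))
    refine hasSum_of_forall_eq this fun k => ?_
    rw [Finset.mul_sum]
    exact Finset.sum_congr rfl fun j _ => by simp only [ha]; ring
  have hQ0 : ∀ k < m, k ≠ 0 → ∑ j ∈ s, ω j * (he k).eval (x j) = 0 := by
    intro k hk hk0
    rw [hexact _ (by rw [degree_he]; exact_mod_cast hk)]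
    simpa [he_zero] using integral_he_mul_he_of_ne hk0
  have hQb : ∀ k, |∑ j ∈ s, ω j * (he k).eval (x j)| ≤
      12 * (Real.sqrt k.factorial * Real.sqrt (k + 1)) := by
    intro k
    calc _ ≤ ∑ j ∈ s, |ω j * (he k).eval (x j)| := Finset.abs_sum_le_sum_abs _ _
      _ ≤ ∑ j ∈ s, (6 * (Real.sqrt k.factorial * Real.sqrt (k + 1))) *
          (ω j * Real.exp (x j ^ 2 / 4)) := by
        apply Finset.sum_le_sum
        intro j hj
        rw [abs_mul, abs_of_nonneg (hω j hj)]
        have := mul_le_mul_of_nonneg_left (abs_he_le k (x j)) (hω j hj)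
        linarith
      _ ≤ _ := by
        rw [← Finset.mul_sum]
        have : 0 ≤ Real.sqrt k.factorial * Real.sqrt (k + 1) := by positivity
        nlinarith
  have ha0 : ∫ y, D 0 y ∂γ₁ = a 0 := by simp [ha, he_zero]
  have hQ00 : a 0 / (0 : ℕ).factorial * ∑ j ∈ s, ω j * (he 0).eval (x j) = a 0 := by
    rw [hexact (he 0) (by rw [degree_he]; exact_mod_cast (by omega : 0 < m))]
    simp [he_zero]
  -- By exactness the terms 0 < k < m vanish and k = 0 reproduces the integral. The error is the
  -- Hermite tail k ≥ m, from which k^{-t} ≤ m^{-t} is extracted.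
  have hdiff : HasSum (fun k : ℕ => if k < m then 0 else
      a k / k.factorial * ∑ j ∈ s, ω j * (he k).eval (x j))
      (∑ j ∈ s, ω j * D 0 (x j) - a 0) := by
    have h0 : HasSum (fun k : ℕ => if k = 0 then a 0 else 0) (a 0) := hasSum_ite_eq 0 (a 0)
    refine hasSum_of_forall_eq (hQ.sub h0) fun k => ?_
    by_cases hk : k = 0
    · subst hk
      rw [hQ00, if_pos (by omega), if_pos rfl, sub_self]
    · by_cases hkm : k < m
      · rw [if_pos hkm, if_neg hk, hQ0 k hkm hk]; ring
      · rw [if_neg hkm, if_neg hk, sub_zero]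
  have hbd : HasSum (fun k : ℕ => 24 * (2 * (t + 3 : ℕ) : ℝ) ^ (t + 3) * M / (m : ℝ) ^ t *
      (1 / (k : ℝ) ^ 2)) (24 * (2 * (t + 3 : ℕ) : ℝ) ^ (t + 3) * M / (m : ℝ) ^ t * S) :=
    hsum.hasSum.mul_left _
  have := tsum_of_norm_bounded hbd (f := fun k : ℕ => if k < m then 0 else
      a k / k.factorial * ∑ j ∈ s, ω j * (he k).eval (x j)) (fun k => ?_)
  · rw [hdiff.tsum_eq] at this
    rw [ha0, abs_sub_comm]
    refine this.trans ?_
    rw [div_mul_eq_mul_div]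
    gcongr ?_ / _
    have : 0 ≤ 24 * (2 * (t + 3 : ℕ) : ℝ) ^ (t + 3) * M := by positivity
    nlinarith
  · split_ifs with hk
    · rw [norm_zero]; positivity
    · push Not at hk
      rw [norm_mul, norm_div, Real.norm_eq_abs, Real.norm_eq_abs, Real.norm_eq_abs, Nat.abs_cast]
      have h1 := hermite_coeff_bound' hd hf hM (hm.trans hk)
      have hm0 : (0 : ℝ) < m := by exact_mod_cast (by omega : 0 < m)
      calc |a k| / k.factorial * |∑ j ∈ s, ω j * (he k).eval (x j)|
          ≤ |a k| / k.factorial * (12 * (Real.sqrt k.factorial * Real.sqrt (k + 1))) := by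
            gcongr; exact hQb k
        _ = 12 * (|a k| / k.factorial * (Real.sqrt k.factorial * Real.sqrt (k + 1))) := by ring
        _ ≤ 12 * (2 * (2 * (t + 3 : ℕ) : ℝ) ^ (t + 3) * M / (k : ℝ) ^ (t + 2)) := by gcongr
        _ = 24 * (2 * (t + 3 : ℕ) : ℝ) ^ (t + 3) * M / (k : ℝ) ^ t * (1 / (k : ℝ) ^ 2) := by
          rw [pow_add]; field_simp; ring
        _ ≤ _ := by gcongr

end HermiteSeries

/-! ### The zeros of Hermite polynomials are real and simple. -/

section Roots
open Polynomial

/-- A Hermite polynomial has no nonconstant factor that is nonnegative on the real line. -/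
lemma he_no_nonneg_factor {N : ℕ} {q s : ℝ[X]} (h : he N = q * s) (hs : ∀ y, 0 ≤ s.eval y)
    (hd : 1 ≤ s.natDegree) : False := by
  have hne : q * s ≠ 0 := h ▸ (he_monic N).ne_zero
  have hq0 : q ≠ 0 := left_ne_zero_of_mul hne
  have hs0 : s ≠ 0 := right_ne_zero_of_mul hne
  have hdeg : q.degree < N := by
    have := natDegree_mul hq0 hs0
    rw [← h, natDegree_he] at this
    rw [degree_eq_natDegree hq0]
    exact_mod_cast (by omega : q.natDegree < N)
  -- Since `q` has degree below N, it is orthogonal to He_N; but He_N q = q² s is nonnegative and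
  -- nonzero as a polynomial.
  have h1 := integral_he_mul_of_degree_lt hdeg
  have h2 : ∀ y, (he N).eval y * q.eval y = q.eval y ^ 2 * s.eval y := fun y => by
    rw [h, eval_mul]; ring
  simp_rw [h2] at h1
  have hint : Integrable (fun y => q.eval y ^ 2 * s.eval y) γ₁ := by
    have := integrable_polynomial (q ^ 2 * s)
    simpa using this
  rw [integral_eq_zero_iff_of_nonneg (fun y => mul_nonneg (sq_nonneg _) (hs y)) hint] at h1
  have h3 := (gaussianReal_absolutelyContinuous' 0 (v := 1) one_ne_zero).ae_le h1
  have hc : Continuous fun y => q.eval y ^ 2 * s.eval y := by fun_prop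
  have h4 := (hc.ae_eq_iff_eq volume continuous_zero).1 h3
  have h5 : q ^ 2 * s = 0 := by
    apply Polynomial.funext
    intro y
    simpa using congrFun h4 y
  exact mul_ne_zero (pow_ne_zero _ hq0) hs0 h5

/-- The cofactor left after splitting off all real roots has no real zero, hence constant sign by
the intermediate value theorem. Up to sign it is a nonnegative factor, so it must be constant. -/
lemma card_roots_he (N : ℕ) : Multiset.card (he N).roots = N := by
  obtain ⟨q, hq, hdeg, hr⟩ := exists_prod_multiset_X_sub_C_mul (he N)
  rw [natDegree_he] at hdeg
  by_contra hne
  have hqd : 1 ≤ q.natDegree := by omega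
  have hq0 : q ≠ 0 := by rintro rfl; simp at hqd
  have hroot : ∀ y, q.eval y ≠ 0 := by
    intro y hy
    have : y ∈ q.roots := (mem_roots hq0).2 hy
    rw [hr] at this; simp at this
  rcases lt_or_gt_of_ne (hroot 0) with h0 | h0
  · refine he_no_nonneg_factor (N := N) (q := -(Multiset.map (fun a => X - C a) (he N).roots).prod)
      (s := -q) (by rw [neg_mul_neg, hq]) (fun y => ?_) (by rwa [natDegree_neg])
    by_contra hy
    rw [eval_neg] at hy
    have : (0 : ℝ) ∈ Set.Icc (q.eval 0) (q.eval y) := ⟨h0.le, by linarith⟩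
    obtain ⟨z, hz⟩ := mem_range_of_exists_le_of_exists_ge q.continuous ⟨0, this.1⟩ ⟨y, this.2⟩
    exact hroot z hz
  · refine he_no_nonneg_factor (N := N) (q := (Multiset.map (fun a => X - C a) (he N).roots).prod)
      (s := q) hq.symm (fun y => ?_) hqd
    by_contra hy
    push Not at hy
    obtain ⟨z, hz⟩ := mem_range_of_exists_le_of_exists_ge q.continuous ⟨y, hy.le⟩ ⟨0, h0.le⟩
    exact hroot z hz

lemma nodup_roots_he (N : ℕ) : (he N).roots.Nodup := by
  rw [Multiset.nodup_iff_count_le_one]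
  intro a
  rw [count_roots]
  by_contra h
  push Not at h
  obtain ⟨q, hq⟩ := (le_rootMultiplicity_iff (he_monic N).ne_zero (a := a) (n := 2)).1 h
  refine he_no_nonneg_factor (N := N) (q := q) (s := (X - C a) ^ 2) (by rw [hq]; ring)
    (fun y => by simp only [eval_pow]; positivity) ?_
  rw [natDegree_pow, natDegree_X_sub_C]; norm_num

lemma card_rootsFinset_he (N : ℕ) : (he N).roots.toFinset.card = N := by
  rw [Multiset.toFinset_card_of_nodup (nodup_roots_he N), card_roots_he]

lemma node_eq_orderEmb (n : ℕ) (j : Fin (n + 1)) :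
    node n j = (he (n + 1)).roots.toFinset.orderEmbOfFin (card_rootsFinset_he (n + 1)) j := by
  rw [Finset.orderEmbOfFin_apply]
  unfold node
  rw [List.getD_eq_getElem]
  · rfl

lemma node_injOn (n : ℕ) : Set.InjOn (node n) (Finset.range (n + 1)) := by
  intro i hi j hj hij
  rw [Finset.coe_range, Set.mem_Iio] at hi hj
  have h1 := node_eq_orderEmb n ⟨i, hi⟩
  have h2 := node_eq_orderEmb n ⟨j, hj⟩
  simp only at h1 h2
  rw [h1, h2] at hij
  simpa using (Finset.orderEmbOfFin _ _).injective hij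

lemma image_node (n : ℕ) : (Finset.range (n + 1)).image (node n) = (he (n + 1)).roots.toFinset := by
  rw [← Finset.image_orderEmbOfFin_univ _ (card_rootsFinset_he (n + 1))]
  ext y
  simp only [Finset.mem_image, Finset.mem_range, Finset.mem_univ, true_and]
  constructor
  · rintro ⟨j, hj, rfl⟩
    exact ⟨⟨j, hj⟩, (node_eq_orderEmb n ⟨j, hj⟩).symm⟩
  · rintro ⟨j, rfl⟩
    exact ⟨j, j.2, node_eq_orderEmb n j⟩

lemma prod_X_sub_node (n : ℕ) :
    ∏ j ∈ Finset.range (n + 1), (X - C (node n j)) = he (n + 1) := by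
  have h := prod_multiset_X_sub_C_of_monic_of_roots_card_eq (he_monic (n + 1))
    (by rw [card_roots_he, natDegree_he])
  conv_rhs => rw [← h]
  have h2 : (he (n + 1)).roots = (he (n + 1)).roots.toFinset.val := by
    rw [Multiset.toFinset_val, (nodup_roots_he _).dedup]
  rw [h2, ← image_node, Finset.image_val_of_injOn (node_injOn n), Multiset.map_map]
  rfl

lemma he_eval_node {n j : ℕ} (hj : j < n + 1) : (he (n + 1)).eval (node n j) = 0 := by
  rw [← prod_X_sub_node, eval_prod]
  exact Finset.prod_eq_zero (Finset.mem_range.2 hj) (by simp)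

lemma he_comp_neg (n : ℕ) : (he n).comp (-X) = (-1) ^ n * he n := by
  induction n with
  | zero => simp [he_zero]
  | succ n ih =>
    have h1 := congrArg derivative ih
    rw [derivative_comp] at h1
    have h2 : derivative ((-1 : ℝ[X]) ^ n * he n) = (-1) ^ n * derivative (he n) := by
      have : ((-1 : ℝ[X]) ^ n) = C ((-1 : ℝ) ^ n) := by simp
      rw [this, derivative_C_mul]
    rw [h2] at h1
    simp only [derivative_neg, derivative_X] at h1
    rw [he_succ, sub_comp, mul_comp, X_comp, ih]
    have h3 : (derivative (he n)).comp (-X) = -((-1) ^ n * derivative (he n)) := by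
      rw [← h1]; ring
    rw [h3]; ring

/-- Parity of He_{n+1} makes the node set symmetric. This exhibits He_{n+1}² as a polynomial in y²
with nonnegative roots, the form needed in `gaussQuad_pow_le`. -/
lemma he_sq_eq_prod (n : ℕ) (y : ℝ) :
    (he (n + 1)).eval y ^ 2 = ∏ j ∈ Finset.range (n + 1), (y ^ 2 - node n j ^ 2) := by
  have h1 : (he (n + 1)).eval y = ∏ j ∈ Finset.range (n + 1), (y - node n j) := by
    rw [← prod_X_sub_node, eval_prod]; simp
  have h2 : (he (n + 1)).eval (-y) = ∏ j ∈ Finset.range (n + 1), (-y - node n j) := by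
    rw [← prod_X_sub_node, eval_prod]; simp
  have h3 : (he (n + 1)).eval (-y) = (-1) ^ (n + 1) * (he (n + 1)).eval y := by
    have := congrArg (eval y) (he_comp_neg (n + 1))
    simpa using this
  have h4 : (he (n + 1)).eval y = ∏ j ∈ Finset.range (n + 1), (y + node n j) := by
    have e : ∀ j, -y - node n j = (-1) * (y + node n j) := fun j => by ring
    simp_rw [e, Finset.prod_mul_distrib, Finset.prod_const, Finset.card_range] at h2
    rw [h2] at h3
    exact (mul_left_cancel₀ (pow_ne_zero _ (by norm_num)) h3).symm
  rw [sq]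
  nth_rw 1 [h1]
  rw [h4, ← Finset.prod_mul_distrib]
  exact Finset.prod_congr rfl fun j _ => by ring

end Roots

/-! ### Exactness, positivity and stability of Gauss-Hermite quadrature. -/

section GaussQuadrature
open Polynomial

/-- The Gauss-Hermite quadrature on the line. -/
def gaussQuad {E : Type*} [AddCommGroup E] [Module ℝ E] (n : ℕ) (g : ℝ → E) : E :=
  ∑ j ∈ Finset.range (n + 1), weight n j • g (node n j)

lemma gaussQuad_of_degree_lt {n : ℕ} {p : ℝ[X]} (hp : p.degree < (n + 1 : ℕ)) :
    gaussQuad n (fun y => p.eval y) = ∫ y, p.eval y ∂γ₁ := by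
  have h := Lagrange.eq_interpolate (f := p) (node_injOn n) (by simpa using hp)
  conv_rhs => rw [h]
  simp only [Lagrange.interpolate_apply, eval_finsetSum, eval_mul, eval_C]
  rw [integral_finsetSum]
  · simp_rw [integral_const_mul]
    exact Finset.sum_congr rfl fun j _ => by rw [smul_eq_mul, mul_comm]; rfl
  · intro j _
    exact (integrable_polynomial _).const_mul _

/-- Gauss quadrature is exact for polynomials of degree at most `2 n + 1`. -/
lemma gaussQuad_exact {n : ℕ} {p : ℝ[X]} (hp : p.natDegree < 2 * (n + 1)) :
    gaussQuad n (fun y => p.eval y) = ∫ y, p.eval y ∂γ₁ := by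
  set h := he (n + 1) with hh
  have hm : h.Monic := he_monic _
  have e : p = p %ₘ h + h * (p /ₘ h) := (modByMonic_add_div p h).symm
  have hr : (p %ₘ h).degree < (n + 1 : ℕ) := by
    have := degree_modByMonic_lt p hm
    rwa [hh, degree_he] at this
  have hq : (p /ₘ h).degree < (n + 1 : ℕ) := by
    by_cases h0 : p /ₘ h = 0
    · rw [h0, degree_zero]; exact WithBot.bot_lt_coe _
    · rw [degree_eq_natDegree h0, natDegree_divByMonic p hm, hh, natDegree_he]
      exact_mod_cast (by omega)
  have e1 : gaussQuad n (fun y => p.eval y) = gaussQuad n (fun y => (p %ₘ h).eval y) := by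
    refine Finset.sum_congr rfl fun j hj => ?_
    congr 1
    conv_lhs => rw [e]
    beta_reduce
    rw [eval_add, eval_mul, hh, he_eval_node (Finset.mem_range.1 hj), zero_mul, add_zero]
  rw [e1, gaussQuad_of_degree_lt hr]
  conv_rhs => rw [e]
  simp only [eval_add, eval_mul]
  rw [integral_add (integrable_polynomial _), integral_he_mul_of_degree_lt hq, add_zero]
  have := integrable_polynomial (h * (p /ₘ h))
  simpa using this

/-- The square of the Lagrange basis polynomial has degree 2n, within the range of exactness, and
its quadrature picks out the single weight. -/
lemma weight_nonneg {n j : ℕ} (hj : j < n + 1) : 0 ≤ weight n j := by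
  set l := Lagrange.basis (Finset.range (n + 1)) (node n) j with hl
  have hjm : j ∈ Finset.range (n + 1) := Finset.mem_range.2 hj
  have hd : (l ^ 2).natDegree < 2 * (n + 1) := by
    rw [natDegree_pow, hl, Lagrange.natDegree_basis (node_injOn n) hjm]
    simp
  have h1 := gaussQuad_exact hd
  have h2 : gaussQuad n (fun y => (l ^ 2).eval y) = weight n j := by
    unfold gaussQuad
    rw [Finset.sum_eq_single_of_mem j hjm]
    · beta_reduce
      rw [eval_pow, hl, Lagrange.eval_basis_self (node_injOn n) hjm]; simp
    · intro i hi hij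
      beta_reduce
      rw [eval_pow, hl, Lagrange.eval_basis_of_ne hij.symm hi]; simp
  rw [← h2, h1]
  exact integral_nonneg fun y => by simp only [eval_pow]; positivity

/-- Synthetic division by X - a with a ≥ 0 keeps coefficients nonnegative: each coefficient of the
quotient is a sum of coefficients of the dividend times powers of a. -/
lemma exists_quotient_nonneg (s : Finset ℕ) {a : ℕ → ℝ} (ha : ∀ j, 0 ≤ a j) {p : ℝ[X]}
    (hp : ∀ i, 0 ≤ p.coeff i) :
    ∃ q r : ℝ[X], p = (∏ j ∈ s, (X - C (a j))) * q + r ∧ (∀ i, 0 ≤ q.coeff i) ∧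
      r.degree < s.card := by
  induction s using Finset.induction_on with
  | empty => exact ⟨p, 0, by simp, hp, by simp⟩
  | insert j s hj ih =>
    obtain ⟨q, r, e, hq, hr⟩ := ih
    refine ⟨q /ₘ (X - C (a j)), (∏ j ∈ s, (X - C (a j))) * (q %ₘ (X - C (a j))) + r, ?_, ?_, ?_⟩
    · rw [Finset.prod_insert hj]
      conv_lhs => rw [e, ← modByMonic_add_div q (X - C (a j))]
      ring
    · intro i
      rw [coeff_divByMonic_X_sub_C]
      exact Finset.sum_nonneg fun k _ => mul_nonneg (pow_nonneg (ha j) _) (hq k)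
    · rw [Finset.card_insert_of_notMem hj, modByMonic_X_sub_C_eq_C_eval]
      refine (degree_add_le _ _).trans_lt (max_lt ?_ (hr.trans (by exact_mod_cast Nat.lt_succ_self _)))
      refine lt_of_le_of_lt (degree_mul_le _ _) ?_
      rw [degree_prod]
      simp only [degree_X_sub_C, Finset.sum_const, nsmul_eq_mul, mul_one]
      calc (s.card : WithBot ℕ) + (C (eval (a j) q)).degree ≤ s.card + 0 := by
            gcongr; exact degree_C_le
        _ < _ := by rw [add_zero]; exact_mod_cast Nat.lt_succ_self _

/-- Division of x^k by ∏ (x - χ_j²), with x = y², gives y^{2k} = He_{n+1}(y)² q(y²) + r(y²) with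
q(y²) ≥ 0. The quadrature sees only r(y²), which it integrates exactly; the integral also contains
the nonnegative term. -/
lemma gaussQuad_pow_le (n k : ℕ) :
    gaussQuad n (fun y => (y ^ 2) ^ k) ≤ ∫ y, (y ^ 2) ^ k ∂γ₁ := by
  obtain ⟨q, r, e, hq, hr⟩ := exists_quotient_nonneg (Finset.range (n + 1))
    (a := fun j => node n j ^ 2) (fun j => sq_nonneg _) (p := X ^ k)
    (fun i => by rw [coeff_X_pow]; split_ifs <;> norm_num)
  have e2 : ∀ y : ℝ, (y ^ 2) ^ k = (he (n + 1)).eval y ^ 2 * q.eval (y ^ 2) + r.eval (y ^ 2) := by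
    intro y
    have := congrArg (eval (y ^ 2)) e
    simpa [eval_prod, ← he_sq_eq_prod] using this
  have hrd : (r.comp (X ^ 2)).natDegree < 2 * (n + 1) := by
    rw [natDegree_comp, natDegree_X_pow]
    have : r.natDegree < n + 1 := by
      by_cases h0 : r = 0
      · simp [h0]
      · rw [degree_eq_natDegree h0, Finset.card_range] at hr
        exact_mod_cast hr
    omega
  have h1 := gaussQuad_exact hrd
  simp only [eval_comp, eval_pow, eval_X] at h1
  have h2 : gaussQuad n (fun y => (y ^ 2) ^ k) = gaussQuad n (fun y => r.eval (y ^ 2)) := by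
    refine Finset.sum_congr rfl fun j hj => ?_
    congr 1
    beta_reduce
    rw [e2, he_eval_node (Finset.mem_range.1 hj)]; ring
  rw [h2, h1]
  have i1 := integrable_polynomial (r.comp (X ^ 2))
  have i2 := integrable_polynomial (X ^ (2 * k))
  simp only [eval_comp, eval_pow, eval_X, pow_mul] at i1 i2
  apply integral_mono i1 i2
  intro y
  simp only
  rw [e2]
  have : 0 ≤ q.eval (y ^ 2) := by
    rw [eval_eq_sum_range]
    exact Finset.sum_nonneg fun i _ => mul_nonneg (hq i) (by positivity)
  nlinarith [mul_nonneg (sq_nonneg ((he (n + 1)).eval y)) this]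

lemma integral_exp_sq_le : ∫ y, Real.exp (y ^ 2 / 4) ∂γ₁ ≤ 2 := by
  rw [γ₁, integral_gaussianReal_eq_integral_smul one_ne_zero]
  have : ∀ y : ℝ, gaussianPDFReal 0 1 y • Real.exp (y ^ 2 / 4) =
      (Real.sqrt (2 * Real.pi))⁻¹ * Real.exp (-(1 / 4) * y ^ 2) := by
    intro y
    rw [gaussianPDFReal_std, smul_eq_mul, mul_assoc, ← Real.exp_add]
    congr 2; ring
  simp_rw [this]
  rw [integral_const_mul, integral_gaussian, ← Real.sqrt_inv, ← Real.sqrt_mul (by positivity)]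
  rw [Real.sqrt_le_iff]
  refine ⟨by norm_num, le_of_eq_of_le (b := 2) ?_ (by norm_num)⟩
  have := Real.pi_pos
  field_simp
  norm_num

/-- The exponential series in y² has nonnegative coefficients, so `gaussQuad_pow_le` applies
termwise. The bound is uniform in n and matches the growth in `abs_he_le`. -/
lemma gaussQuad_exp_le (n : ℕ) : gaussQuad n (fun y => Real.exp (y ^ 2 / 4)) ≤ 2 := by
  have ht : ∀ y : ℝ, Tendsto (fun K => ∑ k ∈ Finset.range K, (y ^ 2 / 4) ^ k / k.factorial) atTop
      (𝓝 (Real.exp (y ^ 2 / 4))) := by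
    intro y
    have := NormedSpace.expSeries_div_hasSum_exp (𝔸 := ℝ) (y ^ 2 / 4)
    rw [← Real.exp_eq_exp_ℝ] at this
    exact this.tendsto_sum_nat
  have ht2 : Tendsto (fun K => gaussQuad n
      (fun y => ∑ k ∈ Finset.range K, (y ^ 2 / 4) ^ k / (k.factorial : ℝ))) atTop
      (𝓝 (gaussQuad n (fun y => Real.exp (y ^ 2 / 4)))) := by
    unfold gaussQuad
    exact tendsto_finsetSum _ fun j _ => (ht _).const_smul _
  refine le_of_tendsto' ht2 fun K => ?_
  have hk : ∀ k : ℕ, Integrable (fun y : ℝ => (y ^ 2 / 4) ^ k / (k.factorial : ℝ)) γ₁ := by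
    intro k
    have := (integrable_polynomial (X ^ (2 * k))).const_mul (1 / (4 ^ k * (k.factorial : ℝ)))
    refine this.congr (ae_of_all _ fun y => ?_)
    simp only [eval_pow, eval_X, pow_mul, div_pow]
    field_simp
  have hexp : Integrable (fun y : ℝ => Real.exp (y ^ 2 / 4)) γ₁ := by
    have := integrable_exp_sq_mul_exp_abs 0
    simpa using this
  calc gaussQuad n (fun y => ∑ k ∈ Finset.range K, (y ^ 2 / 4) ^ k / (k.factorial : ℝ))
      = ∑ k ∈ Finset.range K, (1 / (4 ^ k * (k.factorial : ℝ))) *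
          gaussQuad n (fun y => (y ^ 2) ^ k) := by
        unfold gaussQuad
        simp_rw [smul_eq_mul, Finset.mul_sum]
        rw [Finset.sum_comm]
        refine Finset.sum_congr rfl fun k _ => Finset.sum_congr rfl fun j _ => ?_
        rw [div_pow]; field_simp
    _ ≤ ∑ k ∈ Finset.range K, (1 / (4 ^ k * (k.factorial : ℝ))) * ∫ y, (y ^ 2) ^ k ∂γ₁ := by
        gcongr; exact gaussQuad_pow_le n _
    _ = ∫ y, ∑ k ∈ Finset.range K, (y ^ 2 / 4) ^ k / (k.factorial : ℝ) ∂γ₁ := by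
        rw [integral_finsetSum _ fun k _ => hk k]
        refine Finset.sum_congr rfl fun k _ => ?_
        rw [← integral_const_mul]
        congr 1 with y
        rw [div_pow]; field_simp
    _ ≤ ∫ y, Real.exp (y ^ 2 / 4) ∂γ₁ := by
        apply integral_mono (integrable_finsetSum _ fun k _ => hk k) hexp
        intro y
        exact sum_le_hasSum _ (fun k _ => by positivity)
          (by
            have := NormedSpace.expSeries_div_hasSum_exp (𝔸 := ℝ) (y ^ 2 / 4)
            rwa [← Real.exp_eq_exp_ℝ] at this)
    _ ≤ 2 := integral_exp_sq_le

/-- Error of Gauss-Hermite quadrature for smooth functions. -/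
theorem gaussQuad_error (t : ℕ) : ∃ C : ℝ, 0 < C ∧ ∀ (D : ℕ → ℝ → ℝ),
    (∀ i y, HasDerivAt (D i) (D (i + 1) y) y) → (∀ i, MemLp (D i) 2 γ₁) → ∀ M : ℝ,
    (∀ i, 2 ≤ i → i ≤ 2 * (t + 3) → Real.sqrt (∫ y, ‖D i y‖ ^ 2 ∂γ₁) ≤ M) →
    ∀ n : ℕ, |∫ y, D 0 y ∂γ₁ - gaussQuad n (D 0)| ≤ C * M / ((n : ℝ) + 1) ^ t := by
  obtain ⟨C, hC, h⟩ := quadrature_error t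
  refine ⟨C, hC, fun D hd hf M hM n => ?_⟩
  have hM0 : 0 ≤ M := (Real.sqrt_nonneg _).trans (hM 2 le_rfl (by omega))
  have := h D hd hf M hM (2 * (n + 1)) (Finset.range (n + 1)) (weight n) (node n) (by omega)
    (fun j hj => weight_nonneg (Finset.mem_range.1 hj)) (fun p hp => gaussQuad_exact ?_)
    (gaussQuad_exp_le n)
  · refine this.trans ?_
    gcongr
    push_cast; linarith [(Nat.cast_nonneg n : (0 : ℝ) ≤ n)]
  · by_cases h0 : p = 0
    · simp [h0]
    · rw [degree_eq_natDegree h0] at hp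
      exact_mod_cast hp

end GaussQuadrature

/-! ### L² norms of dominating functions with values in [0, ∞]. -/

/-- The `L²` norm of an extended nonnegative function. -/
def l2 {α : Type*} [MeasurableSpace α] (μ : Measure α) (φ : α → ENNReal) : ENNReal :=
  (∫⁻ y, φ y ^ 2 ∂μ) ^ (1 / 2 : ℝ)

lemma l2_sq {α : Type*} [MeasurableSpace α] (μ : Measure α) (φ : α → ENNReal) :
    l2 μ φ ^ 2 = ∫⁻ y, φ y ^ 2 ∂μ := by
  rw [l2, ← ENNReal.rpow_natCast, ← ENNReal.rpow_mul]; norm_num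

lemma l2_const_mul {α : Type*} [MeasurableSpace α] (μ : Measure α) {φ : α → ENNReal}
    (hφ : Measurable φ) (c : ENNReal) : l2 μ (fun y => c * φ y) = c * l2 μ φ := by
  rw [l2, l2]
  simp_rw [mul_pow]
  rw [lintegral_const_mul _ (by fun_prop), ENNReal.mul_rpow_of_nonneg _ _ (by norm_num)]
  congr 1
  rw [← ENNReal.rpow_natCast, ← ENNReal.rpow_mul]; norm_num

lemma lintegral_le_l2 {α : Type*} [MeasurableSpace α] (μ : Measure α) [IsProbabilityMeasure μ]
    {φ : α → ENNReal} (hφ : Measurable φ) : ∫⁻ y, φ y ∂μ ≤ l2 μ φ := by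
  have := ENNReal.lintegral_mul_le_Lp_mul_Lq μ Real.HolderConjugate.two_two
    hφ.aemeasurable (measurable_const (a := (1 : ENNReal))).aemeasurable
  simpa [l2] using this

section Domination
variable {α E : Type*} [MeasurableSpace α] {μ : Measure α} [NormedAddCommGroup E]

lemma memLp_of_enorm_le {f : α → E} (hf : AEStronglyMeasurable f μ) {φ : α → ENNReal}
    {c : ℝ} (h : ∀ y, ‖f y‖ₑ ≤ ENNReal.ofReal c * φ y) (hφ : Measurable φ) (hfin : l2 μ φ ≠ ⊤) :
    MemLp f 2 μ := by
  refine ⟨hf, ?_⟩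
  rw [eLpNorm_eq_lintegral_rpow_enorm_toReal (by norm_num) (by norm_num)]
  have : (∫⁻ y, ‖f y‖ₑ ^ (2 : ENNReal).toReal ∂μ) ^ (1 / (2 : ENNReal).toReal) ≤
      l2 μ (fun y => ENNReal.ofReal c * φ y) := by
    rw [l2]
    simp only [ENNReal.toReal_ofNat]
    gcongr with y
    rw [← ENNReal.rpow_natCast]
    push_cast
    gcongr
    exact h y
  refine this.trans_lt ?_
  rw [l2_const_mul _ hφ]
  exact ENNReal.mul_lt_top ENNReal.ofReal_lt_top hfin.lt_top

lemma sqrt_integral_sq_le {f : α → E} (hf : AEStronglyMeasurable f μ) {φ : α → ENNReal}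
    {c : ℝ} (hc : 0 ≤ c) (h : ∀ y, ‖f y‖ₑ ≤ ENNReal.ofReal c * φ y) (hφ : Measurable φ)
    (hfin : l2 μ φ ≠ ⊤) : Real.sqrt (∫ y, ‖f y‖ ^ 2 ∂μ) ≤ c * (l2 μ φ).toReal := by
  rw [Real.sqrt_le_iff]
  refine ⟨by positivity, ?_⟩
  rw [integral_eq_lintegral_of_nonneg_ae (f := fun y => ‖f y‖ ^ 2)
    (ae_of_all _ fun _ => by positivity) (hf.norm.pow 2)]
  have h1 : ∫⁻ y, ENNReal.ofReal (‖f y‖ ^ 2) ∂μ ≤ (ENNReal.ofReal c * l2 μ φ) ^ 2 := by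
    rw [← l2_const_mul _ hφ, l2_sq]
    gcongr with y
    rw [ENNReal.ofReal_pow (norm_nonneg _), ofReal_norm]
    gcongr
    exact h y
  have h2 := ENNReal.toReal_mono (by
    exact ENNReal.pow_ne_top (ENNReal.mul_ne_top ENNReal.ofReal_ne_top hfin)) h1
  rwa [ENNReal.toReal_pow, ENNReal.toReal_mul, ENNReal.toReal_ofReal hc] at h2

end Domination

/-! ### Quadrature for holomorphic functions on a strip. -/

section Holomorphic

variable {X : Type*} [NormedAddCommGroup X] [NormedSpace ℂ X] [CompleteSpace X]

/-- `g` is holomorphic on the strip of half-width `κ` and dominated by `φ` on discs of radius `κ`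
around real points. -/
structure DominatedHolo (κ : ℝ) (φ : ℝ → ENNReal) (g : ℂ → X) : Prop where
  diff : DifferentiableOn ℂ g {z | |z.im| < κ}
  dom : ∀ (y : ℝ) (z : ℂ), ‖z‖ < κ → ‖g (y + z)‖ₑ ≤ φ y

variable {κ : ℝ} {φ : ℝ → ENNReal} {g : ℂ → X}

lemma isOpen_strip1 (κ : ℝ) : IsOpen {z : ℂ | |z.im| < κ} :=
  isOpen_lt (by fun_prop) continuous_const

lemma DominatedHolo.differentiableOn_iterate_deriv (h : DominatedHolo κ φ g) (i : ℕ) :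
    DifferentiableOn ℂ (deriv^[i] g) {z | |z.im| < κ} := by
  induction i with
  | zero => exact h.diff
  | succ i ih =>
    rw [Function.iterate_succ_apply']
    exact ih.deriv (isOpen_strip1 κ)

lemma DominatedHolo.hasDerivAt (h : DominatedHolo κ φ g) (hκ : 0 < κ) (i : ℕ) (y : ℝ) :
    HasDerivAt (fun y : ℝ => deriv^[i] g (y : ℂ)) (deriv^[i + 1] g (y : ℂ)) y := by
  have h1 : HasDerivAt (deriv^[i] g) (deriv^[i + 1] g (y : ℂ)) (y : ℂ) := by
    rw [Function.iterate_succ_apply']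
    exact ((h.differentiableOn_iterate_deriv i).differentiableAt
      ((isOpen_strip1 κ).mem_nhds (by simpa using hκ))).hasDerivAt
  have := HasDerivAt.scomp y h1 Complex.ofRealCLM.hasDerivAt
  rw [Complex.ofRealCLM_apply, Complex.ofReal_one, one_smul] at this
  exact this

/-- Cauchy's estimate on the circle of radius κ/2 about y. Every point of it is a complex
displacement of y shorter than κ, so the one value φ y bounds g there. -/
lemma DominatedHolo.enorm_deriv_le (h : DominatedHolo κ φ g) (hκ : 0 < κ) (i : ℕ) (y : ℝ) :
    ‖deriv^[i] g (y : ℂ)‖ₑ ≤ ENNReal.ofReal (i.factorial * (2 / κ) ^ i) * φ y := by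
  have hpos : 0 < i.factorial * (2 / κ) ^ i := by positivity
  by_cases hφ : φ y = ⊤
  · rw [hφ, ENNReal.mul_top (ENNReal.ofReal_pos.2 hpos).ne']; exact le_top
  have hb : Metric.closedBall (y : ℂ) (κ / 2) ⊆ {z | |z.im| < κ} := by
    intro z hz
    rw [Metric.mem_closedBall, dist_eq_norm] at hz
    have := Complex.abs_im_le_norm (z - y)
    simp only [Complex.sub_im, Complex.ofReal_im, sub_zero] at this
    exact lt_of_le_of_lt (this.trans hz) (by linarith)
  have h1 := Complex.norm_iteratedDeriv_le_of_forall_mem_sphere_norm_le (f := g) (c := y) i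
    (R := κ / 2) (C := (φ y).toReal) (by positivity)
    (by
      refine DifferentiableOn.diffContOnCl ?_
      rw [closure_ball _ (by positivity)]
      exact h.diff.mono hb)
    (fun z hz => by
      have h2 := h.dom y (z - y) (by
        rw [mem_sphere_iff_norm] at hz; rw [hz]; linarith)
      rw [add_sub_cancel] at h2
      rw [← toReal_enorm]
      exact ENNReal.toReal_mono hφ h2)
  rw [iteratedDeriv_eq_iterate] at h1
  rw [← ofReal_norm, ← ENNReal.ofReal_toReal hφ, ← ENNReal.ofReal_mul hpos.le]
  apply ENNReal.ofReal_le_ofReal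
  refine h1.trans (le_of_eq ?_)
  rw [div_pow, div_pow]; field_simp

lemma DominatedHolo.continuous (h : DominatedHolo κ φ g) (hκ : 0 < κ) (i : ℕ) :
    Continuous fun y : ℝ => deriv^[i] g (y : ℂ) :=
  continuous_iff_continuousAt.2 fun y => (h.hasDerivAt hκ i y).continuousAt

lemma DominatedHolo.memLp (h : DominatedHolo κ φ g) (hκ : 0 < κ) (hφ : Measurable φ)
    (hfin : l2 γ₁ φ ≠ ⊤) (i : ℕ) : MemLp (fun y : ℝ => deriv^[i] g (y : ℂ)) 2 γ₁ :=
  memLp_of_enorm_le (h.continuous hκ i).aestronglyMeasurable (h.enorm_deriv_le hκ i) hφ hfin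

lemma DominatedHolo.integrable (h : DominatedHolo κ φ g) (hκ : 0 < κ) (hφ : Measurable φ)
    (hfin : l2 γ₁ φ ≠ ⊤) : Integrable (fun y : ℝ => g y) γ₁ :=
  (h.memLp hκ hφ hfin 0).integrable one_le_two

/-- Error of Gauss-Hermite quadrature for holomorphic functions on a strip. -/
theorem exists_gaussQuad_error_le (X : Type*) [NormedAddCommGroup X] [NormedSpace ℂ X]
    [CompleteSpace X] (t : ℕ) {κ₀ : ℝ} (hκ₀ : 0 < κ₀) :
    ∃ C : ℝ, 0 < C ∧ ∀ (κ : ℝ) (φ : ℝ → ENNReal) (g : ℂ → X), κ₀ ≤ κ → Measurable φ →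
      DominatedHolo κ φ g → ∀ n : ℕ,
      ‖∫ y : ℝ, g y ∂γ₁ - gaussQuad n (fun y : ℝ => g y)‖ₑ ≤
        ENNReal.ofReal (C * (κ ^ 2)⁻¹ / ((n : ℝ) + 1) ^ t) * l2 γ₁ φ := by
  obtain ⟨C, hC, hq⟩ := gaussQuad_error t
  set I := 2 * (t + 3) with hI
  set B : ℝ := I.factorial * 2 ^ I * (max 1 κ₀⁻¹) ^ I with hB
  have hm1 : (1 : ℝ) ≤ max 1 κ₀⁻¹ := le_max_left _ _
  have hB0 : 0 < B := by positivity
  refine ⟨C * B, by positivity, fun κ φ g hκ hφ h n => ?_⟩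
  have hκ0 : 0 < κ := hκ₀.trans_le hκ
  have hpos : 0 < C * B * (κ ^ 2)⁻¹ / ((n : ℝ) + 1) ^ t := by positivity
  -- Slices of a dominating function of several variables may have infinite norm; the bound is then
  -- trivial.
  by_cases hfin : l2 γ₁ φ = ⊤
  · rw [hfin, ENNReal.mul_top (by simpa using hpos)]; exact le_top
  -- Orders i ≥ 2 allow κ⁻² to be split off; the other powers of κ⁻¹ are controlled by the lower
  -- bound κ₀.
  have hcoef : ∀ i, 2 ≤ i → i ≤ I → (i.factorial : ℝ) * (2 / κ) ^ i ≤ B * (κ ^ 2)⁻¹ := by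
    intro i hi hiI
    have e : (2 / κ) ^ i = 2 ^ i * ((κ⁻¹) ^ (i - 2) * (κ ^ 2)⁻¹) := by
      obtain ⟨m, rfl⟩ := Nat.exists_eq_add_of_le hi
      rw [Nat.add_sub_cancel_left, div_eq_mul_inv, mul_pow, ← inv_pow, ← pow_add, add_comm m]
    have h1 : (κ⁻¹) ^ (i - 2) ≤ (max 1 κ₀⁻¹) ^ I := by
      calc _ ≤ (max 1 κ₀⁻¹) ^ (i - 2) := by
            gcongr
            exact (inv_anti₀ hκ₀ hκ).trans (le_max_right _ _)
        _ ≤ _ := pow_le_pow_right₀ hm1 (by omega)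
    have h2 : (i.factorial : ℝ) ≤ I.factorial := by exact_mod_cast Nat.factorial_le hiI
    have h3 : (2 : ℝ) ^ i ≤ 2 ^ I := pow_le_pow_right₀ (by norm_num) hiI
    rw [e, hB]
    calc _ ≤ (I.factorial : ℝ) * (2 ^ I * ((max 1 κ₀⁻¹) ^ I * (κ ^ 2)⁻¹)) := by gcongr
      _ = _ := by ring
  have hint := h.integrable hκ0 hφ hfin
  set N := (l2 γ₁ φ).toReal with hN
  have key : ‖∫ y : ℝ, g y ∂γ₁ - gaussQuad n (fun y : ℝ => g y)‖ ≤
      C * B * (κ ^ 2)⁻¹ / ((n : ℝ) + 1) ^ t * N := by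
    -- The Hermite estimate concerns real functions, so it is applied to g composed with each
    -- continuous real functional.
    refine NormedSpace.norm_le_dual_bound ℝ _ (by positivity) fun ℓ => ?_
    have hD := hq (fun i y => ℓ (deriv^[i] g (y : ℂ)))
      (fun i y => (ℓ.hasFDerivAt.comp_hasDerivAt y (h.hasDerivAt hκ0 i y)))
      (fun i => ℓ.comp_memLp' (h.memLp hκ0 hφ hfin i)) (‖ℓ‖ * (B * (κ ^ 2)⁻¹) * N) ?_ n
    · rw [map_sub, ← ℓ.integral_comp_comm hint, Real.norm_eq_abs]
      simp only [gaussQuad, map_sum, map_smul] at hD ⊢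
      refine hD.trans (le_of_eq ?_)
      ring
    · intro i hi hiI
      refine sqrt_integral_sq_le (c := ‖ℓ‖ * (B * (κ ^ 2)⁻¹))
        (ℓ.continuous.comp (h.continuous hκ0 i)).aestronglyMeasurable (by positivity)
        (fun y => ?_) hφ hfin
      calc ‖ℓ (deriv^[i] g (y : ℂ))‖ₑ ≤ ‖ℓ‖ₑ * ‖deriv^[i] g (y : ℂ)‖ₑ := ℓ.le_opENorm _
        _ ≤ ‖ℓ‖ₑ * (ENNReal.ofReal (B * (κ ^ 2)⁻¹) * φ y) := by
          gcongr
          refine (h.enorm_deriv_le hκ0 i y).trans ?_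
          exact mul_le_mul_left (ENNReal.ofReal_le_ofReal (hcoef i hi hiI)) _
        _ = _ := by
          clear_value B
          rw [ENNReal.ofReal_mul (norm_nonneg _), ofReal_norm, mul_assoc]
  rw [← ofReal_norm, ← ENNReal.ofReal_toReal hfin, ← ENNReal.ofReal_mul hpos.le]
  exact ENNReal.ofReal_le_ofReal key

lemma gaussian_ball_ne_zero {κ : ℝ} (hκ : 0 < κ) : γ₁ (Metric.ball 0 κ) ≠ 0 := fun h => by
  have := gaussianReal_absolutelyContinuous' 0 (v := 1) one_ne_zero h
  exact (Metric.measure_ball_pos volume (0 : ℝ) hκ).ne' this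

/-- Boundedness of the evaluation at zero. -/
lemma DominatedHolo.enorm_zero_le (h : DominatedHolo κ φ g) (hκ : 0 < κ) (hφ : Measurable φ) :
    ‖g 0‖ₑ ≤ (γ₁ (Metric.ball 0 κ)) ^ (-(1 / 2) : ℝ) * l2 γ₁ φ := by
  have h1 : ‖g 0‖ₑ ^ 2 * γ₁ (Metric.ball 0 κ) ≤ ∫⁻ y, φ y ^ 2 ∂γ₁ := by
    rw [← setLIntegral_const]
    refine (setLIntegral_mono (by fun_prop) (fun y hy => ?_)).trans (setLIntegral_le_lintegral _ _)
    -- The displacement -y leads from y to 0, so ‖g 0‖ ≤ φ y for all |y| < κ; averaging the squares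
    -- over this ball gives the bound.
    have := h.dom y (-y) (by simpa using hy)
    rw [add_neg_cancel] at this
    gcongr
  have h2 : γ₁ (Metric.ball 0 κ) ≠ ⊤ := measure_ne_top _ _
  have h0 := gaussian_ball_ne_zero hκ
  have h3 : ‖g 0‖ₑ ^ 2 ≤ (γ₁ (Metric.ball 0 κ))⁻¹ * ∫⁻ y, φ y ^ 2 ∂γ₁ := by
    rw [mul_comm, ← div_eq_mul_inv, ENNReal.le_div_iff_mul_le (Or.inl h0) (Or.inl h2)]
    exact h1
  have h4 := ENNReal.rpow_le_rpow h3 (z := 1 / 2) (by norm_num)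
  rw [ENNReal.mul_rpow_of_nonneg _ _ (by norm_num), ← ENNReal.rpow_natCast, ← ENNReal.rpow_mul,
    ENNReal.inv_rpow, ← ENNReal.rpow_neg] at h4
  simpa [l2] using h4

end Holomorphic

/-! ### Tensor products of quadrature functionals. -/

section Tensor

variable {ι : Type*} [Fintype ι] {X : Type*} [NormedAddCommGroup X]

/-- The tensor product of finite linear combinations of point evaluations, as a multilinear map
in the coefficients. -/
def tens [NormedSpace ℝ X] (x : ι → ℝ) {N : ℕ} (F : (Fin N → ℝ) → X) :
    MultilinearMap ℝ (fun _ : Fin N => ι → ℝ) X :=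
  ∑ a : Fin N → ι, (MultilinearMap.mkPiRing ℝ (Fin N) (F fun j => x (a j))).compLinearMap
    fun j => LinearMap.proj (a j)

lemma tens_apply [NormedSpace ℝ X] (x : ι → ℝ) {N : ℕ} (F : (Fin N → ℝ) → X)
    (T : Fin N → ι → ℝ) :
    tens x F T = ∑ a : Fin N → ι, (∏ j, T j (a j)) • F fun j => x (a j) := by
  simp [tens]

lemma tens_succ [NormedSpace ℝ X] (x : ι → ℝ) {N : ℕ} (F : (Fin (N + 1) → ℝ) → X)
    (T : Fin (N + 1) → ι → ℝ) :
    tens x F T = tens x (fun y => ∑ i, T 0 i • F (Fin.cons (x i) y)) (Fin.tail T) := by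
  rw [tens_apply, tens_apply, ← (Fin.consEquiv fun _ : Fin (N + 1) => ι).sum_comp,
    Fintype.sum_prod_type, Finset.sum_comm]
  refine Finset.sum_congr rfl fun a _ => ?_
  rw [Finset.smul_sum]
  refine Finset.sum_congr rfl fun i _ => ?_
  rw [Fin.prod_univ_succ, smul_smul, mul_comm]
  simp only [Fin.consEquiv_apply, Fin.cons_zero, Fin.cons_succ, Fin.tail]
  congr 2
  funext j
  refine Fin.cases ?_ (fun j => ?_) j <;> simp

/-- `F` is holomorphic on a product of strips and dominated by `φ` on polydiscs centred at real
points. -/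
structure DominatedHoloN [NormedSpace ℂ X] {N : ℕ} (κ : Fin N → ℝ) (φ : (Fin N → ℝ) → ENNReal)
    (F : (Fin N → ℂ) → X) : Prop where
  diff : DifferentiableOn ℂ F (strip κ)
  dom : ∀ y : Fin N → ℝ, ∀ z ∈ polydisc κ, ‖F ((fun j => (y j : ℂ)) + z)‖ₑ ≤ φ y

variable [NormedSpace ℂ X]

/-- A finite linear combination of point evaluations is bounded by `A` with respect to the `L²`
norm of the dominating function. -/
def FunctionalBound (X : Type*) [NormedAddCommGroup X] [NormedSpace ℂ X] (x : ι → ℝ)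
    (κ : ℝ) (A : ENNReal) (T : ι → ℝ) : Prop :=
  ∀ (φ : ℝ → ENNReal) (g : ℂ → X), Measurable φ → DominatedHolo κ φ g →
    ‖∑ i, T i • g (x i)‖ₑ ≤ A * l2 γ₁ φ

lemma differentiable_cons_left {N : ℕ} (z : Fin N → ℂ) :
    Differentiable ℂ fun w : ℂ => (Fin.cons w z : Fin (N + 1) → ℂ) := by
  rw [differentiable_pi]
  refine Fin.cases ?_ fun j => ?_
  · simp only [Fin.cons_zero]; exact differentiable_id
  · simp only [Fin.cons_succ]; exact differentiable_const _

lemma differentiable_cons_right {N : ℕ} (w : ℂ) :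
    Differentiable ℂ fun z : Fin N → ℂ => (Fin.cons w z : Fin (N + 1) → ℂ) := by
  rw [differentiable_pi]
  refine Fin.cases ?_ fun j => ?_
  · simp only [Fin.cons_zero]; exact differentiable_const _
  · simp only [Fin.cons_succ]; exact differentiable_apply j

variable {N : ℕ} {κ : Fin (N + 1) → ℝ} {φ : (Fin (N + 1) → ℝ) → ENNReal} {F : (Fin (N + 1) → ℂ) → X}

lemma DominatedHoloN.slice (h : DominatedHoloN κ φ F) (y : Fin N → ℝ) {z : Fin N → ℂ}
    (hz : z ∈ polydisc (Fin.tail κ)) :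
    DominatedHolo (κ 0) (fun t => φ (Fin.cons t y))
      (fun w => F (Fin.cons w ((fun j => (y j : ℂ)) + z))) := by
  constructor
  · refine h.diff.comp (differentiable_cons_left _).differentiableOn fun w hw => ?_
    refine Fin.cases ?_ fun j => ?_
    · simpa using hw
    · have h1 := hz j
      have h2 := Complex.abs_im_le_norm (z j)
      simp only [Fin.cons_succ, Pi.add_apply, Complex.add_im, Complex.ofReal_im, zero_add]
      exact h2.trans_lt h1
  · intro t w hw
    have := h.dom (Fin.cons t y) (Fin.cons w z) (by
      refine Fin.cases ?_ fun j => ?_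
      · simpa using hw
      · simpa [Fin.tail] using hz j)
    convert this using 3
    funext j
    refine Fin.cases ?_ (fun j => ?_) j <;> simp

/-- The slice through any displaced point y + z is dominated by φ(·, y), with no dependence on z.
One functional in the first variable therefore gives a function of N variables that is again
dominated on polydiscs, which makes induction on the dimension possible. -/
lemma DominatedHoloN.apply_functional (h : DominatedHoloN κ φ F) (hφ : Measurable φ)
    (hκ : 0 < κ 0) {x : ι → ℝ} {A : ENNReal} {T : ι → ℝ} (hT : FunctionalBound X x (κ 0) A T) :
    DominatedHoloN (Fin.tail κ) (fun y => A * l2 γ₁ fun t => φ (Fin.cons t y))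
      (fun z => ∑ i, T i • F (Fin.cons (x i : ℂ) z)) := by
  constructor
  · refine DifferentiableOn.fun_sum fun i _ => DifferentiableOn.const_smul ?_ (T i)
    refine h.diff.comp (differentiable_cons_right _).differentiableOn fun z hz => ?_
    refine Fin.cases ?_ fun j => ?_
    · simpa using hκ
    · simpa [Fin.tail] using hz j
  · intro y z hz
    exact hT _ _ (hφ.comp (by fun_prop)) (h.slice y hz)

lemma measurable_l2_cons (hφ : Measurable φ) :
    Measurable fun y : Fin N → ℝ => l2 γ₁ fun t => φ (Fin.cons t y) := by
  unfold l2
  apply Measurable.pow_const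
  exact Measurable.lintegral_prod_left' (f := fun p : ℝ × (Fin N → ℝ) => φ (Fin.cons p.1 p.2) ^ 2)
    (by fun_prop)

lemma measurePreserving_cons (N : ℕ) : MeasurePreserving
    (fun p : ℝ × (Fin N → ℝ) => (Fin.cons p.1 p.2 : Fin (N + 1) → ℝ))
    (γ₁.prod (gaussN N)) (gaussN (N + 1)) := by
  have := (measurePreserving_piFinSuccAbove (fun _ : Fin (N + 1) => γ₁) 0).symm
  simpa [Fin.insertNthEquiv, gaussN] using this

lemma l2_gaussN_succ (hφ : Measurable φ) :
    l2 (gaussN N) (fun y => l2 γ₁ fun t => φ (Fin.cons t y)) = l2 (gaussN (N + 1)) φ := by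
  rw [l2]
  simp_rw [l2_sq]
  rw [l2, ← (measurePreserving_cons N).lintegral_comp (by fun_prop)]
  have : SFinite (gaussN N) := by unfold gaussN; infer_instance
  rw [lintegral_prod_symm _ (by fun_prop)]

lemma l2_gaussN_zero (φ : (Fin 0 → ℝ) → ENNReal) (y : Fin 0 → ℝ) : l2 (gaussN 0) φ = φ y := by
  rw [l2, gaussN, Measure.pi_of_empty _ y, lintegral_dirac, ← ENNReal.rpow_natCast, ← ENNReal.rpow_mul]
  norm_num

lemma ofReal_cons {N : ℕ} (t : ℝ) (y : Fin N → ℝ) :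
    (fun j => (((Fin.cons t y : Fin (N + 1) → ℝ) j : ℝ) : ℂ)) =
      Fin.cons (t : ℂ) fun j => (y j : ℂ) := by
  funext j
  refine Fin.cases ?_ (fun j => ?_) j <;> simp

/-- Boundedness of tensor products of functionals. -/
theorem enorm_tens_le {N : ℕ} {κ : Fin N → ℝ} {φ : (Fin N → ℝ) → ENNReal} {F : (Fin N → ℂ) → X}
    (h : DominatedHoloN κ φ F) (hφ : Measurable φ) (hκ : ∀ j, 0 < κ j) {x : ι → ℝ}
    {A : Fin N → ENNReal} {T : Fin N → ι → ℝ} (hT : ∀ j, FunctionalBound X x (κ j) (A j) (T j)) :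
    ‖tens x (fun y => F fun j => (y j : ℂ)) T‖ₑ ≤ (∏ j, A j) * l2 (gaussN N) φ := by
  induction N with
  | zero =>
    rw [tens_apply, Fintype.sum_unique]
    simp only [Finset.univ_eq_empty, Finset.prod_empty, one_smul, one_mul]
    rw [l2_gaussN_zero _ (fun j => x ((default : Fin 0 → ι) j))]
    have := h.dom (fun j => x ((default : Fin 0 → ι) j)) 0 (fun j => j.elim0)
    rw [add_zero] at this
    exact this
  | succ N ih =>
    rw [tens_succ]
    have h1 := ih (h.apply_functional hφ (hκ 0) (hT 0)) ((measurable_l2_cons hφ).const_mul _)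
      (fun j => hκ j.succ) (fun j => hT j.succ) (A := fun j => A j.succ) (T := Fin.tail T)
    rw [l2_const_mul _ (measurable_l2_cons hφ), l2_gaussN_succ hφ, ← mul_assoc,
      mul_comm _ (A 0), ← Fin.prod_univ_succ] at h1
    simpa only [ofReal_cons] using h1

lemma DominatedHoloN.continuous {N : ℕ} {κ : Fin N → ℝ} {φ : (Fin N → ℝ) → ENNReal}
    {F : (Fin N → ℂ) → X} (h : DominatedHoloN κ φ F) (hκ : ∀ j, 0 < κ j) :
    Continuous fun y : Fin N → ℝ => F fun j => (y j : ℂ) := by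
  refine h.diff.continuousOn.comp_continuous (by fun_prop) fun y j => ?_
  simpa using hκ j

lemma DominatedHoloN.integrable {N : ℕ} {κ : Fin N → ℝ} {φ : (Fin N → ℝ) → ENNReal}
    {F : (Fin N → ℂ) → X} (h : DominatedHoloN κ φ F) (hκ : ∀ j, 0 < κ j) (hφ : Measurable φ)
    (hfin : l2 (gaussN N) φ ≠ ⊤) :
    Integrable (fun y : Fin N → ℝ => F fun j => (y j : ℂ)) (gaussN N) := by
  have : IsProbabilityMeasure (gaussN N) := by unfold gaussN; infer_instance
  refine (memLp_of_enorm_le (c := 1) (h.continuous hκ).aestronglyMeasurable (fun y => ?_)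
    hφ hfin).integrable one_le_two
  have := h.dom y 0 (fun j => by simpa using hκ j)
  simpa using this

/-- Error of tensor product quadrature. -/
theorem enorm_integral_sub_tens_le [CompleteSpace X] {N : ℕ} {κ : Fin N → ℝ}
    {φ : (Fin N → ℝ) → ENNReal} {F : (Fin N → ℂ) → X}
    (h : DominatedHoloN κ φ F) (hφ : Measurable φ) (hκ : ∀ j, 0 < κ j)
    (hfin : l2 (gaussN N) φ ≠ ⊤) {x : ι → ℝ} {B e : ENNReal} (hB : B ≠ ⊤) {T : ι → ℝ}
    (hT : ∀ j, FunctionalBound X x (κ j) B T)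
    (he : ∀ j, ∀ (φ : ℝ → ENNReal) (g : ℂ → X), Measurable φ → DominatedHolo (κ j) φ g →
      ‖∫ y : ℝ, g y ∂γ₁ - ∑ i, T i • g (x i)‖ₑ ≤ e * l2 γ₁ φ) :
    ‖∫ y, F (fun j => (y j : ℂ)) ∂(gaussN N) - tens x (fun y => F fun j => (y j : ℂ)) fun _ => T‖ₑ
      ≤ e * (∑ k ∈ Finset.range N, B ^ k) * l2 (gaussN N) φ := by
  have hprob : ∀ N, IsProbabilityMeasure (gaussN N) := fun N => by unfold gaussN; infer_instance
  induction N with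
  | zero =>
    rw [tens_apply, Fintype.sum_unique, gaussN, Measure.pi_of_empty _ (fun j => j.elim0),
      integral_dirac]
    simp only [Finset.univ_eq_empty, Finset.prod_empty, one_smul]
    rw [show (fun j : Fin 0 => ((x ((default : Fin 0 → ι) j) : ℝ) : ℂ)) =
      fun j : Fin 0 => ((j.elim0 : ℝ) : ℂ) from funext fun j => j.elim0]
    simp
  | succ N ih =>
    rw [tens_succ]
    have h' := h.apply_functional hφ (hκ 0) (hT 0)
    have hφ' := (measurable_l2_cons hφ).const_mul B
    have hl2 : l2 (gaussN N) (fun y => B * l2 γ₁ fun t => φ (Fin.cons t y)) =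
        B * l2 (gaussN (N + 1)) φ := by
      rw [l2_const_mul _ (measurable_l2_cons hφ), l2_gaussN_succ hφ]
    have hfin' : l2 (gaussN N) (fun y => B * l2 γ₁ fun t => φ (Fin.cons t y)) ≠ ⊤ := by
      rw [hl2]; exact ENNReal.mul_ne_top hB hfin
    have h1 := ih h' hφ' (fun j => hκ j.succ) hfin' (fun j => hT j.succ) (fun j => he j.succ)
    rw [hl2] at h1
    simp only [ofReal_cons, Fin.tail_def]
    have hint := h.integrable hκ hφ hfin
    have hme : MeasurableEmbedding
        (fun p : ℝ × (Fin N → ℝ) => (Fin.cons p.1 p.2 : Fin (N + 1) → ℝ)) := by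
      have := (MeasurableEquiv.piFinSuccAbove (fun _ : Fin (N + 1) => ℝ) 0).symm.measurableEmbedding
      simpa [Fin.insertNthEquiv] using this
    have hint2 := ((measurePreserving_cons N).integrable_comp_emb hme).2 hint
    have e1 := (measurePreserving_cons N).integral_comp hme (fun y => F fun j => (y j : ℂ))
    have e2 := integral_prod_symm _ hint2
    simp only [Function.comp_def] at e2
    rw [e2] at e1
    have hint3 := hint2.integral_prod_right
    simp only [ofReal_cons] at e1
    simp only [Function.comp_def, ofReal_cons] at hint3
    rw [← e1]
    have hint4 := h'.integrable (fun j => hκ j.succ) hφ' hfin'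
    -- The integral in the first variable is replaced by quadrature at the cost e. The induction
    -- hypothesis then treats the resulting function, whose dominating norm is larger by the factor
    -- B.
    have h2 : ‖∫ y : Fin N → ℝ, ∫ t : ℝ, F (Fin.cons (t : ℂ) fun j => (y j : ℂ)) ∂γ₁ ∂(gaussN N) -
        ∫ y : Fin N → ℝ, ∑ i, T i • F (Fin.cons (x i : ℂ) fun j => (y j : ℂ)) ∂(gaussN N)‖ₑ ≤
        e * l2 (gaussN (N + 1)) φ := by
      rw [← integral_sub hint3 hint4]
      refine (enorm_integral_le_lintegral_enorm _).trans ?_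
      calc _ ≤ ∫⁻ y, e * l2 γ₁ (fun t => φ (Fin.cons t y)) ∂(gaussN N) := by
            refine lintegral_mono fun y => ?_
            have h3 := h.slice y (z := 0) (fun j => by simpa [Fin.tail] using hκ j.succ)
            rw [add_zero] at h3
            exact he 0 _ _ (hφ.comp (by fun_prop)) h3
        _ = e * ∫⁻ y, l2 γ₁ (fun t => φ (Fin.cons t y)) ∂(gaussN N) :=
            lintegral_const_mul _ (measurable_l2_cons hφ)
        _ ≤ _ := by
            rw [← l2_gaussN_succ hφ]
            gcongr
            exact lintegral_le_l2 _ (measurable_l2_cons hφ)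
    calc _ ≤ e * l2 (gaussN (N + 1)) φ + e * (∑ k ∈ Finset.range N, B ^ k) *
          (B * l2 (gaussN (N + 1)) φ) := by
          refine le_trans ?_ (add_le_add h2 h1)
          refine le_trans (le_of_eq ?_) (enorm_add_le _ _)
          congr 1
          abel
      _ = _ := by
        rw [Finset.sum_range_succ', pow_zero]
        simp_rw [pow_succ]
        rw [← Finset.sum_mul]
        ring

end Tensor

lemma node_zero : node 0 0 = 0 := by
  have := he_eval_node (n := 0) (j := 0) (by norm_num)
  simpa [he_one] using this

lemma weight_zero : weight 0 0 = 1 := by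
  simp [weight, Lagrange.basis_singleton]

/-! ### Quadrature rules and their differences as coefficient vectors. -/

section Coefficients

/-- Labels of the quadrature nodes of level at most `M`. -/
abbrev NodeIdx (M : ℕ) := Fin (M + 1) × Fin (M + 1)

/-- The node with a given label. -/
def nodeAt (M : ℕ) (i : NodeIdx M) : ℝ := node i.1 i.2

/-- The label of the `j`-th node of level `n`. -/
def nodeIdx (M n j : ℕ) : NodeIdx M := (Fin.ofNat (M + 1) n, Fin.ofNat (M + 1) j)

lemma nodeAt_nodeIdx {M n j : ℕ} (hn : n ≤ M) (hj : j ≤ n) : nodeAt M (nodeIdx M n j) = node n j := by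
  simp [nodeAt, nodeIdx, Nat.mod_eq_of_lt (Nat.lt_succ_of_le hn),
    Nat.mod_eq_of_lt (Nat.lt_succ_of_le (hj.trans hn))]

/-- The coefficients of the quadrature `Q_n`. -/
def quadCoeff (M n : ℕ) : NodeIdx M → ℝ :=
  ∑ j ∈ Finset.range (n + 1), weight n j • Pi.single (nodeIdx M n j) (1 : ℝ)

/-- The coefficients of the difference `Q_n - Q_{n-1}`. -/
def diffCoeff (M n : ℕ) : NodeIdx M → ℝ :=
  -- For n = 0 only e = 0 occurs, which encodes Q_{-1} = 0. Multilinear expansion of this sum gives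
  -- the sum over e in `diffQuad`.
  ∑ e ∈ Finset.range (min n 1 + 1), (-1 : ℝ) ^ e • quadCoeff M (n - e)

lemma diffCoeff_zero (M : ℕ) : diffCoeff M 0 = quadCoeff M 0 := by
  simp [diffCoeff]

lemma diffCoeff_succ (M n : ℕ) : diffCoeff M (n + 1) = quadCoeff M (n + 1) - quadCoeff M n := by
  simp [diffCoeff, Finset.sum_range_succ, sub_eq_add_neg]

lemma sum_diffCoeff (M m : ℕ) : ∑ n ∈ Finset.range (m + 1), diffCoeff M n = quadCoeff M m := by
  induction m with
  | zero => simp [diffCoeff_zero]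
  | succ m ih => rw [Finset.sum_range_succ, ih, diffCoeff_succ]; abel

variable {E : Type*} [AddCommGroup E] [Module ℝ E]

lemma sum_quadCoeff_smul {M n : ℕ} (hn : n ≤ M) (g : ℝ → E) :
    ∑ i, quadCoeff M n i • g (nodeAt M i) = gaussQuad n g := by
  simp only [quadCoeff, Finset.sum_apply, Pi.smul_apply, Finset.sum_smul]
  rw [Finset.sum_comm]
  refine Finset.sum_congr rfl fun j hj => ?_
  rw [Finset.sum_eq_single (nodeIdx M n j)]
  · rw [Pi.single_eq_same, smul_eq_mul, mul_one,
      nodeAt_nodeIdx hn (Nat.lt_succ_iff.1 (Finset.mem_range.1 hj))]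
  · intro i _ hi
    rw [Pi.single_eq_of_ne hi, smul_zero, zero_smul]
  · simp

end Coefficients

section Bounds

variable (X : Type*) [NormedAddCommGroup X] [NormedSpace ℂ X] [CompleteSpace X]

lemma functionalBound_zero (M : ℕ) {κ : ℝ} (hκ : 0 < κ) :
    FunctionalBound X (nodeAt M) κ (γ₁ (Metric.ball 0 κ) ^ (-(1 / 2) : ℝ)) (diffCoeff M 0) := by
  intro φ g hφ h
  rw [diffCoeff_zero, sum_quadCoeff_smul (Nat.zero_le M) (fun y : ℝ => g y)]
  simp only [gaussQuad, zero_add, Finset.range_one, Finset.sum_singleton, node_zero, weight_zero,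
    one_smul, Complex.ofReal_zero]
  exact h.enorm_zero_le hκ hφ

/-- The one-dimensional bounds needed for tensor products. -/
theorem exists_functionalBounds (t : ℕ) {κ₀ : ℝ} (hκ₀ : 0 < κ₀) :
    ∃ C : ℝ, 0 < C ∧ ∀ κ : ℝ, κ₀ ≤ κ → ∀ M : ℕ,
      (∀ n, 1 ≤ n → n ≤ M → FunctionalBound X (nodeAt M) κ
        (ENNReal.ofReal (C * (κ ^ 2)⁻¹ * ((n : ℝ) ^ t)⁻¹)) (diffCoeff M n)) ∧
      (∀ n ≤ M, FunctionalBound X (nodeAt M) κ (ENNReal.ofReal (1 + C * (κ ^ 2)⁻¹))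
        (quadCoeff M n)) ∧
      (∀ n ≤ M, ∀ (φ : ℝ → ENNReal) (g : ℂ → X), Measurable φ → DominatedHolo κ φ g →
        ‖∫ y : ℝ, g y ∂γ₁ - ∑ i, quadCoeff M n i • g (nodeAt M i)‖ₑ ≤
          ENNReal.ofReal (C * (κ ^ 2)⁻¹ * (((n : ℝ) + 1) ^ t)⁻¹) * l2 γ₁ φ) := by
  obtain ⟨C, hC, h⟩ := exists_gaussQuad_error_le X t hκ₀
  -- A difference Q_n - Q_{n-1} is a difference of two quadrature errors, whence the factor 2.
  refine ⟨2 * C, by positivity, fun κ hκ M => ?_⟩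
  have hκ0 : 0 < κ := hκ₀.trans_le hκ
  have hc : 0 ≤ C * (κ ^ 2)⁻¹ := by positivity
  have h' : ∀ n ≤ M, ∀ (φ : ℝ → ENNReal) (g : ℂ → X), Measurable φ → DominatedHolo κ φ g →
        ‖∫ y : ℝ, g y ∂γ₁ - ∑ i, quadCoeff M n i • g (nodeAt M i)‖ₑ ≤
          ENNReal.ofReal (C * (κ ^ 2)⁻¹ * (((n : ℝ) + 1) ^ t)⁻¹) * l2 γ₁ φ := by
    intro n hn φ g hφ hg
    rw [sum_quadCoeff_smul hn (fun y : ℝ => g y)]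
    exact h κ φ g hκ hφ hg n
  refine ⟨fun n hn hnM φ g hφ hg => ?_, fun n hn φ g hφ hg => ?_, fun n hn φ g hφ hg => ?_⟩
  · obtain ⟨m, rfl⟩ := Nat.exists_eq_add_of_le' hn
    have h1 := h' (m + 1) hnM φ g hφ hg
    have h2 := h' m (by omega) φ g hφ hg
    have e : ∑ i, diffCoeff M (m + 1) i • g (nodeAt M i) =
        (∫ y : ℝ, g y ∂γ₁ - ∑ i, quadCoeff M m i • g (nodeAt M i)) -
        (∫ y : ℝ, g y ∂γ₁ - ∑ i, quadCoeff M (m + 1) i • g (nodeAt M i)) := by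
      simp only [diffCoeff_succ, Pi.sub_apply, sub_smul, Finset.sum_sub_distrib]
      abel
    rw [e]
    refine (enorm_sub_le).trans ((add_le_add h2 h1).trans ?_)
    rw [← add_mul, ← ENNReal.ofReal_add (by positivity) (by positivity)]
    gcongr
    have : (((m + 1 : ℕ) : ℝ) + 1) ^ t ≥ ((m : ℝ) + 1) ^ t := by
      gcongr; push_cast; linarith
    have h3 : ((((m + 1 : ℕ) : ℝ) + 1) ^ t)⁻¹ ≤ (((m : ℝ) + 1) ^ t)⁻¹ := by gcongr
    push_cast at h3 ⊢
    nlinarith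
  · by_cases hfin : l2 γ₁ φ = ⊤
    · rw [hfin, ENNReal.mul_top (ENNReal.ofReal_pos.2 (by positivity)).ne']; exact le_top
    have h1 := h' n hn φ g hφ hg
    have h2 : ‖∫ y : ℝ, g y ∂γ₁‖ₑ ≤ l2 γ₁ φ := by
      refine (enorm_integral_le_lintegral_enorm _).trans ((lintegral_mono fun y => ?_).trans
        (lintegral_le_l2 _ hφ))
      have := hg.dom y 0 (by simpa using hκ0)
      simpa using this
    have e : ∑ i, quadCoeff M n i • g (nodeAt M i) = ∫ y : ℝ, g y ∂γ₁ -
        (∫ y : ℝ, g y ∂γ₁ - ∑ i, quadCoeff M n i • g (nodeAt M i)) := by abel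
    rw [e]
    refine (enorm_sub_le).trans ((add_le_add h2 h1).trans ?_)
    rw [ENNReal.ofReal_add (by norm_num) (by positivity), add_mul, ENNReal.ofReal_one, one_mul]
    refine add_le_add le_rfl (mul_le_mul_left (ENNReal.ofReal_le_ofReal ?_) _)
    have h3 : (((n : ℝ) + 1) ^ t)⁻¹ ≤ 1 := by
      apply inv_le_one_of_one_le₀
      exact one_le_pow₀ (by linarith [(Nat.cast_nonneg n : (0 : ℝ) ≤ n)])
    calc _ ≤ C * (κ ^ 2)⁻¹ * 1 := by gcongr
      _ ≤ 2 * C * (κ ^ 2)⁻¹ := by linarith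
  · refine (h' n hn φ g hφ hg).trans ?_
    gcongr
    linarith

end Bounds

/-! ### Multi-indices, tensorized differences and the combination formula. -/

section MultiIndex

/-- A multi-index with given first entries and vanishing further entries. -/
def ofTuple {N : ℕ} (r : Fin N → ℕ) : ℕ →₀ ℕ :=
  Finsupp.onFinset (Finset.range N) (fun j => if h : j < N then r ⟨j, h⟩ else 0) (by
    intro j hj
    by_contra h
    simp only [Finset.mem_range] at h
    simp [h] at hj)

lemma ofTuple_apply {N : ℕ} (r : Fin N → ℕ) (j : ℕ) :
    ofTuple r j = if h : j < N then r ⟨j, h⟩ else 0 := rfl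

lemma support_ofTuple {N : ℕ} (r : Fin N → ℕ) : (ofTuple r).support ⊆ Finset.range N :=
  Finsupp.support_onFinset_subset

lemma ofTuple_coe {N : ℕ} (r : Fin N → ℕ) (j : Fin N) : ofTuple r j = r j := by
  simp [ofTuple_apply]

lemma ofTuple_val {N : ℕ} {ν : ℕ →₀ ℕ} (hN : ν.support ⊆ Finset.range N) :
    ofTuple (fun j : Fin N => ν j) = ν := by
  ext j
  rw [ofTuple_apply]
  split_ifs with h
  · rfl
  · symm; rw [← Finsupp.notMem_support_iff]
    exact fun hj => h (Finset.mem_range.1 (hN hj))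

lemma sum_Icc_eq_sum_tuple {E : Type*} [AddCommMonoid E] {N : ℕ} {ν : ℕ →₀ ℕ}
    (hN : ν.support ⊆ Finset.range N) (G : (ℕ →₀ ℕ) → E) :
    ∑ μ ∈ Finset.Icc 0 ν, G μ =
      ∑ r ∈ Fintype.piFinset fun j : Fin N => Finset.range (ν j + 1), G (ofTuple r) := by
  have hsupp : ∀ μ ∈ Finset.Icc 0 ν, μ.support ⊆ Finset.range N := fun μ hμ =>
    (Finsupp.support_mono (Finset.mem_Icc.1 hμ).2).trans hN
  refine Finset.sum_bij' (fun μ _ => fun j : Fin N => μ j) (fun r _ => ofTuple r) ?_ ?_ ?_ ?_ ?_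
  · intro μ hμ
    simp only [Fintype.mem_piFinset, Finset.mem_range]
    intro j
    exact Nat.lt_succ_of_le ((Finset.mem_Icc.1 hμ).2 j)
  · intro r hr
    simp only [Fintype.mem_piFinset, Finset.mem_range] at hr
    rw [Finset.mem_Icc]
    refine ⟨zero_le, fun j => ?_⟩
    rw [ofTuple_apply]
    split_ifs with h
    · exact Nat.lt_succ_iff.1 (hr ⟨j, h⟩)
    · exact Nat.zero_le _
  · intro μ hμ; exact ofTuple_val (hsupp μ hμ)
  · intro r _; funext j; exact ofTuple_coe r j
  · intro μ hμ; rw [ofTuple_val (hsupp μ hμ)]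

lemma prod_support_eq_prod_fin {N : ℕ} {ν : ℕ →₀ ℕ} (hN : ν.support ⊆ Finset.range N)
    (G : ℕ → ℝ) (hG : ∀ j, ν j = 0 → G j = 1) : ∏ j ∈ ν.support, G j = ∏ j : Fin N, G j := by
  rw [Finset.prod_subset hN (fun j _ hj => hG j (by simpa using hj)), Finset.prod_range]

variable {X : Type*} [NormedAddCommGroup X] [NormedSpace ℝ X]

lemma tens_single {ι : Type*} [Fintype ι] [DecidableEq ι] (x : ι → ℝ) {N : ℕ}
    (F : (Fin N → ℝ) → X) (a : Fin N → ι) :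
    tens x F (fun j => Pi.single (a j) 1) = F fun j => x (a j) := by
  rw [tens_apply, Finset.sum_eq_single a]
  · simp
  · intro b _ hb
    obtain ⟨j, hj⟩ := Function.ne_iff.1 hb
    rw [Finset.prod_eq_zero (Finset.mem_univ j) (by simp [Pi.single_eq_of_ne hj]), zero_smul]
  · simp

/-- Off the support of ν the rule is Q_0, with node 0 and weight 1, so any N that covers the support
may be used. -/
lemma tensorQuad_eq_tens {N M : ℕ} {ν : ℕ →₀ ℕ} (hN : ν.support ⊆ Finset.range N)
    (hM : ∀ j, ν j ≤ M) (f : (ℕ → ℝ) → X) :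
    tensorQuad ν f = tens (nodeAt M) (fun y : Fin N → ℝ => f (extendZero y))
      fun j => quadCoeff M (ν j) := by
  unfold tensorQuad quadCoeff
  rw [sum_Icc_eq_sum_tuple hN, MultilinearMap.map_sum_finset]
  refine Finset.sum_congr rfl fun r hr => ?_
  simp only [Fintype.mem_piFinset, Finset.mem_range] at hr
  rw [MultilinearMap.map_smul_univ, tens_single, prod_support_eq_prod_fin hN
    (fun j => weight (ν j) (ofTuple r j))]
  · simp only [ofTuple_coe]
    congr 2
    funext j
    rw [extendZero, ofTuple_apply]
    split_ifs with h
    · rw [nodeAt_nodeIdx (hM _) (Nat.lt_succ_iff.1 (hr ⟨j, h⟩))]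
    · have : ν j = 0 := by
        rw [← Finsupp.notMem_support_iff]
        exact fun hj => h (Finset.mem_range.1 (hN hj))
      rw [this, node_zero]
  · intro j hj
    have : ofTuple r j = 0 := by
      rw [ofTuple_apply]
      split_ifs with h
      · have := hr ⟨j, h⟩
        simp only [hj] at this
        omega
      · rfl
    rw [hj, this, weight_zero]

/-- The multi-index with entries `min (ν j) 1`. -/
def ones (ν : ℕ →₀ ℕ) : ℕ →₀ ℕ := ν.mapRange (fun n => min n 1) rfl

/-- The tensor product of the differences `Q_{ν_j} - Q_{ν_j - 1}`. -/
def diffQuad (ν : ℕ →₀ ℕ) (f : (ℕ → ℝ) → X) : X :=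
  ∑ e ∈ Finset.Icc 0 (ones ν), (-1 : ℝ) ^ (∑ j ∈ e.support, e j) • tensorQuad (ν - e) f

lemma diffQuad_eq_tens {N M : ℕ} {ν : ℕ →₀ ℕ} (hN : ν.support ⊆ Finset.range N)
    (hM : ∀ j, ν j ≤ M) (f : (ℕ → ℝ) → X) :
    diffQuad ν f = tens (nodeAt M) (fun y : Fin N → ℝ => f (extendZero y))
      fun j => diffCoeff M (ν j) := by
  unfold diffQuad diffCoeff
  have h1 : (ones ν).support ⊆ Finset.range N := Finsupp.support_mapRange.trans hN
  rw [sum_Icc_eq_sum_tuple h1, MultilinearMap.map_sum_finset]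
  refine Finset.sum_congr rfl fun r _ => ?_
  rw [MultilinearMap.map_smul_univ, tensorQuad_eq_tens (N := N) (M := M)]
  · have h2 : (-1 : ℝ) ^ (∑ j ∈ (ofTuple r).support, ofTuple r j) = ∏ j, (-1 : ℝ) ^ r j := by
      rw [← Finset.prod_pow_eq_pow_sum, prod_support_eq_prod_fin (N := N)]
      · simp only [ofTuple_coe]
      · exact (support_ofTuple _)
      · intro j hj; rw [hj, pow_zero]
    rw [h2]
    simp only [Finsupp.tsub_apply, ofTuple_coe]
  · exact (Finsupp.support_mono tsub_le_self).trans hN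
  · intro j
    exact (Nat.sub_le _ _).trans (hM j)

/-- The multi-index with the first `N` entries equal to `m`. -/
def boxTop (N m : ℕ) : ℕ →₀ ℕ := ofTuple fun _ : Fin N => m

lemma support_boxTop (N m : ℕ) : (boxTop N m).support ⊆ Finset.range N :=
  (support_ofTuple _)

lemma boxTop_coe (N m : ℕ) (j : Fin N) : boxTop N m j = m := ofTuple_coe _ j

/-- By multilinearity the sum over a box is the tensor product of one-dimensional sums, each of
which telescopes to Q_m. -/
lemma sum_diffQuad_box (N m : ℕ) (f : (ℕ → ℝ) → X) :
    ∑ ν ∈ Finset.Icc 0 (boxTop N m), diffQuad ν f =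
      tens (nodeAt m) (fun y : Fin N → ℝ => f (extendZero y)) fun _ => quadCoeff m m := by
  rw [← sum_diffCoeff, MultilinearMap.map_sum_finset, sum_Icc_eq_sum_tuple (support_boxTop N m)]
  simp only [boxTop_coe]
  refine Finset.sum_congr rfl fun r hr => ?_
  simp only [Fintype.mem_piFinset, Finset.mem_range] at hr
  rw [diffQuad_eq_tens (N := N) (M := m) (support_ofTuple _)]
  · simp only [ofTuple_coe]
  · intro j
    rw [ofTuple_apply]
    split_ifs with h
    · exact Nat.lt_succ_iff.1 (hr _)
    · exact Nat.zero_le _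

lemma tensorQuad_sub (ν : ℕ →₀ ℕ) (f g : (ℕ → ℝ) → X) :
    tensorQuad ν (fun y => f y - g y) = tensorQuad ν f - tensorQuad ν g := by
  simp [tensorQuad, smul_sub, Finset.sum_sub_distrib]

lemma diffQuad_sub (ν : ℕ →₀ ℕ) (f g : (ℕ → ℝ) → X) :
    diffQuad ν (fun y => f y - g y) = diffQuad ν f - diffQuad ν g := by
  simp [diffQuad, tensorQuad_sub, smul_sub, Finset.sum_sub_distrib]

/-- The combination formula: Smolyak quadrature is a sum of tensorized differences. -/
theorem smolyakQuad_eq_sum_diffQuad (Λ : Finset (ℕ →₀ ℕ))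
    (hΛ : ∀ ν ∈ Λ, ∀ μ ≤ ν, μ ∈ Λ) (f : (ℕ → ℝ) → X) :
    smolyakQuad (Λ : Set (ℕ →₀ ℕ)) f = ∑ ν ∈ Λ, diffQuad ν f := by
  classical
  -- Substituting μ = ν + e turns the Smolyak sum into a double sum over pairs ν ≤ μ in Λ. Summed
  -- over ν first it is ∑ Δ_μ, because every μ - e lies in the downward closed set Λ.
  have h1 : ∀ ν, smolyakCoeff (Λ : Set (ℕ →₀ ℕ)) ν =
      ∑ μ ∈ Λ.filter (fun μ => ν ≤ μ ∧ ∀ j, μ j ≤ ν j + 1),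
        (-1 : ℝ) ^ (∑ j ∈ (μ - ν).support, (μ - ν) j) := by
    intro ν
    have hs : {e : ℕ →₀ ℕ | (∀ j, e j ≤ 1) ∧ ν + e ∈ (Λ : Set (ℕ →₀ ℕ))} =
        ((Λ.filter (fun μ => ν ≤ μ ∧ ∀ j, μ j ≤ ν j + 1)).image (fun μ => μ - ν) : Finset _) := by
      ext e
      simp only [Finset.coe_image, Set.mem_ofPred_eq, Set.mem_image, Finset.mem_coe,
        Finset.mem_filter]
      constructor
      · rintro ⟨he, hm⟩
        refine ⟨ν + e, ⟨hm, le_self_add, fun j => ?_⟩, add_tsub_cancel_left _ _⟩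
        simpa using he j
      · rintro ⟨μ, ⟨hm, hle, hj⟩, rfl⟩
        refine ⟨fun j => ?_, by rwa [add_tsub_cancel_of_le hle]⟩
        rw [Finsupp.tsub_apply]
        have := hj j
        omega
    unfold smolyakCoeff
    rw [hs, finsum_mem_coe_finset, Finset.sum_image]
    intro a ha b hb hab
    simp only [Finset.coe_filter, Set.mem_ofPred_eq] at ha hb
    have := congrArg (fun e => ν + e) hab
    simpa [add_tsub_cancel_of_le ha.2.1, add_tsub_cancel_of_le hb.2.1] using this
  unfold smolyakQuad
  rw [finsum_mem_coe_finset]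
  have h2 : ∀ μ ∈ Λ, diffQuad μ f = ∑ ν ∈ Λ.filter (fun ν => ν ≤ μ ∧ ∀ j, μ j ≤ ν j + 1),
      (-1 : ℝ) ^ (∑ j ∈ (μ - ν).support, (μ - ν) j) • tensorQuad ν f := by
    intro μ hμ
    unfold diffQuad
    refine Finset.sum_bij' (fun e _ => μ - e) (fun ν _ => μ - ν) ?_ ?_ ?_ ?_ ?_
    · intro e he
      have he2 := (Finset.mem_Icc.1 he).2
      rw [Finset.mem_filter]
      refine ⟨hΛ μ hμ _ tsub_le_self, tsub_le_self, fun j => ?_⟩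
      have := he2 j
      simp only [ones, Finsupp.mapRange_apply] at this
      rw [Finsupp.tsub_apply]
      omega
    · intro ν hν
      obtain ⟨_, hle, hj⟩ := Finset.mem_filter.1 hν
      rw [Finset.mem_Icc]
      refine ⟨zero_le, fun j => ?_⟩
      have h3 := hj j
      have h4 := hle j
      simp only [ones, Finsupp.mapRange_apply, Finsupp.tsub_apply]
      omega
    · intro e he
      have he2 := (Finset.mem_Icc.1 he).2
      refine tsub_tsub_cancel_of_le (he2.trans fun j => ?_)
      simp [ones]
    · intro ν hν
      exact tsub_tsub_cancel_of_le (Finset.mem_filter.1 hν).2.1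
    · intro e he
      have he2 := (Finset.mem_Icc.1 he).2
      rw [tsub_tsub_cancel_of_le (he2.trans fun j => ?_)]
      simp [ones]
  rw [Finset.sum_congr rfl h2]
  simp_rw [h1, Finset.sum_smul, Finset.sum_filter]
  exact Finset.sum_comm

end MultiIndex

/-! ### The integral over infinitely many variables as the sum of all differences. -/

lemma exists_measurable_majorant {α : Type*} [MeasurableSpace α] {μ : Measure α} {φ : α → ENNReal}
    (hφ : AEMeasurable φ μ) : ∃ ψ : α → ENNReal, Measurable ψ ∧ (∀ y, φ y ≤ ψ y) ∧ φ =ᵐ[μ] ψ := by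
  classical
  set s := toMeasurable μ {y | φ y ≠ hφ.mk φ y} with hs
  have hs0 : μ s = 0 := by rw [hs, measure_toMeasurable]; exact hφ.ae_eq_mk
  refine ⟨fun y => if y ∈ s then ⊤ else hφ.mk φ y,
    Measurable.ite (measurableSet_toMeasurable _ _) measurable_const hφ.measurable_mk, fun y => ?_, ?_⟩
  · beta_reduce
    split_ifs with h
    · exact le_top
    · have : y ∉ {y | φ y ≠ hφ.mk φ y} := fun hy => h (subset_toMeasurable _ _ hy)
      simp only [ne_eq, Set.mem_ofPred_eq, not_not] at this
      exact this.le
  · have h1 : ∀ᵐ y ∂μ, y ∉ s := measure_eq_zero_iff_ae_notMem.1 hs0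
    filter_upwards [hφ.ae_eq_mk, h1] with y hy hy1
    rw [if_neg hy1, hy]

variable {X : Type*} [NormedAddCommGroup X] [InnerProductSpace ℂ X]

lemma IsHolo.exists_dominatedHoloN {b : ℕ → ℝ} {ξ δ : ℝ} {f : (ℕ → ℝ) → X} (h : IsHolo b ξ δ f)
    {N : ℕ} (hN : 1 ≤ N) {ρ : Fin N → ℝ} (hρ : Admissible b ξ ρ) :
    ∃ (φ : (Fin N → ℝ) → ENNReal) (F : (Fin N → ℂ) → X), Measurable φ ∧
      l2 (gaussN N) φ ≤ ENNReal.ofReal δ ∧ DominatedHoloN ρ φ F ∧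
      ∀ y : Fin N → ℝ, F (fun j => (y j : ℂ)) = f (extendZero y) := by
  obtain ⟨φ, hφ0, hφm, hφ, hF⟩ := h.holo N hN
  obtain ⟨F, hFd, hFe, hFb⟩ := hF ρ hρ
  obtain ⟨ψ, hψm, hψ, hψe⟩ := exists_measurable_majorant (φ := fun y => ‖φ y‖ₑ) (μ := gaussN N)
    hφm.1.enorm
  refine ⟨ψ, F, hψm, ?_, ⟨hFd, fun y z hz => ?_⟩, hFe⟩
  · refine le_trans (le_of_eq ?_) hφ
    rw [eLpNorm_eq_lintegral_rpow_enorm_toReal (by norm_num) (by norm_num), l2]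
    simp only [ENNReal.toReal_ofNat]
    congr 1
    refine lintegral_congr_ae ?_
    filter_upwards [hψe] with y hy
    rw [← hy, ← ENNReal.rpow_natCast]; norm_num
  · refine le_trans ?_ (hψ y)
    rw [← ofReal_norm, ← ofReal_norm]
    refine ENNReal.ofReal_le_ofReal ((hFb y z hz).trans ?_)
    exact Real.le_norm_self _

lemma measurePreserving_restrict (N : ℕ) : MeasurePreserving (restrict N) gaussU (gaussN N) := by
  have hm : Measurable (restrict N) := by
    unfold restrict; fun_prop
  refine ⟨hm, ?_⟩
  unfold gaussN
  symm
  refine Measure.pi_eq fun s hs => ?_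
  rw [Measure.map_apply hm (MeasurableSet.univ_pi hs)]
  have e : restrict N ⁻¹' (Set.univ.pi s) =
      (Finset.range N : Set ℕ).pi fun j => if h : j < N then s ⟨j, h⟩ else Set.univ := by
    ext y
    simp only [Set.mem_preimage, Set.mem_pi, Set.mem_univ, forall_true_left, Finset.coe_range,
      Set.mem_Iio, restrict]
    constructor
    · intro hy j hj
      rw [dif_pos hj]; exact hy ⟨j, hj⟩
    · intro hy j
      have := hy j j.2
      rwa [dif_pos j.2] at this
  rw [e, gaussU, Measure.infinitePi_pi]
  · rw [Finset.prod_range]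
    refine Finset.prod_congr rfl fun j _ => ?_
    rw [dif_pos j.2]
  · intro j hj
    rw [dif_pos (Finset.mem_range.1 hj)]
    exact hs _

instance : IsProbabilityMeasure gaussU := by unfold gaussU; infer_instance

lemma boxTop_le_boxTop {N m : ℕ} {ν : ℕ →₀ ℕ} (hN : ν.support ⊆ Finset.range N)
    (hm : ∀ j, ν j ≤ m) : ν ≤ boxTop N m := by
  intro j
  rw [boxTop, ofTuple_apply]
  split_ifs with h
  · exact hm j
  · have : ν j = 0 := by
      rw [← Finsupp.notMem_support_iff]
      exact fun hj => h (Finset.mem_range.1 (hN hj))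
    exact this.le

lemma admissible_const {b : ℕ → ℝ} (hb : ∀ j, 0 < b j) {ξ : ℝ} (hξ : 0 < ξ) {N : ℕ} (hN : 1 ≤ N) :
    0 < ξ / (∑ j : Fin N, b j) ∧
      Admissible b ξ (fun _ : Fin N => ξ / (∑ j : Fin N, b j)) := by
  have hs : 0 < ∑ j : Fin N, b j :=
    Finset.sum_pos (fun j _ => hb j) ⟨⟨0, hN⟩, Finset.mem_univ _⟩
  have : 0 < ξ / (∑ j : Fin N, b j) := by positivity
  refine ⟨this, fun _ => this, ?_⟩
  rw [← Finset.sum_mul, mul_div_cancel₀ _ hs.ne']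

section Integral
variable [CompleteSpace X] {b : ℕ → ℝ} {ξ δ : ℝ} {f : (ℕ → ℝ) → X}

lemma IsHolo.integrable_extendZero (h : IsHolo b ξ δ f) (hb : ∀ j, 0 < b j) (hξ : 0 < ξ)
    {N : ℕ} (hN : 1 ≤ N) : Integrable (fun y : Fin N → ℝ => f (extendZero y)) (gaussN N) := by
  obtain ⟨hpos, hadm⟩ := admissible_const hb hξ hN
  obtain ⟨φ, F, hφ, hl2, hF, hFe⟩ := h.exists_dominatedHoloN hN hadm
  have := hF.integrable (fun _ => hpos) hφ (ne_top_of_le_ne_top ENNReal.ofReal_ne_top hl2)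
  simpa only [hFe] using this

/-- Convergence of full tensor product quadrature in finitely many variables. -/
lemma IsHolo.tendsto_box (h : IsHolo b ξ δ f) (hb : ∀ j, 0 < b j) (hξ : 0 < ξ)
    {N : ℕ} (hN : 1 ≤ N) :
    Tendsto (fun m => ∑ ν ∈ Finset.Icc 0 (boxTop N m), diffQuad ν f) atTop
      (𝓝 (∫ y, f (extendZero y) ∂(gaussN N))) := by
  -- The constants obtained from this uniform radius depend on N, which is harmless for convergence
  -- with N fixed.
  obtain ⟨hpos, hadm⟩ := admissible_const hb hξ hN
  set κ := ξ / (∑ j : Fin N, b j)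
  obtain ⟨φ, F, hφ, hl2, hF, hFe⟩ := h.exists_dominatedHoloN hN hadm
  have hfin := ne_top_of_le_ne_top ENNReal.ofReal_ne_top hl2
  obtain ⟨C, hC, hCb⟩ := exists_functionalBounds X 1 hpos
  set B := ENNReal.ofReal (1 + C * (κ ^ 2)⁻¹)
  set D := (∑ k ∈ Finset.range N, B ^ k) * l2 (gaussN N) φ with hD
  have hDfin : D ≠ ⊤ := ENNReal.mul_ne_top
    (ENNReal.sum_ne_top.2 fun k _ => ENNReal.pow_ne_top ENNReal.ofReal_ne_top) hfin
  have hbound : ∀ m, ‖∫ y, f (extendZero y) ∂(gaussN N) -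
      ∑ ν ∈ Finset.Icc 0 (boxTop N m), diffQuad ν f‖ₑ ≤
      ENNReal.ofReal (C * (κ ^ 2)⁻¹ * (((m : ℝ) + 1) ^ 1)⁻¹) * D := by
    intro m
    obtain ⟨_, h2, h3⟩ := hCb κ le_rfl m
    have := enorm_integral_sub_tens_le hF hφ (fun _ => hpos) hfin ENNReal.ofReal_ne_top
      (fun _ => h2 m le_rfl) (fun _ => h3 m le_rfl)
    rw [mul_assoc] at this
    simp only [hFe] at this
    rw [sum_diffQuad_box]
    exact this
  have hlim : Tendsto (fun m : ℕ => ENNReal.ofReal (C * (κ ^ 2)⁻¹ * (((m : ℝ) + 1) ^ 1)⁻¹) * D) atTop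
      (𝓝 0) := by
    have h1 : Tendsto (fun m : ℕ => C * (κ ^ 2)⁻¹ * (((m : ℝ) + 1) ^ 1)⁻¹) atTop (𝓝 0) := by
      have := (tendsto_one_div_add_atTop_nhds_zero_nat (𝕜 := ℝ)).const_mul (C * (κ ^ 2)⁻¹)
      simpa using this
    have h2 := (ENNReal.tendsto_ofReal h1)
    rw [ENNReal.ofReal_zero] at h2
    have := ENNReal.Tendsto.mul_const h2 (Or.inr hDfin) (b := D)
    simpa using this
  rw [tendsto_iff_edist_tendsto_0]
  refine tendsto_of_tendsto_of_tendsto_of_le_of_le tendsto_const_nhds hlim (fun _ => zero_le)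
    fun m => ?_
  rw [edist_comm, edist_eq_enorm_sub]
  exact hbound m

/-- On a probability space the assumed L² convergence of the truncations implies L¹ convergence,
hence convergence of the integrals. -/
lemma IsHolo.tendsto_integral (h : IsHolo b ξ δ f) (hb : ∀ j, 0 < b j) (hξ : 0 < ξ) :
    Tendsto (fun N => ∫ y, f (extendZero y) ∂(gaussN N)) atTop (𝓝 (∫ y, f y ∂gaussU)) := by
  have hint : ∀ N, 1 ≤ N → Integrable (fun y => f (extendZero (restrict N y))) gaussU := by
    intro N hN
    exact ((measurePreserving_restrict N).integrable_comp
      (h.integrable_extendZero hb hξ hN).1).2 (h.integrable_extendZero hb hξ hN)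
  have hmain : Tendsto (fun N => ∫ y, f (extendZero (restrict N y)) ∂gaussU) atTop
      (𝓝 (∫ y, f y ∂gaussU)) := by
    refine tendsto_integral_of_L1' _ (h.memLp.integrable one_le_two).1
      ((eventually_ge_atTop 1).mono hint) ?_
    refine tendsto_of_tendsto_of_tendsto_of_le_of_le' tendsto_const_nhds h.tendsto
      (Eventually.of_forall fun _ => zero_le) ((eventually_ge_atTop 1).mono fun N hN => ?_)
    have h1 : (fun y => f (extendZero (restrict N y))) - f =
        -(fun y => f y - f (extendZero (restrict N y))) := by
      funext y; simp
    rw [h1, eLpNorm_neg]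
    exact eLpNorm_le_eLpNorm_of_exponent_le one_le_two (h.memLp.1.sub (hint N hN).1)
  refine hmain.congr' ((eventually_ge_atTop 1).mono fun N hN => ?_)
  have := integral_map (μ := gaussU) (φ := restrict N) (f := fun y => f (extendZero y))
    (measurePreserving_restrict N).measurable.aemeasurable
    (by rw [(measurePreserving_restrict N).map_eq]; exact (h.integrable_extendZero hb hξ hN).1)
  rw [(measurePreserving_restrict N).map_eq] at this
  exact this.symm

/-- The integral is the sum of all tensorized differences. -/
theorem IsHolo.hasSum_diffQuad (h : IsHolo b ξ δ f) (hb : ∀ j, 0 < b j) (hξ : 0 < ξ)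
    (hs : Summable fun ν => ‖diffQuad ν f‖) :
    HasSum (fun ν => diffQuad ν f) (∫ y, f y ∂gaussU) := by
  have hsum := hs.of_norm.hasSum
  -- A diagonal choice: m(N) ≥ N makes the boxes exhaust all multi-indices, while the box sum stays
  -- within 1/(N+1) of the N-dimensional integral. Absolute summability then identifies the limit.
  have hm : ∀ N : ℕ, ∃ m, N ≤ m ∧ (1 ≤ N → dist (∑ ν ∈ Finset.Icc 0 (boxTop N m), diffQuad ν f)
      (∫ y, f (extendZero y) ∂(gaussN N)) < 1 / ((N : ℝ) + 1)) := by
    intro N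
    by_cases hN : 1 ≤ N
    · have h1 := (h.tendsto_box hb hξ hN).eventually
        (Metric.ball_mem_nhds _ (by positivity : 0 < 1 / ((N : ℝ) + 1)))
      obtain ⟨m, hm1, hm2⟩ := (h1.and (eventually_ge_atTop N)).exists
      exact ⟨m, hm2, fun _ => hm1⟩
    · exact ⟨N, le_rfl, fun h => absurd h hN⟩
  choose m hm1 hm2 using hm
  have hbox : Tendsto (fun N => Finset.Icc 0 (boxTop N (m N))) atTop atTop := by
    refine tendsto_atTop.2 fun s => ?_
    have : ∀ ν ∈ s, ∀ᶠ N in atTop, ν ∈ Finset.Icc 0 (boxTop N (m N)) := by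
      intro ν _
      filter_upwards [eventually_ge_atTop (ν.support.sup id + 1),
        eventually_ge_atTop (ν.support.sup ν)] with N h1 h2
      rw [Finset.mem_Icc]
      refine ⟨zero_le, boxTop_le_boxTop (fun j hj => ?_) fun j => ?_⟩
      · have : j ≤ ν.support.sup id := Finset.le_sup (f := id) hj
        exact Finset.mem_range.2 (by omega)
      · by_cases hj : j ∈ ν.support
        · exact (Finset.le_sup (f := ν) hj).trans (h2.trans (hm1 N))
        · rw [Finsupp.notMem_support_iff.1 hj]; exact Nat.zero_le _
    exact (Filter.eventually_all_finset s).2 this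
  have h1 := hsum.comp hbox
  have h2 : Tendsto (fun N => dist (∑ ν ∈ Finset.Icc 0 (boxTop N (m N)), diffQuad ν f)
      (∫ y, f (extendZero y) ∂(gaussN N))) atTop (𝓝 0) :=
    tendsto_of_tendsto_of_tendsto_of_le_of_le' tendsto_const_nhds
      (tendsto_one_div_add_atTop_nhds_zero_nat (𝕜 := ℝ))
      (Eventually.of_forall fun _ => dist_nonneg)
      ((eventually_ge_atTop 1).mono fun N hN => (hm2 N hN).le)
  have h3 := h.tendsto_integral hb hξ
  have h4 : Tendsto (fun N => dist (∑ ν ∈ Finset.Icc 0 (boxTop N (m N)), diffQuad ν f)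
      (∫ y, f (extendZero y) ∂(gaussN N))) atTop
      (𝓝 (dist (∑' ν, diffQuad ν f) (∫ y, f y ∂gaussU))) := Tendsto.dist h1 h3
  rw [← dist_eq_zero.1 (tendsto_nhds_unique h4 h2)]
  exact hsum

end Integral

/-! ### Sums of products over finite sets and over multi-indices. -/

section SubsetSums

lemma pow_succ_add_le_add_pow {s a : ℝ} (hs : 0 ≤ s) (ha : 0 ≤ a) (m : ℕ) :
    s ^ (m + 1) + (m + 1) * a * s ^ m ≤ (s + a) ^ (m + 1) := by
  induction m with
  | zero => simp
  | succ m ih =>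
    have h1 : (s + a) ^ (m + 1 + 1) = (s + a) ^ (m + 1) * (s + a) := pow_succ _ _
    rw [h1]
    refine le_trans ?_ (mul_le_mul_of_nonneg_right ih (by positivity))
    have h2 : 0 ≤ (m + 1 : ℝ) * a * s ^ m * a := by positivity
    push_cast
    ring_nf
    ring_nf at h2
    linarith

/-- Expanding (∑ z_j)^m produces each squarefree monomial m! times. The induction splits subsets
according to whether they contain the new element. -/
lemma factorial_mul_sum_powersetCard_le {ι : Type*} [DecidableEq ι] {z : ι → ℝ} (hz : ∀ j, 0 ≤ z j)
    (T : Finset ι) (m : ℕ) :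
    (m.factorial : ℝ) * ∑ S ∈ T.powersetCard m, ∏ j ∈ S, z j ≤ (∑ j ∈ T, z j) ^ m := by
  induction T using Finset.induction_on generalizing m with
  | empty =>
    cases m with
    | zero => simp
    | succ m =>
      rw [Finset.powersetCard_eq_empty.2 (by simp)]
      simp
  | insert a T ha ih =>
    cases m with
    | zero => simp
    | succ m =>
      have hdisj : Disjoint (T.powersetCard (m + 1)) ((T.powersetCard m).image (insert a)) := by
        rw [Finset.disjoint_left]
        intro S hS hS'
        obtain ⟨S', _, rfl⟩ := Finset.mem_image.1 hS'
        exact ha ((Finset.mem_powersetCard.1 hS).1 (Finset.mem_insert_self _ _))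
      have hnot : ∀ S ∈ T.powersetCard m, a ∉ S := fun S hS h =>
        ha ((Finset.mem_powersetCard.1 hS).1 h)
      rw [Finset.powersetCard_succ_insert ha, Finset.sum_union hdisj, Finset.sum_image,
        Finset.sum_insert ha, add_comm (z a)]
      · have h1 : ∑ S ∈ T.powersetCard m, ∏ j ∈ insert a S, z j =
            z a * ∑ S ∈ T.powersetCard m, ∏ j ∈ S, z j := by
          rw [Finset.mul_sum]
          exact Finset.sum_congr rfl fun S hS => Finset.prod_insert (hnot S hS)
        have h2 := ih (m + 1)
        have h3 := mul_le_mul_of_nonneg_left (ih m) (by have := hz a; positivity : 0 ≤ (m + 1 : ℝ) * z a)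
        refine le_trans ?_ (pow_succ_add_le_add_pow (Finset.sum_nonneg fun j _ => hz j) (hz a) m)
        rw [h1, mul_add, Nat.factorial_succ]
        rw [Nat.factorial_succ] at h2
        push_cast at h2 ⊢
        linarith
      · intro S hS S' hS' h
        rw [← Finset.erase_insert (hnot S hS), ← Finset.erase_insert (hnot S' hS')]
        exact congrArg (fun s => s.erase a) h

lemma factorial_mul_prod_le_pow {ι : Type*} [DecidableEq ι] {z : ι → ℝ} (hz : ∀ j, 0 ≤ z j)
    (S : Finset ι) : (S.card.factorial : ℝ) * ∏ j ∈ S, z j ≤ (∑ j ∈ S, z j) ^ S.card := by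
  have := factorial_mul_sum_powersetCard_le hz S S.card
  rwa [Finset.powersetCard_self, Finset.sum_singleton] at this

lemma factorial_mul_prod_le_one {z : ℕ → ℝ} (hz : ∀ j, 0 ≤ z j) (hs : Summable z)
    (h1 : ∑' j, z j < 1) (S : Finset ℕ) : (S.card.factorial : ℝ) * ∏ j ∈ S, z j ≤ 1 :=
  (factorial_mul_prod_le_pow hz S).trans (pow_le_one₀ (Finset.sum_nonneg fun j _ => hz j)
    ((hs.sum_le_tsum _ fun j _ => hz j).trans h1.le))

/-- Grouped by cardinality, the sum is dominated by the geometric series in ∑ z_j. -/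
lemma summable_factorial_mul_prod {z : ℕ → ℝ} (hz : ∀ j, 0 ≤ z j) (hs : Summable z)
    (h1 : ∑' j, z j < 1) : Summable fun S : Finset ℕ => (S.card.factorial : ℝ) * ∏ j ∈ S, z j := by
  have h0 : ∀ S : Finset ℕ, 0 ≤ (S.card.factorial : ℝ) * ∏ j ∈ S, z j := fun S =>
    mul_nonneg (Nat.cast_nonneg _) (Finset.prod_nonneg fun j _ => hz j)
  have hz0 : 0 ≤ ∑' j, z j := tsum_nonneg hz
  refine summable_of_sum_le (c := ∑' m : ℕ, (∑' j, z j) ^ m) h0 fun 𝒮 => ?_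
  set T := 𝒮.sup id
  have hsub : 𝒮 ⊆ T.powerset := fun S hS => Finset.mem_powerset.2 (Finset.le_sup (f := id) hS)
  refine (Finset.sum_le_sum_of_subset_of_nonneg hsub fun S _ _ => h0 S).trans ?_
  rw [Finset.sum_powerset]
  refine le_trans (Finset.sum_le_sum fun m _ => ?_)
    ((summable_geometric_of_lt_one hz0 h1).sum_le_tsum _ fun m _ => pow_nonneg hz0 m)
  rw [Finset.sum_congr rfl fun S hS => by rw [(Finset.mem_powersetCard.1 hS).2], ← Finset.mul_sum]
  exact (factorial_mul_sum_powersetCard_le hz T m).trans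
    (pow_le_pow_left₀ (Finset.sum_nonneg fun j _ => hz j) (hs.sum_le_tsum _ fun j _ => hz j) m)

/-- Summation over multi-indices, grouped by their supports. -/
lemma summable_support_mul_prod {h : Finset ℕ → ℝ} {y : ℕ → ℝ} (hh : ∀ S, 0 ≤ h S)
    (hy : ∀ n, 0 ≤ y n) (hys : Summable y)
    (hs : Summable fun S : Finset ℕ => h S * (∑' n, y n) ^ S.card) :
    Summable fun ν : ℕ →₀ ℕ => h ν.support * ∏ j ∈ ν.support, y (ν j) := by
  classical
  have hY : 0 ≤ ∑' n, y n := tsum_nonneg hy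
  refine summable_of_sum_le (c := ∑' S : Finset ℕ, h S * (∑' n, y n) ^ S.card)
    (fun ν => mul_nonneg (hh _) (Finset.prod_nonneg fun j _ => hy _)) fun 𝒩 => ?_
  set M := 𝒩.sup fun ν => ν.support.sup ν
  have hM : ∀ ν ∈ 𝒩, ∀ j ∈ ν.support, ν j ≤ M := fun ν hν j hj =>
    (Finset.le_sup (f := ν) hj).trans (Finset.le_sup (f := fun ν : ℕ →₀ ℕ => ν.support.sup ν) hν)
  rw [← Finset.sum_fiberwise_of_maps_to (t := 𝒩.image Finsupp.support) (g := Finsupp.support)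
    fun ν hν => Finset.mem_image_of_mem _ hν]
  refine le_trans (Finset.sum_le_sum fun S _ => ?_)
    (hs.sum_le_tsum (𝒩.image Finsupp.support) fun S _ => mul_nonneg (hh S) (pow_nonneg hY _))
  have e1 : ∑ ν ∈ 𝒩 with ν.support = S, h ν.support * ∏ j ∈ ν.support, y (ν j) =
      h S * ∑ ν ∈ 𝒩 with ν.support = S, ∏ j ∈ S, y (ν j) := by
    rw [Finset.mul_sum]
    refine Finset.sum_congr rfl fun ν hν => ?_
    rw [(Finset.mem_filter.1 hν).2]
  rw [e1]
  refine mul_le_mul_of_nonneg_left ?_ (hh S)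
  -- Multi-indices with support S inject into the functions from S to {0, …, M}. The sum over all
  -- those functions factorizes into a power of ∑ y.
  have e2 : ∑ ν ∈ 𝒩 with ν.support = S, ∏ j ∈ S, y (ν j) =
      ∑ p ∈ (𝒩.filter fun ν => ν.support = S).image
        (fun ν => (fun j (_ : j ∈ S) => ν j : ∀ j ∈ S, ℕ)), ∏ x ∈ S.attach, y (p x.1 x.2) := by
    rw [Finset.sum_image]
    · refine Finset.sum_congr rfl fun ν _ => ?_
      rw [← Finset.prod_attach]
    · intro ν hν μ hμ hνμ
      have hν := (Finset.mem_filter.1 hν).2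
      have hμ := (Finset.mem_filter.1 hμ).2
      ext j
      by_cases hj : j ∈ S
      · exact congrFun (congrFun hνμ j) hj
      · rw [Finsupp.notMem_support_iff.1 (hν ▸ hj), Finsupp.notMem_support_iff.1 (hμ ▸ hj)]
  rw [e2]
  have e3 : (𝒩.filter fun ν => ν.support = S).image
      (fun ν => (fun j (_ : j ∈ S) => ν j : ∀ j ∈ S, ℕ)) ⊆ S.pi fun _ => Finset.range (M + 1) := by
    intro p hp
    obtain ⟨ν, hν, rfl⟩ := Finset.mem_image.1 hp
    obtain ⟨h1, h2⟩ := Finset.mem_filter.1 hν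
    rw [Finset.mem_pi]
    intro j hj
    rw [Finset.mem_range]
    exact Nat.lt_succ_of_le (hM ν h1 j (h2 ▸ hj))
  refine (Finset.sum_le_sum_of_subset_of_nonneg e3 fun p _ _ =>
    Finset.prod_nonneg fun x _ => hy _).trans ?_
  rw [← Finset.prod_sum S (fun _ => Finset.range (M + 1)) fun _ n => y n, Finset.prod_const]
  exact pow_le_pow_left₀ (Finset.sum_nonneg fun n _ => hy n) (hys.sum_le_tsum _ fun n _ => hy n) _

lemma summable_prod_support {x y : ℕ → ℝ} (hx : ∀ j, 0 ≤ x j) (hxs : Summable x)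
    (hy : ∀ n, 0 ≤ y n) (hys : Summable y) :
    Summable fun ν : ℕ →₀ ℕ => ∏ j ∈ ν.support, x j * y (ν j) := by
  simp only [Finset.prod_mul_distrib]
  refine summable_support_mul_prod (h := fun S => ∏ j ∈ S, x j)
    (fun S => Finset.prod_nonneg fun j _ => hx j) hy hys ?_
  have := summable_finsetProd_of_summable_nonneg (f := fun j => x j * ∑' n, y n)
    (fun j => mul_nonneg (hx j) (tsum_nonneg hy)) (hxs.mul_right _)
  simpa only [Finset.prod_mul_distrib, Finset.prod_const] using this

/-- Summability of `∏_{j ∈ S} z_j` with an additional factor `n^n`, where `n` is the number of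
large elements of `S`. -/
lemma exists_summable_card_pow {x : ℕ → ℝ} (hx : ∀ j, 0 ≤ x j) (hxs : Summable x) {D : ℝ}
    (hD : 0 ≤ D) : ∃ J : ℕ, Summable fun S : Finset ℕ =>
      (∏ j ∈ S with j < J, D) *
        (∏ j ∈ S with ¬ j < J, ((S.filter fun j => ¬ j < J).card : ℝ) * x j) ^ 4 := by
  have hlim := tendsto_sum_nat_add (fun j => Real.exp 1 * x j)
  -- Beyond J the values e x_j sum to less than 1, as the geometric series requires; the factor e is
  -- the price of n^n ≤ e^n n!.
  obtain ⟨J, hJ⟩ := (hlim.eventually (gt_mem_nhds one_pos)).exists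
  refine ⟨J, ?_⟩
  set z : ℕ → ℝ := fun j => if j < J then 0 else Real.exp 1 * x j with hz
  have hz0 : ∀ j, 0 ≤ z j := fun j => by
    rw [hz]; beta_reduce; split_ifs
    · exact le_rfl
    · have := hx j; positivity
  have hzs : Summable z := by
    refine Summable.of_nonneg_of_le hz0 (fun j => ?_) (hxs.mul_left (Real.exp 1))
    rw [hz]; beta_reduce; split_ifs
    · have := hx j; positivity
    · exact le_rfl
  have hz1 : ∑' j, z j < 1 := by
    rw [← hzs.sum_add_tsum_nat_add J, Finset.sum_eq_zero, zero_add]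
    · refine lt_of_eq_of_lt (tsum_congr fun j => ?_) hJ
      rw [hz]; beta_reduce; rw [if_neg (by omega)]
    · intro j hj
      rw [hz]; beta_reduce; rw [if_pos (Finset.mem_range.1 hj)]
  have hg0 : ∀ S : Finset ℕ, 0 ≤ (S.card.factorial : ℝ) * ∏ j ∈ S, z j := fun S =>
    mul_nonneg (Nat.cast_nonneg _) (Finset.prod_nonneg fun j _ => hz0 j)
  have hg := summable_factorial_mul_prod hz0 hzs hz1
  have hD' : Summable fun S : Finset ℕ => ∏ j ∈ S, if j < J then D else 0 := by
    refine summable_finsetProd_of_summable_nonneg (fun j => by split_ifs <;> simp [hD]) ?_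
    exact summable_of_ne_finset_zero (s := Finset.range J) fun j hj => by
      rw [if_neg (by simpa using hj)]
  have hprod := hD'.mul_of_nonneg hg (fun S => Finset.prod_nonneg fun j _ => by
    split_ifs <;> simp [hD]) hg0
  -- A set is determined by its parts below and above J, so a product of two summable families
  -- dominates.
  have hinj : Function.Injective fun S : Finset ℕ =>
      (S.filter fun j => j < J, S.filter fun j => ¬ j < J) := by
    intro S T h
    simp only [Prod.mk.injEq] at h
    rw [← Finset.filter_union_filter_not_eq (fun j => j < J) S,
      ← Finset.filter_union_filter_not_eq (fun j => j < J) T, h.1, h.2]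
  refine Summable.of_nonneg_of_le (fun S => ?_) (fun S => ?_) (hprod.comp_injective hinj)
  · exact mul_nonneg (Finset.prod_nonneg fun _ _ => hD) (by positivity)
  · simp only [Function.comp]
    set S' := S.filter fun j => ¬ j < J
    refine mul_le_mul (le_of_eq (Finset.prod_congr rfl fun j hj => ?_)) ?_ (by positivity)
      (Finset.prod_nonneg fun j _ => by split_ifs <;> simp [hD])
    · rw [if_pos (Finset.mem_filter.1 hj).2]
    · have h1 := factorial_mul_prod_le_one hz0 hzs hz1 S'
      have h2 : ∏ j ∈ S', (S'.card : ℝ) * x j ≤ (S'.card.factorial : ℝ) * ∏ j ∈ S', z j := by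
        have e : ∏ j ∈ S', z j = ∏ j ∈ S', Real.exp 1 * x j :=
          Finset.prod_congr rfl fun j hj => by
            rw [hz]; beta_reduce; rw [if_neg (Finset.mem_filter.1 hj).2]
        rw [e, Finset.prod_mul_distrib, Finset.prod_mul_distrib, Finset.prod_const,
          Finset.prod_const, ← mul_assoc]
        refine mul_le_mul_of_nonneg_right ?_ (Finset.prod_nonneg fun j _ => hx j)
        have := Real.pow_div_factorial_le_exp (S'.card : ℝ) (Nat.cast_nonneg _) S'.card
        rw [div_le_iff₀ (by positivity)] at this
        rw [← Real.exp_nat_mul, mul_one]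
        linarith
      have h3 : 0 ≤ ∏ j ∈ S', (S'.card : ℝ) * x j := Finset.prod_nonneg fun j _ =>
        mul_nonneg (Nat.cast_nonneg _) (hx j)
      -- The product is at most 1, so the fourth power may be dropped.
      calc _ ≤ ∏ j ∈ S', (S'.card : ℝ) * x j :=
            pow_le_of_le_one h3 (h2.trans h1) (by norm_num)
        _ ≤ _ := h2

end SubsetSums

/-- Markov's inequality for y^{2k} bounds the mass outside the ball by a multiple of κ^{-2k}. With k
free, the norms of evaluation at zero have a bounded product over all coordinates as soon as some
power of κ_j⁻¹ is summable. -/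
lemma exists_gaussian_ball_le (k : ℕ) {κ₀ : ℝ} (hκ₀ : 0 < κ₀) :
    ∃ c : ℝ, 0 ≤ c ∧ ∀ κ, κ₀ ≤ κ → γ₁ (Metric.ball 0 κ) ^ (-(1 / 2) : ℝ) ≤
      ENNReal.ofReal (Real.exp (c * ((κ ^ (2 * k))⁻¹))) := by
  have hint : Integrable (fun y : ℝ => y ^ (2 * k)) γ₁ := by
    simpa using integrable_polynomial (Polynomial.X ^ (2 * k))
  set P₀ := γ₁.real (Metric.ball 0 κ₀) with hP₀
  have hP₀pos : 0 < P₀ := ENNReal.toReal_pos (gaussian_ball_ne_zero hκ₀) (measure_ne_top _ _)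
  set M := ∫ y, y ^ (2 * k) ∂γ₁
  have hnn : ∀ y : ℝ, 0 ≤ y ^ (2 * k) := fun y => by rw [pow_mul]; positivity
  have hM : 0 ≤ M := integral_nonneg hnn
  refine ⟨M / P₀, by positivity, fun κ hκ => ?_⟩
  have hκpos : 0 < κ := hκ₀.trans_le hκ
  set P := γ₁.real (Metric.ball 0 κ) with hP
  have hPP : P₀ ≤ P := measureReal_mono (Metric.ball_subset_ball hκ)
  have hPpos : 0 < P := hP₀pos.trans_le hPP
  have hP1 : P ≤ 1 := measureReal_le_one
  have hmark := mul_meas_ge_le_integral_of_nonneg (μ := γ₁) (f := fun y : ℝ => y ^ (2 * k))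
    (Eventually.of_forall hnn) hint (κ ^ (2 * k))
  have hcompl : 1 - P ≤ γ₁.real {y : ℝ | κ ^ (2 * k) ≤ y ^ (2 * k)} := by
    rw [hP, ← probReal_compl_eq_one_sub Metric.isOpen_ball.measurableSet]
    refine measureReal_mono fun y hy => ?_
    simp only [Set.mem_compl_iff, Metric.mem_ball, dist_zero_right, not_lt, Real.norm_eq_abs] at hy
    have h1 := pow_le_pow_left₀ hκpos.le hy (2 * k)
    rw [pow_mul |y|, sq_abs, ← pow_mul] at h1
    exact h1
  have hpow : (0 : ℝ) < κ ^ (2 * k) := by positivity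
  have h1 : 1 - P ≤ M * (κ ^ (2 * k))⁻¹ := by
    rw [← div_eq_mul_inv, le_div_iff₀ hpow, mul_comm]
    exact (mul_le_mul_of_nonneg_left hcompl hpow.le).trans hmark
  have h2 : P⁻¹ ≤ 1 + M / P₀ * (κ ^ (2 * k))⁻¹ := by
    have e : P⁻¹ = 1 + (1 - P) * P⁻¹ := by field_simp; ring
    rw [e, div_mul_eq_mul_div, div_eq_mul_inv]
    gcongr
  have h3 : γ₁ (Metric.ball 0 κ) = ENNReal.ofReal P := (ofReal_measureReal (measure_ne_top _ _)).symm
  rw [h3, ENNReal.ofReal_rpow_of_pos hPpos]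
  refine ENNReal.ofReal_le_ofReal ?_
  calc P ^ (-(1 / 2) : ℝ) ≤ P ^ (-1 : ℝ) :=
        Real.rpow_le_rpow_of_exponent_ge hPpos hP1 (by norm_num)
    _ = P⁻¹ := Real.rpow_neg_one P
    _ ≤ _ := h2
    _ ≤ _ := by rw [add_comm]; exact Real.add_one_le_exp _

/-! ### The sequences ϱ_j and weighted summability of the differences. -/

section RhoSeq
variable {b : ℕ → ℝ} {p ξ : ℝ}

lemma lpNorm_pos (hb : ∀ j, 0 < b j) (hbs : Summable fun j => b j ^ p) : 0 < lpNorm p b :=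
  Real.rpow_pos_of_pos (hbs.tsum_pos (fun j => (Real.rpow_pos_of_pos (hb j) _).le) 0
    (Real.rpow_pos_of_pos (hb 0) _)) _

lemma rhoSeq_pos (hb : ∀ j, 0 < b j) (hbs : Summable fun j => b j ^ p) (hξ : 0 < ξ) (j : ℕ) :
    0 < rhoSeq b p ξ j := by
  have := lpNorm_pos hb hbs
  have := Real.rpow_pos_of_pos (hb j) (p - 1)
  unfold rhoSeq; positivity

lemma rpow_summable_of_le {s : ℝ} (hb : ∀ j, 0 < b j) (hbs : Summable fun j => b j ^ p)
    (hp : 0 < p) (hs : p ≤ s) : Summable fun j => b j ^ s := by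
  have h1 : ∀ᶠ j in cofinite, b j ^ p < 1 := hbs.tendsto_cofinite_zero.eventually (gt_mem_nhds one_pos)
  refine Summable.of_norm_bounded_eventually hbs ?_
  filter_upwards [h1] with j hj
  have hb1 : b j ≤ 1 := by
    by_contra h
    exact absurd hj (not_lt.2 (Real.one_le_rpow (not_le.1 h).le hp.le))
  rw [Real.norm_of_nonneg (Real.rpow_pos_of_pos (hb j) _).le]
  exact Real.rpow_le_rpow_of_exponent_ge (hb j) hb1 hs

/-- Up to a constant, ϱ_j^{-s} equals b_j^{(1-p)s}. For s = p/(1-p) this is exactly the ℓ^p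
assumption. -/
lemma summable_rhoSeq_rpow {s : ℝ} (hb : ∀ j, 0 < b j) (hbs : Summable fun j => b j ^ p)
    (hp : 0 < p) (hξ : 0 < ξ) (hs0 : 0 ≤ s) (hs : p ≤ (1 - p) * s) :
    Summable fun j => (max 1 (1 * rhoSeq b p ξ j)) ^ (-s) := by
  have hl := lpNorm_pos hb hbs
  have h1 := (rpow_summable_of_le hb hbs hp hs).mul_right ((ξ / (4 * lpNorm p b)) ^ (-s))
  refine Summable.of_nonneg_of_le (fun j => by positivity) (fun j => ?_) h1
  have e : b j ^ ((1 - p) * s) * (ξ / (4 * lpNorm p b)) ^ (-s) = rhoSeq b p ξ j ^ (-s) := by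
    rw [rhoSeq, Real.mul_rpow (Real.rpow_pos_of_pos (hb j) _).le (by positivity),
      ← Real.rpow_mul (hb j).le]
    congr 2; ring
  rw [e, one_mul]
  exact Real.rpow_le_rpow_of_nonpos (rhoSeq_pos hb hbs hξ j) (le_max_right _ _) (by linarith)

lemma summable_mul_max_rhoSeq (hb : ∀ j, 0 < b j) (hbs : Summable fun j => b j ^ p)
    (hp : 0 < p) (hp1 : p < 1) (hξ : 0 < ξ) :
    Summable fun j => b j * max 1 (1 * rhoSeq b p ξ j) := by
  have hl := lpNorm_pos hb hbs
  have h1 : Summable b := by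
    simpa using rpow_summable_of_le hb hbs hp (s := 1) hp1.le
  have h2 := hbs.mul_right (ξ / (4 * lpNorm p b))
  refine Summable.of_nonneg_of_le (fun j => ?_) (fun j => ?_) (h1.add h2)
  · have := hb j; positivity
  · have e : b j ^ p * (ξ / (4 * lpNorm p b)) = b j * rhoSeq b p ξ j := by
      rw [rhoSeq, ← mul_assoc]
      congr 1
      have := Real.rpow_add (hb j) 1 (p - 1)
      rw [Real.rpow_one] at this
      rw [← this]; congr 1; ring
    rw [e, one_mul, ← mul_one_add]
    refine mul_le_mul_of_nonneg_left ?_ (hb j).le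
    have := rhoSeq_pos hb hbs hξ j
    exact max_le (by linarith) (by linarith)

end RhoSeq

variable {X : Type*} [NormedAddCommGroup X] [InnerProductSpace ℂ X]

lemma IsHolo.norm_diffQuad_le {b : ℕ → ℝ} {ξ δ : ℝ} {f : (ℕ → ℝ) → X} (h : IsHolo b ξ δ f)
    (hδ : 0 ≤ δ) {κ : ℕ → ℝ} {N M : ℕ} {ν : ℕ →₀ ℕ} (hN : ν.support ⊆ Finset.range N) (hN1 : 1 ≤ N)
    (hM : ∀ j, ν j ≤ M) (hκ : Admissible b ξ fun j : Fin N => κ j) {a : ℕ → ℝ} (ha : ∀ j, 0 ≤ a j)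
    (hA : ∀ j, FunctionalBound X (nodeAt M) (κ j) (ENNReal.ofReal (a j)) (diffCoeff M (ν j))) :
    ‖diffQuad ν f‖ ≤ δ * ∏ j ∈ Finset.range N, a j := by
  obtain ⟨φ, F, hφ, hl2, hF, hFe⟩ := h.exists_dominatedHoloN hN1 hκ
  have h1 := enorm_tens_le hF hφ (fun j => hκ.1 j) (fun j => hA j)
  simp only [hFe] at h1
  rw [← diffQuad_eq_tens hN hM f, ← ENNReal.ofReal_prod_of_nonneg fun j _ => ha _] at h1
  have h2 := h1.trans (mul_le_mul_right hl2 _)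
  rw [← ENNReal.ofReal_mul (Finset.prod_nonneg fun j _ => ha _), ← ofReal_norm,
    ENNReal.ofReal_le_ofReal_iff (mul_nonneg (Finset.prod_nonneg fun j _ => ha _) hδ)] at h2
  rw [Finset.prod_range, mul_comm]
  exact h2

variable (X) [CompleteSpace X]

/-- Weighted square summability of the tensorized differences of holomorphic functions. -/
theorem exists_diffQuad_bound {b : ℕ → ℝ} {p ξ : ℝ} (hb : ∀ j, 0 < b j)
    (hbs : Summable fun j => b j ^ p) (hp : 0 < p) (hp1 : p < 1) (hξ : 0 < ξ) (r : ℝ) :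
    ∃ A : (ℕ →₀ ℕ) → ℝ, (∀ ν, 0 ≤ A ν) ∧
      (Summable fun ν => indexWeight 1 r (rhoSeq b p ξ) ν * A ν ^ 2) ∧
      ∀ (δ : ℝ) (f : (ℕ → ℝ) → X), 0 ≤ δ → IsHolo b ξ δ f → ∀ ν, ‖diffQuad ν f‖ ≤ δ * A ν := by
  classical
  set m : ℕ → ℝ := fun j => max 1 (1 * rhoSeq b p ξ j) with hm
  have hm1 : ∀ j, 1 ≤ m j := fun j => le_max_left _ _
  have hm0 : ∀ j, 0 < m j := fun j => one_pos.trans_le (hm1 j)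
  set β : ℕ → ℝ := fun j => b j * m j with hβ
  have hβ0 : ∀ j, 0 < β j := fun j => mul_pos (hb j) (hm0 j)
  have hβs : Summable β := summable_mul_max_rhoSeq hb hbs hp hp1 hξ
  set B := ∑' j, β j with hB
  have hB0 : 0 < B := hβs.tsum_pos (fun j => (hβ0 j).le) 0 (hβ0 0)
  -- The radii θ m_j use at most half of the budget: ∑ b_j θ m_j ≤ ξ/2.
  set θ := ξ / (2 * B) with hθ
  have hθ0 : 0 < θ := by positivity
  -- This choice makes m_j^{-2k} summable, so that all coordinates with ν_j = 0 together cost at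
  -- most the constant `G`.
  obtain ⟨k, hk⟩ := exists_nat_ge (p / (1 - p))
  obtain ⟨c, hc0, hc⟩ := exists_gaussian_ball_le k hθ0
  -- Polynomial decay of this order in ν_j outweighs the weight ν_j^{r-3}: the exponent r - 3 - 2t
  -- is at most -3.
  set t := ⌈r⌉₊ with ht
  obtain ⟨C, hC0, hC⟩ := exists_functionalBounds X t hθ0
  have hsum1 : Summable fun j => ((θ * m j) ^ (2 * k))⁻¹ := by
    have h1 : p ≤ (1 - p) * (2 * k : ℕ) := by
      rw [div_le_iff₀ (by linarith)] at hk
      push_cast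
      nlinarith
    have := (summable_rhoSeq_rpow hb hbs hp hξ (Nat.cast_nonneg (2 * k)) h1).mul_left
      ((θ ^ (2 * k))⁻¹)
    refine this.congr fun j => ?_
    rw [mul_pow, mul_inv, Real.rpow_neg (hm0 j).le, Real.rpow_natCast]
  set G := Real.exp (c * ∑' j, ((θ * m j) ^ (2 * k))⁻¹) with hG
  set y : ℕ → ℝ := fun n => C ^ 2 * (n : ℝ) ^ (r - 3 - 2 * t) with hy
  have hy0 : ∀ n, 0 ≤ y n := fun n => by positivity
  have hys : Summable y := by
    refine Summable.mul_left _ (Real.summable_nat_rpow.2 ?_)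
    have h1 := Nat.le_ceil r
    have h2 : (0 : ℝ) ≤ t := Nat.cast_nonneg _
    rw [← ht] at h1
    linarith
  set Y := ∑' n, y n with hY
  have hY0 : 0 ≤ Y := tsum_nonneg hy0
  -- Summation over the value of each support entry costs a factor Y ≤ L^4, which is absorbed into
  -- the fourth power of x_j.
  set L := max 1 Y with hL
  have hL1 : 1 ≤ L := le_max_left _ _
  have hLY : Y ≤ L ^ 4 := (le_max_right _ _).trans (le_self_pow₀ hL1 (by norm_num))
  obtain ⟨J, hJ⟩ := exists_summable_card_pow (x := fun j => L * (2 / ξ) * β j)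
    (fun j => by have := hβ0 j; positivity) (hβs.mul_left _) (D := θ⁻¹ ^ 4 * Y) (by positivity)
  set n : Finset ℕ → ℕ := fun S => (S.filter fun j => ¬ j < J).card with hn
  -- An upper bound for m_j/κ_j on the support: from the uniform part of the radius below J, from
  -- the ν-dependent part beyond J.
  set e : Finset ℕ → ℕ → ℝ := fun S j => if j < J then θ⁻¹ else 2 * β j * n S / ξ with he
  have he0 : ∀ S j, 0 ≤ e S j := fun S j => by
    have := hβ0 j
    simp only [he]; split_ifs <;> positivity
  refine ⟨fun ν => G * ∏ j ∈ ν.support, C * ((m j)⁻¹ * e ν.support j) ^ 2 * ((ν j : ℝ) ^ t)⁻¹,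
    fun ν => mul_nonneg (Real.exp_pos _).le (Finset.prod_nonneg fun j _ => by positivity), ?_, ?_⟩
  · have h1 : Summable fun S : Finset ℕ => (∏ j ∈ S, e S j ^ 4) * Y ^ S.card := by
      refine Summable.of_nonneg_of_le (fun S => ?_) (fun S => ?_) hJ
      · exact mul_nonneg (Finset.prod_nonneg fun j _ => by positivity) (pow_nonneg hY0 _)
      · rw [← Finset.prod_const, ← Finset.prod_mul_distrib,
          ← Finset.prod_filter_mul_prod_filter_not S (fun j => j < J), ← Finset.prod_pow]
        refine mul_le_mul (le_of_eq (Finset.prod_congr rfl fun j hj => ?_))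
          (Finset.prod_le_prod (fun j _ => by positivity) fun j hj => ?_)
          (Finset.prod_nonneg fun j _ => by positivity)
          (Finset.prod_nonneg fun j _ => by positivity)
        · simp only [he, if_pos (Finset.mem_filter.1 hj).2]
        · simp only [he, if_neg (Finset.mem_filter.1 hj).2]
          have e1 : ((n S : ℝ) * (L * (2 / ξ) * β j)) ^ 4 = (2 * β j * n S / ξ) ^ 4 * L ^ 4 := by
            ring
          rw [e1]
          exact mul_le_mul_of_nonneg_left hLY (by positivity)
    refine ((summable_support_mul_prod (h := fun S => ∏ j ∈ S, e S j ^ 4)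
      (fun S => Finset.prod_nonneg fun j _ => by positivity) hy0 hys h1).mul_left (G ^ 2)).congr
      fun ν => ?_
    rw [indexWeight, mul_pow, ← Finset.prod_pow, mul_left_comm _ (G ^ 2), ← Finset.prod_mul_distrib,
      ← Finset.prod_mul_distrib]
    congr 1
    refine Finset.prod_congr rfl fun j hj => ?_
    have hj0 : (0 : ℝ) < ν j := by
      exact_mod_cast Nat.pos_of_ne_zero (Finsupp.mem_support_iff.1 hj)
    have h2 : (ν j : ℝ) ^ (r - 3 - 2 * t) = (ν j : ℝ) ^ (r - 3) * (((ν j : ℝ) ^ t)⁻¹) ^ 2 := by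
      rw [Real.rpow_sub hj0, mul_comm 2 (t : ℝ), Real.rpow_mul hj0.le, Real.rpow_natCast,
        Real.rpow_two, div_eq_mul_inv, inv_pow]
    have h3 : max 1 (1 * rhoSeq b p ξ j) = m j := rfl
    rw [h3]
    simp only [hy]
    rw [h2]
    have := (hm0 j).ne'
    field_simp
  · intro δ f hδ hf ν
    set S := ν.support with hS
    -- The second half of the budget goes to the support coordinates beyond J. Each adds b_j m_j
    -- ξ/(2 β_j n) = ξ/(2n), and there are at most n of them.
    set κ : ℕ → ℝ := fun j => m j * (θ + if j ∈ S ∧ ¬ j < J then ξ / (2 * β j * n S) else 0) with hκ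
    have hadd0 : ∀ j, 0 ≤ if j ∈ S ∧ ¬ j < J then ξ / (2 * β j * n S) else 0 := fun j => by
      have := hβ0 j
      split_ifs <;> positivity
    have hκθ' : ∀ j, θ * m j ≤ κ j := fun j => by
      simp only [hκ]
      rw [mul_comm θ]
      exact mul_le_mul_of_nonneg_left (by linarith [hadd0 j]) (hm0 j).le
    have hκθ : ∀ j, θ ≤ κ j := fun j =>
      (le_mul_of_one_le_right hθ0.le (hm1 j)).trans (hκθ' j)
    have hκ0 : ∀ j, 0 < κ j := fun j => hθ0.trans_le (hκθ j)
    set N := S.sup id + 1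
    set M := S.sup ν
    have hN : S ⊆ Finset.range N := fun j hj =>
      Finset.mem_range.2 (Nat.lt_succ_of_le (Finset.le_sup (f := id) hj))
    have hM : ∀ j, ν j ≤ M := fun j => by
      by_cases hj : j ∈ S
      · exact Finset.le_sup (f := ν) hj
      · rw [Finsupp.notMem_support_iff.1 hj]; exact Nat.zero_le _
    have hadm : Admissible b ξ fun j : Fin N => κ j := by
      refine ⟨fun j => hκ0 j, ?_⟩
      rw [← Finset.sum_range fun j => b j * κ j]
      have e1 : ∀ j, b j * κ j = β j * θ + if j ∈ S.filter (fun j => ¬ j < J)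
          then ξ / (2 * n S) else 0 := by
        intro j
        simp only [hκ, Finset.mem_filter]
        rw [← mul_assoc, mul_add]
        congr 1
        split_ifs
        · have h1 := (hb j).ne'
          have h2 := (hm0 j).ne'
          simp only [hβ]
          field_simp
        · simp
      rw [Finset.sum_congr rfl fun j _ => e1 j, Finset.sum_add_distrib, ← Finset.sum_mul,
        ← Finset.sum_filter, Finset.sum_const, nsmul_eq_mul]
      have h1 : (∑ j ∈ Finset.range N, β j) * θ ≤ B * θ :=
        mul_le_mul_of_nonneg_right (hβs.sum_le_tsum _ fun j _ => (hβ0 j).le) hθ0.le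
      have h2 : B * θ = ξ / 2 := by rw [hθ]; field_simp
      have h3 : (({j ∈ Finset.range N | j ∈ S.filter (fun j => ¬ j < J)} : Finset ℕ).card : ℝ)
          ≤ n S := by
        exact_mod_cast Finset.card_le_card fun j hj => (Finset.mem_filter.1 hj).2
      have h4 : (n S : ℝ) * (ξ / (2 * n S)) ≤ ξ / 2 := by
        rcases Nat.eq_zero_or_pos (n S) with h0 | h0
        · rw [h0]; simp; positivity
        · have : (0 : ℝ) < n S := by exact_mod_cast h0
          exact le_of_eq (by field_simp)
      have h5 := mul_le_mul_of_nonneg_right h3 (by positivity : 0 ≤ ξ / (2 * (n S : ℝ)))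
      linarith
    -- Written as two factors so that the product separates into the evaluations at zero, bounded by
    -- `G`, and the true differences, which live on the support.
    set a : ℕ → ℝ := fun j => (if ν j = 0 then Real.exp (c * ((κ j) ^ (2 * k))⁻¹) else 1) *
      (if ν j = 0 then 1 else C * (κ j ^ 2)⁻¹ * ((ν j : ℝ) ^ t)⁻¹) with ha
    have ha0 : ∀ j, 0 ≤ a j := fun j => by
      simp only [ha]; split_ifs <;> positivity
    have hmain := hf.norm_diffQuad_le hδ hN (Nat.succ_pos _) hM hadm ha0 fun j => by
      by_cases hj : ν j = 0
      · intro φ g hφ hg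
        simp only [ha, if_pos hj]
        rw [hj, mul_one]
        exact (functionalBound_zero X M (hκ0 j) φ g hφ hg).trans
          (mul_le_mul_left (hc (κ j) (hκθ j)) _)
      · have := (hC (κ j) (hκθ j) M).1 (ν j) (Nat.pos_of_ne_zero hj) (hM j)
        simpa only [ha, if_neg hj, one_mul] using this
    refine hmain.trans (mul_le_mul_of_nonneg_left ?_ hδ)
    simp only [ha]
    rw [Finset.prod_mul_distrib]
    refine mul_le_mul ?_ ?_ (Finset.prod_nonneg fun j _ => by split_ifs <;> positivity)
      (Real.exp_pos _).le
    · calc _ ≤ ∏ j ∈ Finset.range N, Real.exp (c * ((θ * m j) ^ (2 * k))⁻¹) := by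
            refine Finset.prod_le_prod (fun j _ => by split_ifs <;> positivity) fun j _ => ?_
            have h1 := hm0 j
            split_ifs
            · refine Real.exp_le_exp.2 (mul_le_mul_of_nonneg_left ?_ hc0)
              exact inv_anti₀ (by positivity) (pow_le_pow_left₀ (by positivity) (hκθ' j) _)
            · exact Real.one_le_exp (by positivity)
        _ = Real.exp (c * ∑ j ∈ Finset.range N, ((θ * m j) ^ (2 * k))⁻¹) := by
            rw [← Real.exp_sum, Finset.mul_sum]
        _ ≤ G := by
            refine Real.exp_le_exp.2 (mul_le_mul_of_nonneg_left ?_ hc0)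
            exact hsum1.sum_le_tsum _ fun j _ => by have := hm0 j; positivity
    · rw [← Finset.prod_subset hN fun j _ hj => by
        rw [if_pos (Finsupp.notMem_support_iff.1 hj)]]
      refine Finset.prod_le_prod (fun j _ => by split_ifs <;> positivity) fun j hj => ?_
      rw [if_neg (Finsupp.mem_support_iff.1 hj)]
      refine mul_le_mul_of_nonneg_right (mul_le_mul_of_nonneg_left ?_ hC0.le) (by positivity)
      rw [← inv_pow]
      refine pow_le_pow_left₀ (inv_nonneg.2 (hκ0 j).le) ?_ 2
      have hmj := hm0 j
      have hbj := hβ0 j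
      by_cases hJj : j < J
      · simp only [he, if_pos hJj]
        rw [← mul_inv]
        refine inv_anti₀ (by positivity) ?_
        rw [mul_comm]; exact hκθ' j
      · simp only [he, if_neg hJj]
        have hn0 : 0 < n S := Finset.card_pos.2 ⟨j, Finset.mem_filter.2 ⟨hj, hJj⟩⟩
        have hn0' : (0 : ℝ) < n S := by exact_mod_cast hn0
        rw [← inv_div, ← mul_inv]
        refine inv_anti₀ (by positivity) ?_
        simp only [hκ]
        rw [if_pos ⟨hj, hJj⟩]
        exact mul_le_mul_of_nonneg_left (by linarith) hmj.le

/-! ### Collapse of the multilevel sum; index weights and levels. -/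

/-- Multilevel quadrature is a sum of tensorized differences of the approximations. -/
theorem multilevelQuad_eq_sum {X : Type*} [NormedAddCommGroup X] [NormedSpace ℝ X]
    {l : (ℕ →₀ ℕ) → ℕ} {Λ : Finset (ℕ →₀ ℕ)} (hl : ∀ ν, 1 ≤ l ν → ν ∈ Λ)
    (hanti : ∀ μ ν, μ ≤ ν → l ν ≤ l μ) (v : ℕ → (ℕ → ℝ) → X) :
    multilevelQuad l v = ∑ ν ∈ Λ with 1 ≤ l ν, diffQuad ν (v (l ν)) := by
  have hset : ∀ j, 1 ≤ j → levelSet l j = ((Λ.filter fun ν => j ≤ l ν : Finset _) : Set _) := by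
    intro j hj
    ext ν
    simp only [levelSet, Set.mem_ofPred_eq, Finset.coe_filter]
    exact ⟨fun h => ⟨hl ν (hj.trans h), h⟩, fun h => h.2⟩
  have hquad : ∀ j, 1 ≤ j → ∀ f : (ℕ → ℝ) → X,
      smolyakQuad (levelSet l j) f = ∑ ν ∈ Λ with j ≤ l ν, diffQuad ν f := by
    intro j hj f
    rw [hset j hj, smolyakQuad_eq_sum_diffQuad]
    intro ν hν μ hμ
    rw [Finset.mem_filter] at hν ⊢
    have := hν.2.trans (hanti μ ν hμ)
    exact ⟨hl μ (hj.trans this), this⟩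
  have hterm : ∀ j ∈ Set.Ici (1 : ℕ), smolyakQuad (levelSet l j) (v j) -
      smolyakQuad (levelSet l (j + 1)) (v j) = ∑ ν ∈ Λ with l ν = j, diffQuad ν (v j) := by
    intro j hj
    rw [hquad j hj, hquad (j + 1) (Nat.succ_pos _), sub_eq_iff_eq_add, ← Finset.sum_union]
    · refine Finset.sum_congr ?_ fun _ _ => rfl
      ext ν
      simp only [Finset.mem_filter, Finset.mem_union]
      constructor
      · rintro ⟨h1, h2⟩
        rcases h2.eq_or_lt with h3 | h3
        · exact Or.inl ⟨h1, h3.symm⟩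
        · exact Or.inr ⟨h1, h3⟩
      · rintro (⟨h1, h2⟩ | ⟨h1, h2⟩)
        · exact ⟨h1, h2.ge⟩
        · exact ⟨h1, (Nat.le_succ j).trans h2⟩
    · rw [Finset.disjoint_left]
      intro ν h1 h2
      have h3 := (Finset.mem_filter.1 h1).2
      have h4 := (Finset.mem_filter.1 h2).2
      omega
  unfold multilevelQuad
  rw [finsum_mem_congr rfl hterm,
    finsum_mem_eq_sum_of_inter_support_eq (t := Finset.Icc 1 (Λ.sup l)) _ ?_]
  · rw [← Finset.sum_fiberwise_of_maps_to (s := Λ.filter fun ν => 1 ≤ l ν)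
      (t := Finset.Icc 1 (Λ.sup l)) (g := l) fun ν hν => ?_]
    · refine Finset.sum_congr rfl fun j hj => ?_
      have hj1 := (Finset.mem_Icc.1 hj).1
      rw [Finset.filter_filter]
      refine Finset.sum_congr (Finset.filter_congr fun ν _ => ?_) fun ν hν => ?_
      · exact ⟨fun h => ⟨h ▸ hj1, h⟩, fun h => h.2⟩
      · rw [(Finset.mem_filter.1 hν).2.2]
    · obtain ⟨h1, h2⟩ := Finset.mem_filter.1 hν
      exact Finset.mem_Icc.2 ⟨h2, Finset.le_sup h1⟩
  · ext j
    simp only [Set.mem_inter_iff, Set.mem_Ici, Function.mem_support, Finset.coe_Icc, Set.mem_Icc]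
    refine and_congr_left fun hne => ⟨fun h => ⟨h, ?_⟩, fun h => h.1⟩
    by_contra hj
    refine hne (Finset.sum_eq_zero fun ν hν => ?_)
    obtain ⟨h1, h2⟩ := Finset.mem_filter.1 hν
    exact absurd (h2 ▸ Finset.le_sup (f := l) h1) hj

section IndexWeight
variable {K r : ℝ} {ρ : ℕ → ℝ}

lemma indexWeight_factor_one_le (hr : 3 ≤ r) {ν : ℕ →₀ ℕ} {j : ℕ} (hj : j ∈ ν.support) :
    1 ≤ max 1 (K * ρ j) ^ 4 * (ν j : ℝ) ^ (r - 3) := by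
  have h1 : (1 : ℝ) ≤ ν j := by
    exact_mod_cast Nat.pos_of_ne_zero (Finsupp.mem_support_iff.1 hj)
  exact one_le_mul_of_one_le_of_one_le (one_le_pow₀ (le_max_left _ _))
    (Real.one_le_rpow h1 (by linarith))

lemma one_le_indexWeight (hr : 3 ≤ r) (ν : ℕ →₀ ℕ) : 1 ≤ indexWeight K r ρ ν :=
  Finset.one_le_prod fun _ hj => indexWeight_factor_one_le hr hj

lemma indexWeight_mono (hr : 3 ≤ r) {μ ν : ℕ →₀ ℕ} (h : μ ≤ ν) :
    indexWeight K r ρ μ ≤ indexWeight K r ρ ν := by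
  have hsub : μ.support ⊆ ν.support := Finsupp.support_mono h
  unfold indexWeight
  rw [← Finset.prod_sdiff hsub]
  have h1 : 1 ≤ ∏ j ∈ ν.support \ μ.support, max 1 (K * ρ j) ^ 4 * (ν j : ℝ) ^ (r - 3) :=
    Finset.one_le_prod fun j hj => indexWeight_factor_one_le hr (Finset.mem_sdiff.1 hj).1
  have h2 : ∏ j ∈ μ.support, max 1 (K * ρ j) ^ 4 * (μ j : ℝ) ^ (r - 3) ≤
      ∏ j ∈ μ.support, max 1 (K * ρ j) ^ 4 * (ν j : ℝ) ^ (r - 3) := by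
    refine Finset.prod_le_prod (fun j _ => by positivity) fun j _ => ?_
    refine mul_le_mul_of_nonneg_left ?_ (by positivity)
    exact Real.rpow_le_rpow (Nat.cast_nonneg _) (by exact_mod_cast h j) (by linarith)
  exact h2.trans (le_mul_of_one_le_left (Finset.prod_nonneg fun j _ => by positivity) h1)

lemma indexWeight_rpow (s : ℝ) (ν : ℕ →₀ ℕ) : indexWeight K r ρ ν ^ s =
    ∏ j ∈ ν.support, max 1 (K * ρ j) ^ (4 * s) * (ν j : ℝ) ^ ((r - 3) * s) := by
  unfold indexWeight
  rw [← Real.finsetProd_rpow _ _ fun j _ => by positivity]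
  refine Finset.prod_congr rfl fun j _ => ?_
  have h1 : 0 ≤ max 1 (K * ρ j) := zero_le_one.trans (le_max_left _ _)
  rw [Real.mul_rpow (by positivity) (by positivity), ← Real.rpow_natCast, ← Real.rpow_mul h1,
    ← Real.rpow_mul (Nat.cast_nonneg _)]
  norm_num

lemma summable_indexWeight_rpow {q : ℝ} (hs : Summable fun j => max 1 (K * ρ j) ^ (-q))
    (hq : 1 < (r - 3) * (q / 4)) : Summable fun ν => indexWeight K r ρ ν ^ (-(q / 4)) := by
  have h := summable_prod_support (fun j => by positivity) hs (fun n => by positivity)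
    (Real.summable_nat_rpow.2 (by linarith : -((r - 3) * (q / 4)) < -1))
  refine h.congr fun ν => ?_
  rw [indexWeight_rpow]
  refine Finset.prod_congr rfl fun j _ => ?_
  congr 2 <;> ring

lemma threshold_finite {c : (ℕ →₀ ℕ) → ℝ} (hc : ∀ ν, 0 < c ν) {s : ℝ} (hs0 : 0 < s)
    (hs : Summable fun ν => c ν ^ (-s)) {ε : ℝ} (hε : 0 < ε) : (threshold c ε).Finite := by
  have h1 : ∀ᶠ ν in cofinite, c ν ^ (-s) < ε ^ s :=
    hs.tendsto_cofinite_zero.eventually (gt_mem_nhds (Real.rpow_pos_of_pos hε s))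
  refine (Filter.eventually_cofinite.1 h1).subset fun ν hν => ?_
  simp only [Set.mem_ofPred_eq, not_lt]
  rw [Real.rpow_neg (hc ν).le, ← Real.inv_rpow (hc ν).le]
  exact Real.rpow_le_rpow hε.le hν hs0.le

lemma threshold_mem_of_le {c : (ℕ →₀ ℕ) → ℝ} (hc : ∀ ν, 0 < c ν)
    (hmono : ∀ μ ν, μ ≤ ν → c μ ≤ c ν) {ε : ℝ} {μ ν : ℕ →₀ ℕ} (h : μ ≤ ν)
    (hν : ν ∈ threshold c ε) : μ ∈ threshold c ε :=
  le_trans (show ε ≤ (c ν)⁻¹ from hν) (inv_anti₀ (hc μ) (hmono μ ν h))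

end IndexWeight

section Level
variable {w : ℕ → ℕ}

lemma bddAbove_work_le (hw : StrictMono w) (T : ℝ) : BddAbove {j : ℕ | (w j : ℝ) ≤ T} := by
  refine ⟨⌊T⌋₊, fun j hj => Nat.le_floor ?_⟩
  exact le_trans (by exact_mod_cast hw.le_apply) (show (w j : ℝ) ≤ T from hj)

lemma work_sSup_le (hw : StrictMono w) (hw0 : w 0 = 0) {T : ℝ} (hT : 0 ≤ T) :
    (w (sSup {j : ℕ | (w j : ℝ) ≤ T}) : ℝ) ≤ T :=
  Nat.sSup_mem (s := {j : ℕ | (w j : ℝ) ≤ T}) ⟨0, by simp [hw0, hT]⟩ (bddAbove_work_le hw T)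

lemma lt_work_sSup_succ (hw : StrictMono w) (T : ℝ) :
    T < w (sSup {j : ℕ | (w j : ℝ) ≤ T} + 1) := by
  by_contra h
  have := le_csSup (bddAbove_work_le hw T)
    (show sSup {j : ℕ | (w j : ℝ) ≤ T} + 1 ∈ {j : ℕ | (w j : ℝ) ≤ T} from not_lt.1 h)
  omega

lemma sSup_work_mono (hw : StrictMono w) (hw0 : w 0 = 0) {T T' : ℝ} (hT : 0 ≤ T) (h : T ≤ T') :
    sSup {j : ℕ | (w j : ℝ) ≤ T} ≤ sSup {j : ℕ | (w j : ℝ) ≤ T'} :=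
  csSup_le_csSup (bddAbove_work_le hw T') ⟨0, by simp [hw0, hT]⟩
    fun _ hj => le_trans (show _ ≤ T from hj) h

variable {c d : (ℕ →₀ ℕ) → ℝ} {q α ε : ℝ}

lemma targetWork_nonneg (hd : ∀ ν, 0 < d ν) (hε : 0 < ε) (ν : ℕ →₀ ℕ) :
    0 ≤ targetWork c d q α ε ν := by
  have h1 : 0 ≤ ∑ᶠ μ ∈ threshold c ε, d μ ^ (-1 / (1 + 2 * α)) :=
    finsum_nonneg fun μ => finsum_nonneg fun _ => (Real.rpow_pos_of_pos (hd μ) _).le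
  have h2 := Real.rpow_pos_of_pos (hd ν) (-1 / (1 + 2 * α))
  unfold targetWork; positivity

lemma targetWork_anti (hd : ∀ ν, 0 < d ν) (hmono : ∀ μ ν, μ ≤ ν → d μ ≤ d ν) (hα : 0 < α)
    (hε : 0 < ε) {μ ν : ℕ →₀ ℕ} (h : μ ≤ ν) :
    targetWork c d q α ε ν ≤ targetWork c d q α ε μ := by
  have h1 : 0 ≤ ∑ᶠ μ ∈ threshold c ε, d μ ^ (-1 / (1 + 2 * α)) :=
    finsum_nonneg fun μ => finsum_nonneg fun _ => (Real.rpow_pos_of_pos (hd μ) _).le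
  refine mul_le_mul_of_nonneg_right (mul_le_mul_of_nonneg_left ?_ (by positivity)) (by positivity)
  refine Real.rpow_le_rpow_of_nonpos (hd μ) (hmono μ ν h) ?_
  rw [neg_div]
  exact neg_nonpos.2 (by positivity)

/-- Levels that decrease in ν make every Γ_j downward closed, as the combination formula requires.
It follows from monotonicity of both weights. -/
lemma level_anti (hw : StrictMono w) (hw0 : w 0 = 0) (hc : ∀ ν, 0 < c ν) (hd : ∀ ν, 0 < d ν)
    (hcm : ∀ μ ν, μ ≤ ν → c μ ≤ c ν) (hdm : ∀ μ ν, μ ≤ ν → d μ ≤ d ν) (hα : 0 < α) (hε : 0 < ε)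
    (μ ν : ℕ →₀ ℕ) (h : μ ≤ ν) : level w c d q α ε ν ≤ level w c d q α ε μ := by
  unfold level
  split_ifs with h1 h2 h2
  · exact sSup_work_mono hw hw0 (targetWork_nonneg hd hε ν) (targetWork_anti hd hdm hα hε h)
  · exact absurd (threshold_mem_of_le hc hcm h h1) h2
  · exact Nat.zero_le _
  · exact le_rfl

end Level

/-! ### Error estimate. -/

section Sums
variable {ι : Type*} {c a : ι → ℝ}

/-- Cauchy-Schwarz with weights c_i, together with c_i⁻¹ = c_i^{-s} (c_i⁻¹)^{1-s} ≤ c_i^{-s}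
ε^{1-s}. It serves for the tail outside Λ_ε and, with ε = 1, for absolute summability. -/
lemma sum_le_of_inv_le {s : ℝ} (hc : ∀ i, 0 < c i) (hs : s ≤ 1)
    (hca : Summable fun i => c i * a i ^ 2) (hcs : Summable fun i => c i ^ (-s))
    {ε : ℝ} (hε : 0 < ε) (F : Finset ι) (hF : ∀ i ∈ F, (c i)⁻¹ ≤ ε) :
    ∑ i ∈ F, a i ≤ √(∑' i, c i * a i ^ 2) * √(∑' i, c i ^ (-s)) * ε ^ ((1 - s) / 2) := by
  have h1 : ∑ i ∈ F, a i = ∑ i ∈ F, (√(c i) * a i) * √((c i)⁻¹) := by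
    refine Finset.sum_congr rfl fun i _ => ?_
    rw [Real.sqrt_inv, mul_right_comm, mul_inv_cancel₀ (Real.sqrt_pos.2 (hc i)).ne', one_mul]
  have h2 : ∑ i ∈ F, (√(c i) * a i) ^ 2 ≤ ∑' i, c i * a i ^ 2 := by
    rw [Finset.sum_congr rfl fun i _ => by rw [mul_pow, Real.sq_sqrt (hc i).le]]
    exact hca.sum_le_tsum _ fun i _ => mul_nonneg (hc i).le (sq_nonneg _)
  have h3 : ∑ i ∈ F, √((c i)⁻¹) ^ 2 ≤ (∑' i, c i ^ (-s)) * ε ^ (1 - s) := by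
    have h4 : ∑ i ∈ F, √((c i)⁻¹) ^ 2 ≤ ∑ i ∈ F, c i ^ (-s) * ε ^ (1 - s) := by
      refine Finset.sum_le_sum fun i hi => ?_
      rw [Real.sq_sqrt (inv_nonneg.2 (hc i).le)]
      have h5 : (c i)⁻¹ = c i ^ (-s) * (c i)⁻¹ ^ (1 - s) := by
        rw [Real.inv_rpow (hc i).le, ← Real.rpow_neg (hc i).le, ← Real.rpow_add (hc i),
          ← Real.rpow_neg_one]
        congr 1; ring
      rw [h5]
      refine mul_le_mul_of_nonneg_left ?_ (Real.rpow_pos_of_pos (hc i) _).le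
      exact Real.rpow_le_rpow (inv_nonneg.2 (hc i).le) (hF i hi) (by linarith)
    rw [← Finset.sum_mul] at h4
    exact h4.trans (mul_le_mul_of_nonneg_right
      (hcs.sum_le_tsum _ fun i _ => (Real.rpow_pos_of_pos (hc i) _).le) (by positivity))
  rw [h1]
  refine (Real.sum_mul_le_sqrt_mul_sqrt F _ _).trans ?_
  rw [mul_assoc]
  refine mul_le_mul (Real.sqrt_le_sqrt h2) ?_ (Real.sqrt_nonneg _) (Real.sqrt_nonneg _)
  refine (Real.sqrt_le_sqrt h3).trans (le_of_eq ?_)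
  rw [Real.sqrt_mul (tsum_nonneg fun i => (Real.rpow_pos_of_pos (hc i) _).le),
    Real.sqrt_eq_rpow (ε ^ (1 - s)), ← Real.rpow_mul hε.le]
  congr 2; ring

/-- With S the normalizing sum, the target work raised to -α equals ε^e S^{-1/2} c_i^{1/2}
c_i^{-1/(2(1+2α))}. Cauchy-Schwarz pairs c_i^{1/2} a_i with the last factor, whose squares sum to S,
so S cancels. -/
lemma sum_rpow_target_mul_le {α e ε : ℝ} (hα : 0 < α) (hε : 0 < ε) (hc : ∀ i, 0 < c i)
    (hca : Summable fun i => c i * a i ^ 2) (Λ : Finset ι) :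
    ∑ i ∈ Λ, (ε ^ (-(e / α)) * c i ^ (-1 / (1 + 2 * α)) *
      (∑ j ∈ Λ, c j ^ (-1 / (1 + 2 * α))) ^ (1 / (2 * α))) ^ (-α) * a i ≤
      ε ^ e * √(∑' i, c i * a i ^ 2) := by
  set S := ∑ j ∈ Λ, c j ^ (-1 / (1 + 2 * α)) with hS
  rcases Λ.eq_empty_or_nonempty with rfl | hne
  · simp only [Finset.sum_empty]; positivity
  have hSpos : 0 < S := Finset.sum_pos (fun i _ => Real.rpow_pos_of_pos (hc i) _) hne
  have h1 : ∀ i, (ε ^ (-(e / α)) * c i ^ (-1 / (1 + 2 * α)) * S ^ (1 / (2 * α))) ^ (-α) * a i =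
      ε ^ e * (√S)⁻¹ * (√(c i) * a i * √(c i ^ (-1 / (1 + 2 * α)))) := by
    intro i
    have hci := hc i
    rw [Real.mul_rpow (by positivity) (by positivity), Real.mul_rpow (by positivity) (by positivity),
      ← Real.rpow_mul hε.le, ← Real.rpow_mul hci.le, ← Real.rpow_mul hSpos.le,
      Real.sqrt_eq_rpow, Real.sqrt_eq_rpow, Real.sqrt_eq_rpow, ← Real.rpow_mul hci.le,
      ← Real.rpow_neg hSpos.le]
    have e1 : -(e / α) * -α = e := by field_simp
    have e2 : c i ^ (-1 / (1 + 2 * α) * -α) =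
        c i ^ (1 / 2 : ℝ) * c i ^ (-1 / (1 + 2 * α) * (1 / 2)) := by
      rw [← Real.rpow_add hci]
      congr 1
      have : (1 + 2 * α) ≠ 0 := by positivity
      field_simp
      ring
    have e3 : 1 / (2 * α) * -α = -(1 / 2) := by field_simp
    rw [e1, e2, e3]
    ring
  rw [Finset.sum_congr rfl fun i _ => h1 i, ← Finset.mul_sum, mul_assoc]
  refine mul_le_mul_of_nonneg_left ?_ (by positivity)
  have h2 := Real.sum_mul_le_sqrt_mul_sqrt Λ (fun i => √(c i) * a i)
    (fun i => √(c i ^ (-1 / (1 + 2 * α))))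
  have h3 : ∑ i ∈ Λ, √(c i ^ (-1 / (1 + 2 * α))) ^ 2 = S :=
    Finset.sum_congr rfl fun i _ => Real.sq_sqrt (Real.rpow_pos_of_pos (hc i) _).le
  have h4 : ∑ i ∈ Λ, (√(c i) * a i) ^ 2 ≤ ∑' i, c i * a i ^ 2 := by
    rw [Finset.sum_congr rfl fun i _ => by rw [mul_pow, Real.sq_sqrt (hc i).le]]
    exact hca.sum_le_tsum _ fun i _ => mul_nonneg (hc i).le (sq_nonneg _)
  rw [h3] at h2
  rw [inv_mul_le_iff₀ (Real.sqrt_pos.2 hSpos), mul_comm (√S)]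
  exact h2.trans (mul_le_mul_of_nonneg_right (Real.sqrt_le_sqrt h4) (Real.sqrt_nonneg _))

lemma hasSum_ite_mem {E : Type*} [AddCommMonoid E] [TopologicalSpace E] [DecidableEq ι]
    (Λ : Finset ι) (f : ι → E) :
    HasSum (fun i => if i ∈ Λ then f i else 0) (∑ i ∈ Λ, f i) := by
  have : HasSum (fun i => if i ∈ Λ then f i else 0) (∑ i ∈ Λ, if i ∈ Λ then f i else 0) :=
    hasSum_sum_of_ne_finset_zero fun i hi => if_neg hi
  rwa [Finset.sum_congr rfl fun i hi => if_pos hi] at this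

lemma norm_sub_sum_le_of_tail_le {E : Type*} [NormedAddCommGroup E] [DecidableEq ι] {D V : ι → E}
    {x : E} (hD : HasSum D x) {Λ : Finset ι} {B g : ι → ℝ} {Z : ℝ}
    (hB : ∀ i ∈ Λ, ‖D i - V i‖ ≤ B i) (hg : ∀ i, ‖D i‖ ≤ g i)
    (hZ : ∀ F : Finset ι, (∀ i ∈ F, i ∉ Λ) → ∑ i ∈ F, g i ≤ Z) :
    ‖x - ∑ i ∈ Λ, V i‖ ≤ Z + ∑ i ∈ Λ, B i := by
  have hg₁0 : ∀ i, 0 ≤ if i ∈ Λ then 0 else g i := fun i => by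
    split_ifs
    · exact le_rfl
    · exact (norm_nonneg _).trans (hg i)
  have hg₁F : ∀ F : Finset ι, ∑ i ∈ F, (if i ∈ Λ then 0 else g i) ≤ Z := by
    intro F
    rw [← Finset.sum_filter_add_sum_filter_not F (· ∈ Λ),
      Finset.sum_eq_zero fun i hi => if_pos (Finset.mem_filter.1 hi).2, zero_add,
      Finset.sum_congr rfl fun i hi => if_neg (Finset.mem_filter.1 hi).2]
    exact hZ _ fun i hi => (Finset.mem_filter.1 hi).2
  have hg₁s := summable_of_sum_le hg₁0 hg₁F
  have hsub := hD.sub (hasSum_ite_mem Λ V)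
  have hnorm := tsum_of_norm_bounded (hg₁s.hasSum.add (hasSum_ite_mem Λ B))
    (f := fun i => D i - if i ∈ Λ then V i else 0) fun i => by
      by_cases hi : i ∈ Λ
      · simp only [if_pos hi, zero_add]; exact hB i hi
      · simp only [if_neg hi, add_zero, sub_zero]; exact hg i
  rw [hsub.tsum_eq] at hnorm
  exact hnorm.trans (add_le_add_left (hg₁s.tsum_le_of_sum_le hg₁F) _)

end Sums

/-- Rounding down to an available level loses only a constant: T < w_{l+1} ≤ K (1 + w_l) ≤ 2K max{1,
w_l}. The maximum covers w_0 = 0. -/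
lemma max_one_work_rpow_le {w : ℕ → ℕ} {K : ℝ} (hK : 1 ≤ K)
    (hw : ∀ l : ℕ, 1 ≤ l → (w l : ℝ) ≤ K * (1 + w (l - 1))) {l : ℕ} {T : ℝ} (hT : 0 < T)
    (hl : T < w (l + 1)) {α : ℝ} (hα : 0 < α) :
    (max 1 (w l : ℝ)) ^ (-α) ≤ (2 * K) ^ α * T ^ (-α) := by
  have h1 := hw (l + 1) (Nat.succ_pos l)
  rw [Nat.add_sub_cancel] at h1
  have h2 : 1 + (w l : ℝ) ≤ 2 * max 1 (w l : ℝ) := by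
    linarith [le_max_left (1 : ℝ) (w l), le_max_right (1 : ℝ) (w l)]
  have h3 : T / (2 * K) ≤ max 1 (w l : ℝ) := by
    rw [div_le_iff₀ (by positivity)]
    nlinarith
  refine (Real.rpow_le_rpow_of_nonpos (by positivity) h3 (by linarith)).trans (le_of_eq ?_)
  rw [Real.div_rpow hT.le (by positivity), Real.rpow_neg (by positivity : 0 ≤ 2 * K), div_inv_eq_mul,
    mul_comm]

section Assumption
variable {X : Type*} [NormedAddCommGroup X] [InnerProductSpace ℂ X]
  {w : ℕ → ℕ} {α p₁ p₂ ξ δ : ℝ} {b₁ b₂ : ℕ → ℝ} {u : (ℕ → ℝ) → X} {v : ℕ → (ℕ → ℝ) → X}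

/-- At level 0 nothing is subtracted and the bound for u itself applies; max{1, w_0} = 1 puts both
cases under one formula. -/
lemma MLAssumption.norm_diffQuad_sub_le (h : MLAssumption w α p₁ p₂ ξ δ b₁ b₂ u v)
    {A : (ℕ →₀ ℕ) → ℝ}
    (hA : ∀ (δ : ℝ) (f : (ℕ → ℝ) → X), 0 ≤ δ → IsHolo b₂ ξ δ f → ∀ ν, ‖diffQuad ν f‖ ≤ δ * A ν)
    (l : ℕ) (ν : ℕ →₀ ℕ) : ‖diffQuad ν u - if 1 ≤ l then diffQuad ν (v l) else 0‖ ≤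
      δ * (max 1 (w l : ℝ)) ^ (-α) * A ν := by
  split_ifs with hl
  · have h1 : 1 ≤ w l := by
      have := h.work.strictMono (Nat.lt_of_lt_of_le Nat.zero_lt_one hl)
      omega
    rw [max_eq_right (by exact_mod_cast h1), ← diffQuad_sub]
    exact hA _ _ (mul_nonneg h.δ_pos.le (by positivity)) (h.diff_holo₂ l hl) ν
  · have h0 : l = 0 := by omega
    rw [h0, h.work.zero]
    simpa using hA δ u h.δ_pos.le h.u_holo₂ ν

lemma div_one_sub_mono {p p' : ℝ} (h : p ≤ p') (h1 : p' < 1) : p / (1 - p) ≤ p' / (1 - p') := by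
  rw [div_le_div_iff₀ (by linarith) (by linarith)]
  nlinarith

/-- Error bound for the multilevel quadrature in terms of the threshold `ε`. -/
theorem MLAssumption.exists_error_bound [CompleteSpace X]
    (h : MLAssumption w α p₁ p₂ ξ δ b₁ b₂ u v) (hα : 0 < α)
    (hp₁ : p₁ < 4 / 5) (hp₂ : p₂ < 1) {q₁ : ℝ} (hq₁ : q₁ = p₁ / (1 - p₁)) {r : ℝ}
    (hr : 3 < r) (hr1 : 1 < (r - 3) * (q₁ / 4)) :
    ∃ C : ℝ, 0 < C ∧ ∀ ε : ℝ, 0 < ε →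
      ‖(∫ y, u y ∂gaussU) - multilevelQuad (level w (indexWeight 1 r (rhoSeq b₁ p₁ ξ))
        (indexWeight 1 r (rhoSeq b₂ p₂ ξ)) (q₁ / 2) α ε) v‖ ≤ C * ε ^ (1 / 2 - q₁ / 8) := by
  classical
  set c := indexWeight 1 r (rhoSeq b₁ p₁ ξ)
  set d := indexWeight 1 r (rhoSeq b₂ p₂ ξ)
  have hc1 : ∀ ν, 1 ≤ c ν := one_le_indexWeight hr.le
  have hc0 : ∀ ν, 0 < c ν := fun ν => one_pos.trans_le (hc1 ν)
  have hd0 : ∀ ν, 0 < d ν := fun ν => one_pos.trans_le (one_le_indexWeight hr.le ν)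
  have hcm : ∀ μ ν, μ ≤ ν → c μ ≤ c ν := fun _ _ => indexWeight_mono hr.le
  have hdm : ∀ μ ν, μ ≤ ν → d μ ≤ d ν := fun _ _ => indexWeight_mono hr.le
  have hp1 : p₁ < 1 := by linarith
  have hq0 : 0 < q₁ := by rw [hq₁]; exact div_pos h.p₁_pos (by linarith)
  have hq4 : q₁ < 4 := by
    rw [hq₁, div_lt_iff₀ (by linarith)]; linarith
  have hcs : Summable fun ν => c ν ^ (-(q₁ / 4)) := by
    refine summable_indexWeight_rpow (summable_rhoSeq_rpow h.b₁_pos h.b₁_summable h.p₁_pos h.ξ_pos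
      hq0.le ?_) hr1
    rw [hq₁, mul_div_cancel₀ _ (by linarith)]
  obtain ⟨A₁, hA₁0, hA₁s, hA₁⟩ :=
    exists_diffQuad_bound X h.b₁_pos h.b₁_summable h.p₁_pos hp1 h.ξ_pos r
  obtain ⟨A₂, hA₂0, hA₂s, hA₂⟩ := exists_diffQuad_bound X h.b₂_pos h.b₂_summable
    (h.p₁_pos.trans_le h.p₁_le_p₂) hp₂ h.ξ_pos r
  change Summable fun ν => c ν * A₁ ν ^ 2 at hA₁s
  change Summable fun ν => d ν * A₂ ν ^ 2 at hA₂s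
  obtain ⟨K, hK1, hK⟩ := h.work.growth
  set Z₁ := √(∑' ν, c ν * A₁ ν ^ 2) * √(∑' ν, c ν ^ (-(q₁ / 4))) with hZ₁
  set Z₂ := √(∑' ν, d ν * A₂ ν ^ 2) with hZ₂
  have hδ := h.δ_pos
  -- Since c ≥ 1, the tail estimate with ε = 1 covers every multi-index.
  have hA₁sum : Summable A₁ := summable_of_sum_le hA₁0 fun F =>
    sum_le_of_inv_le hc0 (by linarith) hA₁s hcs one_pos F fun ν _ => inv_le_one_of_one_le₀ (hc1 ν)
  have hu : HasSum (fun ν => diffQuad ν u) (∫ y, u y ∂gaussU) :=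
    h.u_holo₁.hasSum_diffQuad h.b₁_pos h.ξ_pos
      (Summable.of_nonneg_of_le (fun _ => norm_nonneg _) (hA₁ δ u hδ.le h.u_holo₁)
        (hA₁sum.mul_left δ))
  clear_value c d
  refine ⟨δ * Z₁ + δ * (2 * K) ^ α * Z₂ + 1, by positivity, fun ε hε => ?_⟩
  have hfin : (threshold c ε).Finite := threshold_finite hc0 (by positivity) hcs hε
  set Λ := hfin.toFinset with hΛ
  set l := level w c d (q₁ / 2) α ε with hl
  have hlΛ : ∀ ν, 1 ≤ l ν → ν ∈ Λ := by
    intro ν hν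
    rw [hΛ, Set.Finite.mem_toFinset]
    by_contra hn
    rw [hl, level, if_neg hn] at hν
    omega
  have hT : ∀ ν, targetWork c d (q₁ / 2) α ε ν = ε ^ (-((1 / 2 - q₁ / 8) / α)) *
      d ν ^ (-1 / (1 + 2 * α)) * (∑ μ ∈ Λ, d μ ^ (-1 / (1 + 2 * α))) ^ (1 / (2 * α)) := by
    intro ν
    rw [targetWork, finsum_mem_eq_finite_toFinset_sum _ hfin]
    congr 5; ring
  have hbulk : ∀ ν ∈ Λ, ‖diffQuad ν u - if 1 ≤ l ν then diffQuad ν (v (l ν)) else 0‖ ≤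
      δ * (2 * K) ^ α * (targetWork c d (q₁ / 2) α ε ν ^ (-α) * A₂ ν) := by
    intro ν hν
    refine (h.norm_diffQuad_sub_le hA₂ (l ν) ν).trans ?_
    have hTpos : 0 < targetWork c d (q₁ / 2) α ε ν := by
      rw [hT]
      have h1 : 0 < ∑ μ ∈ Λ, d μ ^ (-1 / (1 + 2 * α)) :=
        Finset.sum_pos (fun μ _ => Real.rpow_pos_of_pos (hd0 μ) _) ⟨ν, hν⟩
      have h2 := hd0 ν
      positivity
    have hlt : targetWork c d (q₁ / 2) α ε ν < w (l ν + 1) := by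
      rw [hl, level, if_pos (hfin.mem_toFinset.1 hν)]
      exact lt_work_sSup_succ h.work.strictMono _
    have h3 := max_one_work_rpow_le hK1 (fun l hl => (hK l hl).2.2) hTpos hlt hα
    have h4 := mul_le_mul_of_nonneg_left (mul_le_mul_of_nonneg_right h3 (hA₂0 ν)) hδ.le
    calc _ = δ * (max 1 (w (l ν) : ℝ) ^ (-α) * A₂ ν) := by ring
      _ ≤ _ := h4
      _ = _ := by ring
  have hanti : ∀ μ ν, μ ≤ ν → l ν ≤ l μ :=
    level_anti h.work.strictMono h.work.zero hc0 hd0 hcm hdm hα hε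
  rw [multilevelQuad_eq_sum hlΛ hanti, Finset.sum_filter]
  refine (norm_sub_sum_le_of_tail_le hu hbulk (hA₁ δ u hδ.le h.u_holo₁)
    (Z := δ * (Z₁ * ε ^ (1 / 2 - q₁ / 8))) fun F hF => ?_).trans ?_
  · rw [← Finset.mul_sum]
    refine mul_le_mul_of_nonneg_left ?_ hδ.le
    refine (sum_le_of_inv_le hc0 (by linarith : q₁ / 4 ≤ 1) hA₁s hcs hε F fun ν hν => ?_).trans
      (le_of_eq ?_)
    · have := hF ν hν
      rw [hΛ, Set.Finite.mem_toFinset] at this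
      exact (not_le.1 this).le
    · rw [← hZ₁]; congr 2; ring
  · have h2 : ∑ ν ∈ Λ, δ * (2 * K) ^ α * (targetWork c d (q₁ / 2) α ε ν ^ (-α) * A₂ ν) ≤
        δ * (2 * K) ^ α * (ε ^ (1 / 2 - q₁ / 8) * Z₂) := by
      rw [← Finset.mul_sum]
      refine mul_le_mul_of_nonneg_left ?_ (by positivity)
      rw [Finset.sum_congr rfl fun ν _ => by rw [hT ν]]
      exact sum_rpow_target_mul_le hα hε hd0 hA₂s Λ
    have h3 : 0 ≤ ε ^ (1 / 2 - q₁ / 8) := by positivity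
    linarith

end Assumption

/-! ### Exponents and work estimate. -/

section Exponents

/-- The exponent `θ ∈ (0, 1]` in the interpolation between the two families of weights. -/
def mixExponent (α q₂ : ℝ) : ℝ := min 1 (4 / (q₂ * (1 + 2 * α)))

/-- The growth exponent of the weighted sums over the threshold sets. -/
def sumExponent (α q₁ q₂ : ℝ) : ℝ := (1 - mixExponent α q₂) * (q₁ / 4)

/-- The growth exponent of the work. -/
def workExponent (α q₁ q₂ : ℝ) : ℝ :=
  (1 / 2 - q₁ / 8) / α + sumExponent α q₁ q₂ * (1 + 1 / (2 * α))

variable {α q₁ q₂ : ℝ}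

lemma mixExponent_pos (hα : 0 < α) (hq₂ : 0 < q₂) : 0 < mixExponent α q₂ :=
  lt_min one_pos (by positivity)

lemma mixExponent_le_one : mixExponent α q₂ ≤ 1 := min_le_left _ _

lemma mixExponent_mul_le (hα : 0 < α) (hq₂ : 0 < q₂) :
    mixExponent α q₂ * q₂ ≤ 4 / (1 + 2 * α) := by
  refine (mul_le_mul_of_nonneg_right (min_le_right _ _) hq₂.le).trans (le_of_eq ?_)
  field_simp

lemma sumExponent_nonneg (hq₁ : 0 < q₁) : 0 ≤ sumExponent α q₁ q₂ :=
  mul_nonneg (sub_nonneg.2 mixExponent_le_one) (by positivity)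

lemma workExponent_pos (hα : 0 < α) (hq₁ : 0 < q₁) (hq4 : q₁ < 4) :
    0 < workExponent α q₁ q₂ := by
  have h1 : 0 < (1 / 2 - q₁ / 8) / α := div_pos (by linarith) hα
  have h2 := sumExponent_nonneg (α := α) (q₂ := q₂) hq₁
  unfold workExponent; positivity

/-- The bracket is at least 1/(1+2α) and, since θ q₁ ≤ θ q₂ ≤ 4/(1+2α), also at least q₁/4. In r - 3
> 4/q₁ + 2(α+1) each summand then contributes at least 1. -/
lemma two_lt_exponent {r : ℝ} (hα : 0 < α) (hq₁ : 0 < q₁) (hq : q₁ ≤ q₂)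
    (hr : 4 * (1 + (α + 1) * q₁ / 2) / q₁ + 3 < r) :
    2 < (r - 3) * (1 / (1 + 2 * α) + sumExponent α q₁ q₂) := by
  have hq₂ := hq₁.trans_le hq
  set B := 1 / (1 + 2 * α) + sumExponent α q₁ q₂ with hB
  have h0 : 1 / (1 + 2 * α) ≤ B := le_add_of_nonneg_right (sumExponent_nonneg hq₁)
  have h1 : q₁ / 4 ≤ B := by
    have h2 := mixExponent_mul_le hα hq₂
    have h3 := mul_le_mul_of_nonneg_left hq (mixExponent_pos hα hq₂).le
    have h4 : 4 / (1 + 2 * α) = 4 * (1 / (1 + 2 * α)) := by ring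
    rw [hB, sumExponent]
    linarith
  have h5 : 4 / q₁ + 2 * (α + 1) < r - 3 := by
    have : 4 * (1 + (α + 1) * q₁ / 2) / q₁ = 4 / q₁ + 2 * (α + 1) := by field_simp; ring
    linarith
  have hBpos : 0 < B := lt_of_lt_of_le (by positivity) h1
  have h6 : 1 ≤ 4 / q₁ * B := by
    have := mul_le_mul_of_nonneg_left h1 (by positivity : 0 ≤ 4 / q₁)
    rwa [div_mul_div_cancel₀' (by norm_num) , div_self hq₁.ne'] at this
  have h7 : 1 ≤ 2 * (α + 1) * B := by
    have h8 := mul_le_mul_of_nonneg_left h0 (by positivity : 0 ≤ 2 * (α + 1))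
    have h9 : 1 ≤ 2 * (α + 1) * (1 / (1 + 2 * α)) := by
      rw [mul_one_div, le_div_iff₀ (by positivity)]; linarith
    exact h9.trans h8
  have h10 := mul_lt_mul_of_pos_right h5 hBpos
  linarith

lemma one_lt_exponent {r : ℝ} (hα : 0 < α) (hq₁ : 0 < q₁)
    (hr : 4 * (1 + (α + 1) * q₁ / 2) / q₁ + 3 < r) : 1 < (r - 3) * (q₁ / 4) := by
  have h1 : 4 * (1 + (α + 1) * q₁ / 2) / q₁ < r - 3 := by linarith
  rw [div_lt_iff₀ hq₁] at h1
  have : 0 < (α + 1) * q₁ := by positivity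
  linarith

/-- The convergence rate in terms of the exponents of the error and of the work. -/
lemma rate_le_div_workExponent {p₁ p₂ : ℝ} (hα : 0 < α) (hp₁ : 0 < p₁) (hp₁' : p₁ < 4 / 5)
    (hp₂ : 0 < p₂) (hp₂' : p₂ < 1) (hq₁ : q₁ = p₁ / (1 - p₁)) (hq₂ : q₂ = p₂ / (1 - p₂)) :
    min α (α * (2 / p₁ - 5 / 2) / (α + 2 / p₁ - 2 / p₂)) ≤
      (1 / 2 - q₁ / 8) / workExponent α q₁ q₂ := by
  have hq₁0 : 0 < q₁ := by rw [hq₁]; exact div_pos hp₁ (by linarith)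
  have hq₂0 : 0 < q₂ := by rw [hq₂]; exact div_pos hp₂ (by linarith)
  have hq4 : q₁ < 4 := by rw [hq₁, div_lt_iff₀ (by linarith)]; linarith
  have he : 0 < 1 / 2 - q₁ / 8 := by linarith
  have hω := workExponent_pos (α := α) (q₂ := q₂) hα hq₁0 hq4
  -- If θ = 1, the weighted sums stay bounded and the rate is α. Otherwise substituting 1/p_i = 1 +
  -- 1/q_i gives equality with the second entry of the minimum.
  rcases le_total 1 (4 / (q₂ * (1 + 2 * α))) with h | h
  · have h1 : workExponent α q₁ q₂ = (1 / 2 - q₁ / 8) / α := by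
      rw [workExponent, sumExponent, mixExponent, min_eq_left h]; ring
    rw [h1, div_div_cancel₀ he.ne']
    exact min_le_left _ _
  · refine (min_le_right _ _).trans (le_of_eq ?_)
    have e1 : 1 / p₁ = 1 + 1 / q₁ := by
      have : 1 - p₁ ≠ 0 := by linarith
      rw [hq₁]; field_simp; ring
    have e2 : 1 / p₂ = 1 + 1 / q₂ := by
      have : 1 - p₂ ≠ 0 := by linarith
      rw [hq₂]; field_simp; ring
    have e3 : 2 / p₁ - 5 / 2 = 4 / q₁ * (1 / 2 - q₁ / 8) := by
      have : 2 / p₁ = 2 * (1 / p₁) := by ring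
      rw [this, e1]; field_simp; ring
    have e4 : α + 2 / p₁ - 2 / p₂ = 4 / q₁ * (α * workExponent α q₁ q₂) := by
      have h1 : 2 / p₁ = 2 * (1 / p₁) := by ring
      have h2 : 2 / p₂ = 2 * (1 / p₂) := by ring
      rw [h1, h2, e1, e2, workExponent, sumExponent, mixExponent, min_eq_right h]
      have : 1 + 2 * α ≠ 0 := by positivity
      field_simp; ring
    rw [e3, e4]
    field_simp

end Exponents

/-- Weighted sums over the threshold sets. -/
lemma exists_sum_threshold_le {r α q₁ q₂ : ℝ} {ρ₁ ρ₂ : ℕ → ℝ} (hα : 0 < α) (hq₁ : 0 < q₁)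
    (hq₂ : 0 < q₂) (hr3 : 3 ≤ r) (hr : 2 < (r - 3) * (1 / (1 + 2 * α) + sumExponent α q₁ q₂))
    (h₁ : Summable fun j => max 1 (1 * ρ₁ j) ^ (-q₁))
    (h₂ : Summable fun j => max 1 (1 * ρ₂ j) ^ (-q₂)) :
    ∃ Z : ℝ, 0 < Z ∧ ∀ ε : ℝ, 0 < ε → ∀ Λ : Finset (ℕ →₀ ℕ),
      (∀ ν ∈ Λ, ν ∈ threshold (indexWeight 1 r ρ₁) ε) →
      ∑ ν ∈ Λ, (∏ j ∈ ν.support, (1 + (ν j : ℝ))) * indexWeight 1 r ρ₂ ν ^ (-1 / (1 + 2 * α)) ≤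
        Z * ε ^ (-sumExponent α q₁ q₂) := by
  set θ := mixExponent α q₂ with hθ
  set σ := sumExponent α q₁ q₂ with hσ
  have hθ0 : 0 < θ := mixExponent_pos hα hq₂
  have hθ1 : θ ≤ 1 := mixExponent_le_one
  have hσ0 : 0 ≤ σ := sumExponent_nonneg hq₁
  -- The weighted arithmetic-geometric mean inequality bounds each mixed power of the two weights by
  -- this summable combination. In `y`, the extra power of n accounts for 1 + ν_j ≤ 2 ν_j.
  set x : ℕ → ℝ := fun j => θ * max 1 (1 * ρ₂ j) ^ (-q₂) + (1 - θ) * max 1 (1 * ρ₁ j) ^ (-q₁) with hx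
  set y : ℕ → ℝ := fun n => 2 * (n : ℝ) ^ (1 - (r - 3) * (1 / (1 + 2 * α) + σ)) with hy
  have hx0 : ∀ j, 0 ≤ x j := fun j => by
    have : 0 ≤ 1 - θ := by linarith
    simp only [hx]; positivity
  have hy0 : ∀ n, 0 ≤ y n := fun n => by positivity
  have hs := summable_prod_support hx0 ((h₂.mul_left θ).add (h₁.mul_left (1 - θ))) hy0
    ((Real.summable_nat_rpow.2 (by linarith)).mul_left 2)
  have hterm : ∀ ν : ℕ →₀ ℕ, (∏ j ∈ ν.support, (1 + (ν j : ℝ))) *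
      indexWeight 1 r ρ₂ ν ^ (-1 / (1 + 2 * α)) * indexWeight 1 r ρ₁ ν ^ (-σ) ≤
      ∏ j ∈ ν.support, x j * y (ν j) := by
    intro ν
    rw [indexWeight_rpow, indexWeight_rpow, ← Finset.prod_mul_distrib, ← Finset.prod_mul_distrib]
    refine Finset.prod_le_prod (fun j _ => by positivity) fun j hj => ?_
    have hν1 : (1 : ℝ) ≤ ν j := by
      exact_mod_cast Nat.pos_of_ne_zero (Finsupp.mem_support_iff.1 hj)
    have hν0 : (0 : ℝ) < ν j := by linarith
    set m₁ := max 1 (1 * ρ₁ j)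
    set m₂ := max 1 (1 * ρ₂ j)
    have hm₁ : 1 ≤ m₁ := le_max_left _ _
    have hm₂ : 1 ≤ m₂ := le_max_left _ _
    have h3 : m₂ ^ (4 * (-1 / (1 + 2 * α))) * m₁ ^ (4 * -σ) ≤ x j := by
      refine le_trans ?_ (Real.geom_mean_le_arith_mean2_weighted hθ0.le (by linarith)
        (by positivity : 0 ≤ m₂ ^ (-q₂)) (by positivity : 0 ≤ m₁ ^ (-q₁)) (by ring))
      rw [← Real.rpow_mul (by linarith), ← Real.rpow_mul (by linarith)]
      refine mul_le_mul (Real.rpow_le_rpow_of_exponent_le hm₂ ?_)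
        (Real.rpow_le_rpow_of_exponent_le hm₁ ?_) (by positivity) (by positivity)
      · have := mixExponent_mul_le hα hq₂
        have e : 4 * (-1 / (1 + 2 * α)) = -(4 / (1 + 2 * α)) := by ring
        rw [e]; linarith
      · rw [hσ, sumExponent]; linarith
    have h4 : (1 + (ν j : ℝ)) * ((ν j : ℝ) ^ ((r - 3) * (-1 / (1 + 2 * α))) *
        (ν j : ℝ) ^ ((r - 3) * -σ)) ≤ y (ν j) := by
      have e : y (ν j) = (2 * (ν j : ℝ)) * ((ν j : ℝ) ^ ((r - 3) * (-1 / (1 + 2 * α))) *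
        (ν j : ℝ) ^ ((r - 3) * -σ)) := by
        simp only [hy]
        rw [← Real.rpow_add hν0, mul_assoc, ← Real.rpow_one_add' hν0.le]
        · congr 2; ring
        · have : 1 + ((r - 3) * (-1 / (1 + 2 * α)) + (r - 3) * -σ) =
              1 - (r - 3) * (1 / (1 + 2 * α) + σ) := by ring
          rw [this]; linarith
      rw [e]
      exact mul_le_mul_of_nonneg_right (by linarith) (by positivity)
    calc _ = (m₂ ^ (4 * (-1 / (1 + 2 * α))) * m₁ ^ (4 * -σ)) *
          ((1 + (ν j : ℝ)) * ((ν j : ℝ) ^ ((r - 3) * (-1 / (1 + 2 * α))) *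
            (ν j : ℝ) ^ ((r - 3) * -σ))) := by ring
      _ ≤ _ := mul_le_mul h3 h4 (by positivity) (hx0 j)
  refine ⟨∑' ν : ℕ →₀ ℕ, ∏ j ∈ ν.support, x j * y (ν j), ?_, fun ε hε Λ hΛ => ?_⟩
  · refine hs.tsum_pos (fun ν => Finset.prod_nonneg fun j _ => mul_nonneg (hx0 j) (hy0 _)) 0 ?_
    simp
  · refine le_trans (Finset.sum_le_sum (g := fun ν => (∏ j ∈ ν.support, x j * y (ν j)) * ε ^ (-σ))
      fun ν hν => ?_) ?_
    · have hc0 : 0 < indexWeight 1 r ρ₁ ν := one_pos.trans_le (one_le_indexWeight hr3 ν)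
      -- On the threshold set c_ν ε ≤ 1, so (c_ν ε)^{-σ} ≥ 1 may be inserted; it supplies the
      -- missing decay at the price ε^{-σ}.
      have h5 : 1 ≤ indexWeight 1 r ρ₁ ν ^ (-σ) * ε ^ (-σ) := by
        rw [← Real.mul_rpow hc0.le hε.le]
        refine Real.one_le_rpow_of_pos_of_le_one_of_nonpos (by positivity) ?_ (by linarith)
        have h6 : ε ≤ (indexWeight 1 r ρ₁ ν)⁻¹ := hΛ ν hν
        have := mul_le_mul_of_nonneg_left h6 hc0.le
        rwa [mul_inv_cancel₀ hc0.ne'] at this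
      have hd0 : 0 < indexWeight 1 r ρ₂ ν := one_pos.trans_le (one_le_indexWeight hr3 ν)
      have h7 : 0 ≤ (∏ j ∈ ν.support, (1 + (ν j : ℝ))) *
          indexWeight 1 r ρ₂ ν ^ (-1 / (1 + 2 * α)) :=
        mul_nonneg (Finset.prod_nonneg fun j _ => by positivity) (by positivity)
      refine (le_mul_of_one_le_right h7 h5).trans ?_
      rw [← mul_assoc]
      exact mul_le_mul_of_nonneg_right (hterm ν) (by positivity)
    · rw [← Finset.sum_mul]
      refine mul_le_mul_of_nonneg_right (hs.sum_le_tsum _ fun ν _ =>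
        Finset.prod_nonneg fun j _ => mul_nonneg (hx0 j) (hy0 _)) (by positivity)

/-- Work bound in terms of the target works. -/
lemma work_level_le {w : ℕ → ℕ} (hw : WorkSequence w) {K : ℝ} (hK1 : 1 ≤ K)
    (hK : ∀ l : ℕ, 1 ≤ l → (∑ j ∈ Finset.range (l + 1), (w j : ℝ)) ≤ K * w l)
    {c d : (ℕ →₀ ℕ) → ℝ} {q α ε : ℝ} (hd : ∀ ν, 0 < d ν) (hε : 0 < ε)
    (hfin : (threshold c ε).Finite) :
    work w (level w c d q α ε) ≤ ENNReal.ofReal (K * ∑ ν ∈ hfin.toFinset,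
      (∏ j ∈ ν.support, (1 + (ν j : ℝ))) * targetWork c d q α ε ν) := by
  have h0 : ∀ ν ∉ hfin.toFinset, (((∏ j ∈ ν.support, (1 + ν j)) *
      ∑ j ∈ Finset.Icc 1 (level w c d q α ε ν), w j : ℕ) : ENNReal) = 0 := by
    intro ν hν
    rw [hfin.mem_toFinset] at hν
    rw [level, if_neg hν]
    simp
  rw [work, tsum_eq_sum h0, ← Nat.cast_sum, ← ENNReal.ofReal_natCast]
  refine ENNReal.ofReal_le_ofReal ?_
  rw [Finset.mul_sum, Nat.cast_sum]
  refine Finset.sum_le_sum fun ν hν => ?_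
  have hT := targetWork_nonneg (c := c) (q := q) (α := α) hd hε ν
  push_cast
  rw [mul_left_comm]
  refine mul_le_mul_of_nonneg_left ?_ (Finset.prod_nonneg fun j _ => by positivity)
  have hl : (w (level w c d q α ε ν) : ℝ) ≤ targetWork c d q α ε ν := by
    rw [level, if_pos (hfin.mem_toFinset.1 hν)]
    exact work_sSup_le hw.strictMono hw.zero hT
  rcases Nat.eq_zero_or_pos (level w c d q α ε ν) with h1 | h1
  · rw [h1]; simp; positivity
  · calc _ ≤ ∑ j ∈ Finset.range (level w c d q α ε ν + 1), (w j : ℝ) := by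
          refine Finset.sum_le_sum_of_subset_of_nonneg (fun j hj => ?_) fun _ _ _ => Nat.cast_nonneg _
          rw [Finset.mem_range]
          exact Nat.lt_succ_of_le (Finset.mem_Icc.1 hj).2
      _ ≤ _ := hK _ h1
      _ ≤ _ := mul_le_mul_of_nonneg_left hl (by linarith)

/-- Work bound for the multilevel quadrature in terms of the threshold `ε`. -/
theorem MLAssumption.exists_work_bound {X : Type*} [NormedAddCommGroup X] [InnerProductSpace ℂ X]
    {w : ℕ → ℕ} {α p₁ p₂ ξ δ : ℝ} {b₁ b₂ : ℕ → ℝ} {u : (ℕ → ℝ) → X} {v : ℕ → (ℕ → ℝ) → X}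
    (h : MLAssumption w α p₁ p₂ ξ δ b₁ b₂ u v) (hα : 0 < α) (hp₂ : p₂ < 1)
    {q₁ q₂ : ℝ} (hq₁ : q₁ = p₁ / (1 - p₁)) (hq₂ : q₂ = p₂ / (1 - p₂)) {r : ℝ}
    (hr : 4 * (1 + (α + 1) * q₁ / 2) / q₁ + 3 < r) :
    ∃ C : ℝ, 0 < C ∧ ∀ ε : ℝ, 0 < ε →
      MLQuad.work w (level w (indexWeight 1 r (rhoSeq b₁ p₁ ξ)) (indexWeight 1 r (rhoSeq b₂ p₂ ξ))
        (q₁ / 2) α ε) ≤ ENNReal.ofReal (C * ε ^ (-workExponent α q₁ q₂)) := by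
  have hp1 : p₁ < 1 := h.p₁_le_p₂.trans_lt hp₂
  have hp2 : 0 < p₂ := h.p₁_pos.trans_le h.p₁_le_p₂
  have hq₁0 : 0 < q₁ := by rw [hq₁]; exact div_pos h.p₁_pos (by linarith)
  have hq₂0 : 0 < q₂ := by rw [hq₂]; exact div_pos hp2 (by linarith)
  have hq : q₁ ≤ q₂ := by rw [hq₁, hq₂]; exact div_one_sub_mono h.p₁_le_p₂ hp₂
  have hr3 : 3 < r := lt_trans (by have : 0 < 4 * (1 + (α + 1) * q₁ / 2) / q₁ := by positivity
                                   linarith) hr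
  have hs₁ : Summable fun j => max 1 (1 * rhoSeq b₁ p₁ ξ j) ^ (-q₁) :=
    summable_rhoSeq_rpow h.b₁_pos h.b₁_summable h.p₁_pos h.ξ_pos hq₁0.le
      (by rw [hq₁, mul_div_cancel₀ _ (by linarith)])
  have hs₂ : Summable fun j => max 1 (1 * rhoSeq b₂ p₂ ξ j) ^ (-q₂) :=
    summable_rhoSeq_rpow h.b₂_pos h.b₂_summable hp2 h.ξ_pos hq₂0.le
      (by rw [hq₂, mul_div_cancel₀ _ (by linarith)])
  obtain ⟨Z, hZ0, hZ⟩ := exists_sum_threshold_le hα hq₁0 hq₂0 hr3.le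
    (two_lt_exponent hα hq₁0 hq hr) hs₁ hs₂
  have hcs := summable_indexWeight_rpow hs₁ (one_lt_exponent hα hq₁0 hr)
  set c := indexWeight 1 r (rhoSeq b₁ p₁ ξ)
  set d := indexWeight 1 r (rhoSeq b₂ p₂ ξ)
  have hc0 : ∀ ν, 0 < c ν := fun ν => one_pos.trans_le (one_le_indexWeight hr3.le ν)
  have hd0 : ∀ ν, 0 < d ν := fun ν => one_pos.trans_le (one_le_indexWeight hr3.le ν)
  obtain ⟨K, hK1, hK⟩ := h.work.growth
  change ∀ ε : ℝ, 0 < ε → ∀ Λ : Finset (ℕ →₀ ℕ), (∀ ν ∈ Λ, ν ∈ threshold c ε) →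
      ∑ ν ∈ Λ, (∏ j ∈ ν.support, (1 + (ν j : ℝ))) * d ν ^ (-1 / (1 + 2 * α)) ≤
        Z * ε ^ (-sumExponent α q₁ q₂) at hZ
  clear_value c d
  refine ⟨K * Z ^ (1 + 1 / (2 * α)), by positivity, fun ε hε => ?_⟩
  have hfin : (threshold c ε).Finite := threshold_finite hc0 (by positivity) hcs hε
  refine (work_level_le h.work hK1 (fun l hl => (hK l hl).1) hd0 hε hfin).trans
    (ENNReal.ofReal_le_ofReal ?_)
  rw [mul_assoc]
  refine mul_le_mul_of_nonneg_left ?_ (by linarith)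
  set Λ := hfin.toFinset
  set S := ∑ ν ∈ Λ, d ν ^ (-1 / (1 + 2 * α)) with hS
  set P := ∑ ν ∈ Λ, (∏ j ∈ ν.support, (1 + (ν j : ℝ))) * d ν ^ (-1 / (1 + 2 * α)) with hP
  have hPZ : P ≤ Z * ε ^ (-sumExponent α q₁ q₂) := hZ ε hε Λ fun ν hν => hfin.mem_toFinset.1 hν
  have hS0 : 0 ≤ S := Finset.sum_nonneg fun ν _ => (Real.rpow_pos_of_pos (hd0 ν) _).le
  -- Because p_ν(1) ≥ 1, the bound for `P` also controls the normalizing sum `S` in the target work.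
  have hSP : S ≤ P := Finset.sum_le_sum fun ν _ =>
    le_mul_of_one_le_left (Real.rpow_pos_of_pos (hd0 ν) _).le
      (Finset.one_le_prod fun j _ => by linarith [Nat.cast_nonneg (α := ℝ) (ν j)])
  have hP0 : 0 ≤ P := hS0.trans hSP
  have e1 : ∑ ν ∈ Λ, (∏ j ∈ ν.support, (1 + (ν j : ℝ))) * targetWork c d (q₁ / 2) α ε ν =
      ε ^ (-((1 / 2 - q₁ / 8) / α)) * (S ^ (1 / (2 * α)) * P) := by
    rw [hP, Finset.mul_sum, Finset.mul_sum]
    refine Finset.sum_congr rfl fun ν _ => ?_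
    rw [targetWork, finsum_mem_eq_finite_toFinset_sum _ hfin, ← hS]
    have : q₁ / 2 / 4 = q₁ / 8 := by ring
    rw [this]; ring
  rw [e1]
  calc _ ≤ ε ^ (-((1 / 2 - q₁ / 8) / α)) * (P ^ (1 / (2 * α)) * P) := by gcongr
    _ = ε ^ (-((1 / 2 - q₁ / 8) / α)) * P ^ (1 + 1 / (2 * α)) := by
        rw [mul_comm (P ^ _), Real.rpow_one_add' hP0 (by positivity)]
    _ ≤ ε ^ (-((1 / 2 - q₁ / 8) / α)) *
          (Z * ε ^ (-sumExponent α q₁ q₂)) ^ (1 + 1 / (2 * α)) := by gcongr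
    _ = _ := by
        rw [Real.mul_rpow hZ0.le (by positivity), ← Real.rpow_mul hε.le, mul_left_comm,
          ← Real.rpow_add hε]
        congr 2
        rw [workExponent]; ring

end MLQuad

end


theorem theorem7p6 {X : Type*} [NormedAddCommGroup X] [InnerProductSpace ℂ X] [CompleteSpace X]
    [TopologicalSpace.SeparableSpace X]
    (w : ℕ → ℕ) (α p₁ p₂ ξ δ : ℝ) (b₁ b₂ : ℕ → ℝ)
    (u : (ℕ → ℝ) → X) (v : ℕ → (ℕ → ℝ) → X)
    (h : MLQuad.MLAssumption w α p₁ p₂ ξ δ b₁ b₂ u v)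
    (hα : 0 < α) (hp₁ : p₁ < 4 / 5) (hp₂ : p₂ < 1)
    (q₁ : ℝ) (hq₁ : q₁ = p₁ / (1 - p₁))
    (r : ℝ) (hr : 4 * (1 + (α + 1) * q₁ / 2) / q₁ + 3 < r)
    (R : ℝ) (hR : R = min α (α * (2 / p₁ - 5 / 2) / (α + 2 / p₁ - 2 / p₂))) :
    ∃ K : ℝ, 0 < K ∧ ∃ C : ℝ, 0 < C ∧ ∃ n₀ : ℕ, ∀ n : ℕ, 1 ≤ n →
      ∃ ε : ℝ, 0 < ε ∧ (n₀ ≤ n → ε ≤ 1) ∧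
        ∃ l : (ℕ →₀ ℕ) → ℕ,
          l = MLQuad.level w
            (MLQuad.indexWeight K r (MLQuad.rhoSeq b₁ p₁ ξ))
            (MLQuad.indexWeight K r (MLQuad.rhoSeq b₂ p₂ ξ)) (q₁ / 2) α ε ∧
          MLQuad.work w l ≤ (n : ENNReal) ∧
          ‖(∫ y, u y ∂MLQuad.gaussU) - MLQuad.multilevelQuad l v‖
            ≤ C * (1 + Real.log n) * (n : ℝ) ^ (-R) := by
  have hp₁0 := h.p₁_pos
  have hp₂0 := hp₁0.trans_le h.p₁_le_p₂
  have hq₁0 : 0 < q₁ := by rw [hq₁]; exact div_pos hp₁0 (by linarith)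
  have hq4 : q₁ < 4 := by rw [hq₁, div_lt_iff₀ (by linarith)]; linarith
  have hr3 : 3 < r := by
    have : 0 < 4 * (1 + (α + 1) * q₁ / 2) / q₁ := by positivity
    linarith
  obtain ⟨C, hC0, hC⟩ := h.exists_error_bound hα hp₁ hp₂ hq₁ hr3
    (MLQuad.one_lt_exponent hα hq₁0 hr)
  obtain ⟨W, hW0, hW⟩ := h.exists_work_bound hα hp₂ hq₁ rfl hr
  set ω := MLQuad.workExponent α q₁ (p₂ / (1 - p₂))
  have hω : 0 < ω := MLQuad.workExponent_pos hα hq₁0 hq4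
  have hRω : R ≤ (1 / 2 - q₁ / 8) / ω :=
    hR.le.trans (MLQuad.rate_le_div_workExponent hα hp₁0 hp₁ hp₂0 hp₂ hq₁ rfl)
  refine ⟨1, one_pos, C * W ^ ((1 / 2 - q₁ / 8) / ω), by positivity, ⌈W⌉₊, fun n hn => ?_⟩
  have hn1 : (1 : ℝ) ≤ n := by exact_mod_cast hn
  have hn0 : (0 : ℝ) < n := by linarith
  -- The solution of W ε^{-ω} = n; it is at most 1 exactly when n ≥ W, which explains n₀ = ⌈W⌉.
  set ε := (W / n) ^ (1 / ω) with hε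
  have hε0 : 0 < ε := by positivity
  refine ⟨ε, hε0, fun hWn => ?_, _, rfl, (hW ε hε0).trans (le_of_eq ?_), (hC ε hε0).trans ?_⟩
  · refine Real.rpow_le_one (by positivity) ?_ (by positivity)
    rw [div_le_one hn0]
    exact (Nat.le_ceil W).trans (by exact_mod_cast hWn)
  · rw [hε, ← Real.rpow_mul (by positivity), one_div_mul_eq_div, neg_div, div_self hω.ne',
      Real.rpow_neg_one, inv_div, mul_div_cancel₀ _ hW0.ne', ENNReal.ofReal_natCast]
  · rw [hε, ← Real.rpow_mul (by positivity), one_div_mul_eq_div,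
      Real.div_rpow hW0.le hn0.le, div_eq_mul_inv, ← Real.rpow_neg hn0.le, ← mul_assoc]
    refine mul_le_mul ?_ (Real.rpow_le_rpow_of_exponent_le hn1 (by linarith)) (by positivity)
      (by have := Real.log_nonneg hn1; positivity)
    -- The logarithmic factor enters only through 1 + log n ≥ 1.
    exact le_mul_of_one_le_right (by positivity) (by linarith [Real.log_nonneg hn1])
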